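/- Let $G_2$ be the group of invertible affine maps $[x,A]:z\mapsto x+Az$ of the plane ($x\in\mathbb R^2$ a column vector, $A\in \mathrm{GL}_2(\mathbb R)$), with product $[x,A][y,B]=[x+Ay,AB]$ and left Haar measure $$d\mu_{G_2}[x,A]=|\det A|^{-3}\,dx\,da_{11}\,da_{12}\,da_{21}\,da_{22}.$$ Let $K=\{[0,M]: M=\begin{pmatrix} s&-t\\ t&s\end{pmatrix},\ s^2+t^2>0\}\subseteq G_2$. For a nonzero row vector $\omega=(\omega_1,\omega_2)$ put $\|\omega\|^2=\omega_1^2+\omega_2^2$ and $\gamma(\omega)=\frac1{\|\omega\|^2}\begin{pmatrix}\omega_1&-\omega_2\\ \omega_2&\omega_1\end{pmatrix}$; then $\omega\mapsto[0,\gamma(\omega)]$ is a bijection of $\mathbb R^2\setminus\{0\}$ onto $K$. Equip $K$ with the Haar measure given by $\int_K f\,d\mu_K=\int_{\mathbb R^2\setminus\{0\}} f[0,\gamma(\omega)]\,\|\omega\|^{-2}\,d\omega$ and $\mathbb R^*=\mathbb R\setminus\{0\}$ with the Haar measure $dt/|t|$. For $A=\begin{pmatrix}a&b\\c&d\end{pmatrix}\in\mathrm{GL}_2(\mathbb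 R)$ and $\omega\ne0$ put $$u_{\omega,A}=\frac{(ac+bd)(\omega_1^2-\omega_2^2)-(a^2+b^2-c^2-d^2)\omega_1\omega_2}{\|\omega A\|^2},\qquad v_{\omega,A}=\frac{\det(A)\,\|\omega\|^2}{\|\omega A\|^2}.$$ Let $\sigma$ be the unitary representation of $G_2$ on $L^2(K,L^2(\mathbb R^*))$ given, for a.e. $\omega\neq 0$ and a.e. $t\in\mathbb R^*$, by $$\big(\sigma[x,A]F[0,\gamma(\omega)]\big)(t)=\frac{|\det A|^{1/2}\|\omega\|}{\|\omega A\|}\,e^{2\pi i(\omega x+t^{-1}u_{\omega,A})}\,\big(F[0,\gamma(\omega A)]\big)(v_{\omega,A}^{-1}t),$$ and for $f\in L^1(G_2)$ let $\sigma(f)$ be the bounded operator with $\langle\sigma(f)F,E\rangle=\int_{G_2}f(g)\langle\sigma(g)F,E\rangle\,d\mu_{G_2}(g)$ for all $F,E\in L^2(K,L^2(\mathbb R^*))$. Let $T$ be the operator $$\big((TF)[0,L]\big)(\nu)=|\det(L)\,\nu|^{-1/2}\big(F[0,L]\big)(\nu)\quad\text{for a.e. }([0,L],\nu)\in K\times\mathbb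 R^*,$$ with domain the set of all $F\in L^2(K,L^2(\mathbb R^*))$ for which the right-hand side again defines an element of $L^2(K,L^2(\mathbb R^*))$. Then $T$ is a (densely defined, unbounded) positive self-adjoint operator, and for every $f\in L^1(G_2)\cap L^2(G_2)$ the operator $\sigma(f)T$, defined on the domain of $T$, extends to a Hilbert–Schmidt operator $R$ on $L^2(K,L^2(\mathbb R^*))$ with $$\|f\|_{L^2(G_2)}=\|R\|_{\mathrm{HS}}.$$ That is, $\sum_j\|R\xi_j\|^2<\infty$ and $\|f\|_{L^2(G_2)}=\big(\sum_j\|R\xi_j\|^2\big)^{1/2}$ for every orthonormal basis $(\xi_j)$ of $L^2(K,L^2(\mathbb R^*))$. -/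

import Mathlib

open MeasureTheory
open scoped ENNReal NNReal

namespace AffinePlane

/-! ### The affine group of the plane -/

/-- The element `[x, A]` of `G₂`, i.e. the affine map `z ↦ x + A z` of the plane. -/
@[ext] structure G2 where
  x : Fin 2 → ℝ
  A : GL (Fin 2) ℝ

namespace G2

instance : Mul G2 := ⟨fun g h => ⟨g.x + (g.A : Matrix (Fin 2) (Fin 2) ℝ).mulVec h.x, g.A * h.A⟩⟩
instance : One G2 := ⟨⟨0, 1⟩⟩
instance : Inv G2 :=
  ⟨fun g => ⟨-((g.A⁻¹ : GL (Fin 2) ℝ) : Matrix (Fin 2) (Fin 2) ℝ).mulVec g.x, g.A⁻¹⟩⟩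

@[simp] theorem mul_x (g h : G2) :
    (g * h).x = g.x + (g.A : Matrix (Fin 2) (Fin 2) ℝ).mulVec h.x := rfl
@[simp] theorem mul_A (g h : G2) : (g * h).A = g.A * h.A := rfl
@[simp] theorem one_x : (1 : G2).x = 0 := rfl
@[simp] theorem one_A : (1 : G2).A = 1 := rfl
@[simp] theorem inv_x (g : G2) :
    (g⁻¹).x = -((g.A⁻¹ : GL (Fin 2) ℝ) : Matrix (Fin 2) (Fin 2) ℝ).mulVec g.x := rfl
@[simp] theorem inv_A (g : G2) : (g⁻¹).A = g.A⁻¹ := rfl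

instance : Group G2 := Group.ofLeftAxioms
  (fun a b c => by
    refine G2.ext ?_ (mul_assoc _ _ _)
    simp only [mul_x, mul_A, Units.val_mul, Matrix.mulVec_add, Matrix.mulVec_mulVec, add_assoc])
  (fun a => by ext1 <;> simp)
  (fun a => by ext1 <;> simp)

/-- The coordinates `(x, (a_{ij}))` of `[x, A]`, which identify `G₂` with the open subset
`{(x, a) | det a ≠ 0}` of `ℝ² × ℝ⁴`. -/
def coords (g : G2) : (Fin 2 → ℝ) × (Fin 2 → Fin 2 → ℝ) := (g.x, fun i j => g.A i j)

instance : TopologicalSpace G2 := .induced coords inferInstance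
instance : MeasurableSpace G2 := .comap coords inferInstance

theorem measurable_coords : Measurable coords := comap_measurable _

instance : BorelSpace G2 := ⟨by
  change MeasurableSpace.comap coords _ = _
  rw [BorelSpace.measurable_eq (α := (Fin 2 → ℝ) × (Fin 2 → Fin 2 → ℝ)), ← borel_comap]⟩

theorem coords_injective : Function.Injective coords := by
  intro g h e
  simp only [coords, Prod.mk.injEq] at e
  refine G2.ext e.1 (Units.ext ?_)
  ext i j
  exact congrFun (congrFun e.2 i) j

theorem range_coords : Set.range coords = {p | (Matrix.of p.2).det ≠ 0} := by
  ext p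
  constructor
  · rintro ⟨g, rfl⟩
    have : (Matrix.of (coords g).2) = (g.A : Matrix (Fin 2) (Fin 2) ℝ) := by ext i j; rfl
    change (Matrix.of (coords g).2).det ≠ 0
    rw [this]
    exact (Matrix.isUnits_det_units g.A).ne_zero
  · intro hp
    exact ⟨⟨p.1, Matrix.GeneralLinearGroup.mkOfDetNeZero _ hp⟩, rfl⟩

instance : SecondCountableTopology G2 :=
  (Topology.IsInducing.mk rfl : Topology.IsInducing coords).secondCountableTopology

theorem measurableEmbedding_coords : MeasurableEmbedding coords := by
  refine Topology.IsEmbedding.measurableEmbedding ⟨⟨rfl⟩, coords_injective⟩ ?_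
  rw [range_coords]
  have : Measurable fun p : (Fin 2 → ℝ) × (Fin 2 → Fin 2 → ℝ) => (Matrix.of p.2).det := by
    simp only [Matrix.det_fin_two, Matrix.of_apply]
    fun_prop
  exact this (measurableSet_singleton (0 : ℝ)).compl

/-- The left Haar measure of `G₂`, normalised as
`∫ f dμ = ∫_{GL₂(ℝ)} ∫_{ℝ²} f[x, A] dx dμ_{GL₂}(A) / |det A|` with
`dμ_{GL₂}(A) = da₁₁ da₁₂ da₂₁ da₂₂ / |det A|²`. -/
noncomputable def haar : Measure G2 :=
  (volume.comap coords).withDensity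
    fun g => ENNReal.ofReal (|(g.A : Matrix (Fin 2) (Fin 2) ℝ).det|⁻¹ ^ 3)

end G2

/-! ### Multiplicative group of the reals and its `L²` space -/

instance : BorelSpace ℝˣ := ⟨by
  change MeasurableSpace.comap (Units.val : ℝˣ → ℝ) _ = _
  rw [BorelSpace.measurable_eq (α := ℝ), ← borel_comap,
    ← (Units.isEmbedding_val₀ (G₀ := ℝ)).eq_induced]⟩

instance : SecondCountableTopology ℝˣ := Units.isEmbedding_val₀.secondCountableTopology
instance : TopologicalSpace.PseudoMetrizableSpace ℝˣ :=
  Units.isEmbedding_val₀.toIsInducing.pseudoMetrizableSpace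
instance : LocallyCompactSpace ℝˣ := Units.isOpenEmbedding_val.locallyCompactSpace

theorem measurableEmbedding_unitsVal : MeasurableEmbedding (Units.val : ℝˣ → ℝ) :=
  Units.isOpenEmbedding_val.measurableEmbedding

/-- Haar measure `dt / |t|` of the multiplicative group `ℝ* = ℝ \ {0}`. -/
noncomputable def haarRstar : Measure ℝˣ :=
  (volume.comap Units.val).withDensity fun t => ENNReal.ofReal |(t : ℝ)|⁻¹

instance : IsLocallyFiniteMeasure haarRstar := by
  have : IsFiniteMeasureOnCompacts ((volume : Measure ℝ).comap (Units.val : ℝˣ → ℝ)) :=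
    IsFiniteMeasureOnCompacts.comap' _ Units.continuous_val measurableEmbedding_unitsVal
  refine IsLocallyFiniteMeasure.withDensity_ofReal ?_
  exact (Units.continuous_val.abs).inv₀ fun t => abs_ne_zero.2 t.ne_zero

theorem lintegral_haarRstar (h : ℝ → ℝ≥0∞) (hh : Measurable h) :
    ∫⁻ t : ℝˣ, h t ∂haarRstar = ∫⁻ t : ℝ, ENNReal.ofReal |t|⁻¹ * h t := by
  have hm : Measurable fun t : ℝˣ => (t : ℝ) := measurableEmbedding_unitsVal.measurable
  rw [haarRstar, lintegral_withDensity_eq_lintegral_mul _ (by fun_prop) (g := fun t : ℝˣ => h t)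
    (hh.comp hm)]
  have := measurableEmbedding_unitsVal.lintegral_map (μ := volume.comap Units.val)
    (fun t : ℝ => ENNReal.ofReal |t|⁻¹ * h t)
  rw [measurableEmbedding_unitsVal.map_comap] at this
  simp only [Pi.mul_apply]
  rw [← this]
  have hr : Set.range (Units.val : ℝˣ → ℝ) = {0}ᶜ := by
    ext t; constructor
    · rintro ⟨u, rfl⟩; exact u.ne_zero
    · intro ht; exact ⟨Units.mk0 t ht, rfl⟩
  rw [hr, setLIntegral_congr (ae_eq_univ.2 (by simp)), setLIntegral_univ]

theorem map_mul_left_haarRstar (a : ℝˣ) : haarRstar.map (a * ·) = haarRstar := by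
  have hma : Measurable fun t : ℝˣ => a * t := measurable_const_mul a
  have hm : Measurable fun t : ℝˣ => (t : ℝ) := measurableEmbedding_unitsVal.measurable
  ext s hs
  obtain ⟨h, hh, hhs⟩ := measurableEmbedding_unitsVal.exists_measurable_extend
    (g := s.indicator (1 : ℝˣ → ℝ≥0∞)) (measurable_one.indicator hs) (fun _ => inferInstance)
  have hs' : ∀ t : ℝˣ, s.indicator (1 : ℝˣ → ℝ≥0∞) t = h t := fun t => (congrFun hhs t).symm
  rw [← lintegral_indicator_one hs, ← lintegral_indicator_one hs,
    lintegral_map (measurable_one.indicator hs) hma]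
  simp only [hs', Units.val_mul]
  rw [lintegral_haarRstar h hh, lintegral_haarRstar (fun t => h (a * t)) (by fun_prop)]
  have hF : Measurable fun t : ℝ => ENNReal.ofReal |t|⁻¹ * h t := by fun_prop
  have key := lintegral_map (μ := volume) hF (measurable_const_mul (a : ℝ))
  rw [Real.map_volume_mul_left a.ne_zero, lintegral_smul_measure] at key
  have ha : (0 : ℝ) < |(a : ℝ)| := abs_pos.2 a.ne_zero
  have e : ∀ t : ℝ, ENNReal.ofReal |t|⁻¹ * h (a * t)
      = ENNReal.ofReal |(a : ℝ)| * (ENNReal.ofReal |a * t|⁻¹ * h (a * t)) := by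
    intro t
    rw [← mul_assoc, ← ENNReal.ofReal_mul ha.le, abs_mul, mul_inv, mul_inv_cancel_left₀ ha.ne']
  simp only [e]
  rw [lintegral_const_mul _ (by fun_prop), ← key, abs_inv, smul_eq_mul, ← mul_assoc,
    ← ENNReal.ofReal_mul ha.le, mul_inv_cancel₀ ha.ne', ENNReal.ofReal_one, one_mul]

instance : haarRstar.IsMulLeftInvariant := ⟨map_mul_left_haarRstar⟩

section LpIsometry

variable {X E : Type*} [MeasurableSpace X] {μ : Measure X} [NormedAddCommGroup E] [NormedSpace ℂ E]

/-- A linear map on functions which respects a.e. equality, preserves measurability and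
preserves the `L²` norm induces a linear isometry of `L²`. -/
noncomputable def lpIsometry (Φ : (X → E) →ₗ[ℂ] (X → E))
    (hc : ∀ f g : X → E, f =ᵐ[μ] g → Φ f =ᵐ[μ] Φ g)
    (hm : ∀ f : X → E, StronglyMeasurable f → AEStronglyMeasurable (Φ f) μ)
    (hn : ∀ f : X → E, StronglyMeasurable f → eLpNorm (Φ f) 2 μ = eLpNorm f 2 μ) :
    Lp E 2 μ →ₗᵢ[ℂ] Lp E 2 μ :=
  have h : ∀ f : Lp E 2 μ, MemLp (Φ f) 2 μ := fun f =>
    ⟨hm f (Lp.stronglyMeasurable f), by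
      rw [hn f (Lp.stronglyMeasurable f)]; exact (Lp.memLp f).2⟩
  { toFun := fun f => (h f).toLp
    map_add' := fun f g => by
      rw [← MemLp.toLp_add, MemLp.toLp_eq_toLp_iff, ← map_add]
      exact hc _ _ (Lp.coeFn_add f g)
    map_smul' := fun c f => by
      rw [RingHom.id_apply, ← MemLp.toLp_const_smul, MemLp.toLp_eq_toLp_iff, ← map_smul]
      exact hc _ _ (Lp.coeFn_smul c f)
    norm_map' := fun f => by
      change ‖(h f).toLp‖ = ‖f‖
      rw [Lp.norm_toLp, hn f (Lp.stronglyMeasurable f), Lp.norm_def] }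

theorem lpIsometry_coe (Φ : (X → E) →ₗ[ℂ] (X → E))
    (hc : ∀ f g : X → E, f =ᵐ[μ] g → Φ f =ᵐ[μ] Φ g)
    (hm : ∀ f : X → E, StronglyMeasurable f → AEStronglyMeasurable (Φ f) μ)
    (hn : ∀ f : X → E, StronglyMeasurable f → eLpNorm (Φ f) 2 μ = eLpNorm f 2 μ)
    (f : Lp E 2 μ) : lpIsometry Φ hc hm hn f =ᵐ[μ] Φ f :=
  MemLp.coeFn_toLp (f := Φ f) ⟨hm f (Lp.stronglyMeasurable f), by
    rw [hn f (Lp.stronglyMeasurable f)]; exact (Lp.memLp f).2⟩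

end LpIsometry

/-- The Hilbert space `L²(ℝ*)`. -/
abbrev L2Rstar : Type := Lp ℂ 2 haarRstar

/-- The unimodular factor `e^{2πi r}`. -/
noncomputable def unitExp (r : ℝ) : ℂ := Complex.exp (2 * Real.pi * Complex.I * r)

theorem unitExp_add (r s : ℝ) : unitExp (r + s) = unitExp r * unitExp s := by
  rw [unitExp, unitExp, unitExp, ← Complex.exp_add]; push_cast; ring_nf

theorem norm_unitExp (r : ℝ) : ‖unitExp r‖ = 1 := by
  have : unitExp r = Complex.exp ((2 * Real.pi * r : ℝ) * Complex.I) := by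
    rw [unitExp]; push_cast; ring_nf
  rw [this, Complex.norm_exp_ofReal_mul_I]

theorem unitExp_zero : unitExp 0 = 1 := by simp [unitExp]

theorem continuous_unitExp : Continuous unitExp := by unfold unitExp; fun_prop

/-- `(π¹[u, v] f)(t) = e^{2πi t⁻¹ u} f(v⁻¹ t)`, on functions. -/
noncomputable def piOneFun (u : ℝ) (v : ℝˣ) : (ℝˣ → ℂ) →ₗ[ℂ] (ℝˣ → ℂ) where
  toFun f t := unitExp ((t : ℝ)⁻¹ * u) * f (v⁻¹ * t)
  map_add' f g := by ext t; simp [mul_add]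
  map_smul' c f := by ext t; simp; ring

theorem measurePreserving_mul_left (v : ℝˣ) :
    MeasurePreserving (fun t : ℝˣ => v * t) haarRstar haarRstar :=
  ⟨measurable_const_mul v, map_mul_left_haarRstar v⟩

theorem piOneFun_congr (u : ℝ) (v : ℝˣ) (f g : ℝˣ → ℂ) (h : f =ᵐ[haarRstar] g) :
    piOneFun u v f =ᵐ[haarRstar] piOneFun u v g := by
  filter_upwards [(measurePreserving_mul_left v⁻¹).quasiMeasurePreserving.ae h] with t ht
  simp [piOneFun, ht]

theorem measurable_unitExp_inv (u : ℝ) : Measurable fun t : ℝˣ => unitExp ((t : ℝ)⁻¹ * u) := by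
  have hm : Measurable fun t : ℝˣ => (t : ℝ) := measurableEmbedding_unitsVal.measurable
  exact continuous_unitExp.measurable.comp (by fun_prop)

/-- The unitary operator `π¹[u, v]` of `L²(ℝ*)`. -/
noncomputable def piOne (u : ℝ) (v : ℝˣ) : L2Rstar →ₗᵢ[ℂ] L2Rstar :=
  lpIsometry (piOneFun u v) (piOneFun_congr u v)
    (fun f hf => ((measurable_unitExp_inv u).mul
      (hf.measurable.comp (measurable_const_mul v⁻¹))).aestronglyMeasurable)
    (fun f hf => by
      rw [← eLpNorm_comp_measurePreserving hf.aestronglyMeasurable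
        (measurePreserving_mul_left v⁻¹)]
      refine eLpNorm_congr_norm_ae (.of_forall fun t => ?_)
      simp [piOneFun, norm_unitExp])

theorem piOne_coe (u : ℝ) (v : ℝˣ) (f : L2Rstar) :
    piOne u v f =ᵐ[haarRstar] piOneFun u v f := lpIsometry_coe _ _ _ _ _

attribute [irreducible] piOne

theorem piOne_mul (u u' : ℝ) (v v' : ℝˣ) (f : L2Rstar) :
    piOne u v (piOne u' v' f) = piOne (u + v * u') (v * v') f := by
  apply Lp.ext
  refine (piOne_coe _ _ _).trans (.trans (piOneFun_congr u v _ _ (piOne_coe u' v' f)) ?_)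
  refine .trans (.of_forall fun t => ?_) (piOne_coe _ _ _).symm
  simp only [piOneFun, LinearMap.coe_mk, AddHom.coe_mk, Units.val_mul, Units.val_inv_eq_inv_val,
    mul_inv_rev, inv_inv]
  rw [← mul_assoc, ← unitExp_add]
  congr 2
  · ring
  · rw [mul_assoc]

theorem piOne_zero_one (f : L2Rstar) : piOne 0 1 f = f := by
  apply Lp.ext
  refine (piOne_coe _ _ _).trans (.of_forall fun t => ?_)
  simp [piOneFun, unitExp_zero]

theorem continuous_piOne_left (f : L2Rstar) : Continuous fun u : ℝ => piOne u 1 f := by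
  rw [continuous_iff_continuousAt]
  intro u₀
  have key : Filter.Tendsto (fun u : ℝ => ∫⁻ t : ℝˣ,
      ‖(unitExp ((t : ℝ)⁻¹ * u) - unitExp ((t : ℝ)⁻¹ * u₀)) * f t‖ₑ ^ 2 ∂haarRstar)
      (nhds u₀) (nhds (∫⁻ _ : ℝˣ, 0 ∂haarRstar)) := by
    have hfm := (Lp.stronglyMeasurable f).measurable
    refine tendsto_lintegral_filter_of_dominated_convergence
      (fun t => (2 * ‖f t‖ₑ) ^ 2) (.of_forall fun u => ?_) (.of_forall fun u => ?_) ?_ ?_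
    · have h1 := measurable_unitExp_inv u
      have h2 := measurable_unitExp_inv u₀
      fun_prop
    · refine .of_forall fun t => ?_
      rw [enorm_mul]
      gcongr
      refine (enorm_sub_le).trans ?_
      rw [← ofReal_norm, ← ofReal_norm, norm_unitExp, norm_unitExp]
      norm_num
    · simp_rw [mul_pow]
      rw [lintegral_const_mul _ (by fun_prop)]
      refine ENNReal.mul_ne_top (by norm_num) ?_
      have := (Lp.memLp f).2
      rw [eLpNorm_lt_top_iff_lintegral_rpow_enorm_lt_top (by norm_num) (by norm_num)] at this
      simpa using this.ne
    · refine .of_forall fun t => ?_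
      have hc : Continuous fun u : ℝ =>
          ‖(unitExp ((t : ℝ)⁻¹ * u) - unitExp ((t : ℝ)⁻¹ * u₀)) * f t‖ₑ ^ 2 := by
        have h1 : Continuous fun u : ℝ => unitExp ((t : ℝ)⁻¹ * u) :=
          continuous_unitExp.comp (by fun_prop)
        fun_prop
      simpa using hc.tendsto u₀
  rw [ContinuousAt, Lp.tendsto_Lp_iff_tendsto_eLpNorm']
  have e : ∀ u : ℝ, eLpNorm ((piOne u 1 f : ℝˣ → ℂ) - (piOne u₀ 1 f : ℝˣ → ℂ)) 2 haarRstar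
      = (∫⁻ t : ℝˣ, ‖(unitExp ((t : ℝ)⁻¹ * u) - unitExp ((t : ℝ)⁻¹ * u₀)) * f t‖ₑ ^ 2
        ∂haarRstar) ^ (1 / 2 : ℝ) := by
    intro u
    rw [eLpNorm_eq_lintegral_rpow_enorm_toReal (by norm_num) (by norm_num)]
    simp only [ENNReal.toReal_ofNat, ENNReal.rpow_ofNat]
    congr 1
    refine lintegral_congr_ae ?_
    filter_upwards [piOne_coe u 1 f, piOne_coe u₀ 1 f] with t h1 h2
    simp only [Pi.sub_apply, h1, h2, piOneFun, LinearMap.coe_mk, AddHom.coe_mk, inv_one, one_mul,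
      sub_mul]
  simp only [e]
  rw [lintegral_zero] at key
  have := (ENNReal.continuous_rpow_const (y := (1 / 2 : ℝ))).tendsto 0 |>.comp key
  simpa [Function.comp_def] using this

theorem continuous_piOne :
    Continuous fun p : (ℝ × ℝˣ) × L2Rstar => piOne p.1.1 p.1.2 p.2 := by
  have e : ∀ (u : ℝ) (v : ℝˣ) (f : L2Rstar),
      piOne u v f = piOne u 1 (DomMulAct.mk v⁻¹ • f) := by
    intro u v f
    apply Lp.ext
    refine (piOne_coe _ _ _).trans (.symm ?_)
    refine (piOne_coe _ _ _).trans ((piOneFun_congr u 1 _ _ (DomMulAct.smul_Lp_ae_eq _ f)).trans ?_)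
    refine .of_forall fun t => ?_
    simp [piOneFun]
  have hD : Continuous fun p : (ℝ × ℝˣ) × L2Rstar => DomMulAct.mk p.1.2⁻¹ • p.2 := by
    have h1 : Continuous fun p : (ℝ × ℝˣ) × L2Rstar => (DomMulAct.mk p.1.2⁻¹ : ℝˣᵈᵐᵃ) :=
      DomMulAct.continuous_mk.comp (by fun_prop)
    have : Fact ((2 : ℝ≥0∞) ≠ ∞) := ⟨by norm_num⟩
    exact h1.smul continuous_snd
  have hM : Continuous fun p : ℝ × L2Rstar => piOne p.1 1 p.2 := by
    rw [continuous_iff_continuousAt]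
    rintro ⟨u₀, f₀⟩
    rw [ContinuousAt, tendsto_iff_norm_sub_tendsto_zero]
    have h1 : Filter.Tendsto (fun p : ℝ × L2Rstar => ‖p.2 - f₀‖ + ‖piOne p.1 1 f₀ - piOne u₀ 1 f₀‖)
        (nhds (u₀, f₀)) (nhds 0) := by
      have : Continuous fun p : ℝ × L2Rstar =>
          ‖p.2 - f₀‖ + ‖piOne p.1 1 f₀ - piOne u₀ 1 f₀‖ := by
        have := (continuous_piOne_left f₀).comp (continuous_fst (X := ℝ) (Y := L2Rstar))
        simp only [Function.comp_def] at this
        fun_prop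
      simpa using this.tendsto (u₀, f₀)
    refine squeeze_zero (fun _ => norm_nonneg _) (fun p => ?_) h1
    have : piOne p.1 1 p.2 - piOne u₀ 1 f₀
        = piOne p.1 1 (p.2 - f₀) + (piOne p.1 1 f₀ - piOne u₀ 1 f₀) := by
      rw [map_sub]; abel
    rw [this]
    exact (norm_add_le _ _).trans (by rw [LinearIsometry.norm_map])
  have h2 : Continuous fun p : (ℝ × ℝˣ) × L2Rstar =>
      ((p.1.1, DomMulAct.mk p.1.2⁻¹ • p.2) : ℝ × L2Rstar) :=
    (continuous_fst.comp continuous_fst).prodMk hD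
  have h3 := Continuous.comp (g := fun p : ℝ × L2Rstar => piOne p.1 1 p.2) hM h2
  refine Continuous.congr h3 fun p => ?_
  exact (e p.1.1 p.1.2 p.2).symm

/-! ### The subgroup `K` and its identification with the orbit `ℝ² \ {0}` -/

/-- The subgroup `K = {[0, M] | M = (s, -t; t, s), s² + t² > 0}` of `G₂`. -/
def K : Subgroup G2 where
  carrier := {g | g.x = 0 ∧ ∃ s t : ℝ, (g.A : Matrix (Fin 2) (Fin 2) ℝ) = !![s, -t; t, s]}
  mul_mem' := by
    rintro g h ⟨hg, s, t, hA⟩ ⟨hh, s', t', hB⟩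
    refine ⟨by simp [hg, hh], s * s' - t * t', t * s' + s * t', ?_⟩
    rw [G2.mul_A, Units.val_mul, hA, hB, Matrix.mul_fin_two]
    ext i j; fin_cases i <;> fin_cases j <;> simp <;> ring
  one_mem' := ⟨rfl, 1, 0, by rw [G2.one_A, Units.val_one, Matrix.one_fin_two]; simp⟩
  inv_mem' := by
    rintro g ⟨hg, s, t, hA⟩
    refine ⟨by simp [hg], s / (s ^ 2 + t ^ 2), -t / (s ^ 2 + t ^ 2), ?_⟩
    rw [G2.inv_A, Matrix.coe_units_inv, hA, Matrix.inv_def, Matrix.adjugate_fin_two_of,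
      Matrix.det_fin_two_of, Ring.inverse_eq_inv']
    ext i j; fin_cases i <;> fin_cases j <;> simp <;> ring

/-- The squared Euclidean norm `‖ω‖²` of a row vector. -/
def normSq (ω : Fin 2 → ℝ) : ℝ := ω 0 ^ 2 + ω 1 ^ 2

/-- The Euclidean norm `‖ω‖` of a row vector. -/
noncomputable def rowNorm (ω : Fin 2 → ℝ) : ℝ := √(normSq ω)

theorem normSq_pos {ω : Fin 2 → ℝ} (h : ω ≠ 0) : 0 < normSq ω := by
  unfold normSq
  by_contra hc
  apply h
  have h0 : ω 0 ^ 2 = 0 := by nlinarith [sq_nonneg (ω 0), sq_nonneg (ω 1)]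
  have h1 : ω 1 ^ 2 = 0 := by nlinarith [sq_nonneg (ω 0), sq_nonneg (ω 1)]
  ext i; fin_cases i
  · simpa using h0
  · simpa using h1

theorem normSq_nonneg (ω : Fin 2 → ℝ) : 0 ≤ normSq ω := by unfold normSq; positivity

theorem rowNorm_pos {ω : Fin 2 → ℝ} (h : ω ≠ 0) : 0 < rowNorm ω := Real.sqrt_pos.2 (normSq_pos h)

/-- The orbit `𝒪 = ℝ² \ {0}` of nonzero row vectors. -/
abbrev Orbit : Type := {ω : Fin 2 → ℝ // ω ≠ 0}

/-- The right action `ω ↦ ω A` on row vectors. -/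
def rowMul (ω : Orbit) (A : GL (Fin 2) ℝ) : Orbit :=
  ⟨Matrix.vecMul ω.1 (A : Matrix (Fin 2) (Fin 2) ℝ), fun h => ω.2 (by
    have := congrArg (fun w => Matrix.vecMul w ((A⁻¹ : GL (Fin 2) ℝ) : Matrix (Fin 2) (Fin 2) ℝ)) h
    simpa [Matrix.vecMul_vecMul] using this)⟩

theorem rowMul_mul (ω : Orbit) (A B : GL (Fin 2) ℝ) :
    rowMul ω (A * B) = rowMul (rowMul ω A) B := by
  apply Subtype.ext
  simp [rowMul, Matrix.vecMul_vecMul]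

theorem rowMul_one (ω : Orbit) : rowMul ω 1 = ω := by
  apply Subtype.ext
  simp [rowMul]

/-- The point `[0, γ(ω)]` of `K`, where `γ(ω) = ‖ω‖⁻² (ω₁, -ω₂; ω₂, ω₁)`. -/
noncomputable def gamma (ω : Orbit) : K :=
  ⟨⟨0, Matrix.GeneralLinearGroup.mkOfDetNeZero
      !![ω.1 0 / normSq ω.1, -(ω.1 1 / normSq ω.1); ω.1 1 / normSq ω.1, ω.1 0 / normSq ω.1] (by
        have h := normSq_pos ω.2
        rw [Matrix.det_fin_two_of]
        have : ω.1 0 / normSq ω.1 * (ω.1 0 / normSq ω.1)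
            - -(ω.1 1 / normSq ω.1) * (ω.1 1 / normSq ω.1) = (normSq ω.1)⁻¹ := by
          field_simp
          unfold normSq; ring
        rw [this]
        positivity)⟩, rfl, _, _, rfl⟩

/-- The inverse `γ⁻¹ : [0, L] ↦ (1, 0) L⁻¹` of `γ`, with values in row vectors. -/
noncomputable def freqVec (k : K) : Fin 2 → ℝ :=
  Matrix.vecMul ![1, 0] ((k.1.A⁻¹ : GL (Fin 2) ℝ) : Matrix (Fin 2) (Fin 2) ℝ)

theorem freqVec_eq (k : K) :
    freqVec k = ![k.1.A 0 0 / (k.1.A 0 0 ^ 2 + k.1.A 1 0 ^ 2),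
      k.1.A 1 0 / (k.1.A 0 0 ^ 2 + k.1.A 1 0 ^ 2)] := by
  obtain ⟨g, hg, s, t, hA⟩ := k
  rw [freqVec]
  simp only [Matrix.coe_units_inv, hA, Matrix.inv_def, Matrix.adjugate_fin_two_of,
      Matrix.det_fin_two_of, Ring.inverse_eq_inv']
  ext i; fin_cases i <;> simp [Matrix.vecMul, dotProduct] <;> ring

theorem freqVec_ne_zero (k : K) : freqVec k ≠ 0 := fun h => by
  have := congrArg (fun w => Matrix.vecMul w (k.1.A : Matrix (Fin 2) (Fin 2) ℝ)) h
  simp only [freqVec, Matrix.vecMul_vecMul, Units.inv_mul, Matrix.vecMul_one,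
    Matrix.zero_vecMul] at this
  simpa using congrFun this 0

/-- The inverse `γ⁻¹ : K → 𝒪` of `γ`. -/
noncomputable def freq (k : K) : Orbit := ⟨freqVec k, freqVec_ne_zero k⟩

theorem freq_gamma (ω : Orbit) : freq (gamma ω) = ω := by
  apply Subtype.ext
  have h := normSq_pos ω.2
  change freqVec (gamma ω) = ω.1
  rw [freqVec_eq]
  have e0 : ((gamma ω).1.A : Matrix (Fin 2) (Fin 2) ℝ) 0 0 = ω.1 0 / normSq ω.1 := rfl
  have e1 : ((gamma ω).1.A : Matrix (Fin 2) (Fin 2) ℝ) 1 0 = ω.1 1 / normSq ω.1 := rfl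
  rw [e0, e1]
  have : (ω.1 0 / normSq ω.1) ^ 2 + (ω.1 1 / normSq ω.1) ^ 2 = (normSq ω.1)⁻¹ := by
    field_simp; unfold normSq; ring
  rw [this]
  ext i; fin_cases i <;> simp <;> field_simp

theorem gamma_freq (k : K) : gamma (freq k) = k := by
  have h := normSq_pos (freqVec_ne_zero k)
  obtain ⟨g, hg, s, t, hA⟩ := k
  have e := freqVec_eq ⟨g, hg, s, t, hA⟩
  simp only [hA] at e
  have es : s / (s ^ 2 + t ^ 2) = freqVec ⟨g, hg, s, t, hA⟩ 0 := by rw [e]; simp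
  have et : t / (s ^ 2 + t ^ 2) = freqVec ⟨g, hg, s, t, hA⟩ 1 := by rw [e]; simp
  have hn : normSq (freqVec ⟨g, hg, s, t, hA⟩) = (s ^ 2 + t ^ 2)⁻¹ := by
    rw [normSq, ← es, ← et]
    rcases eq_or_ne (s ^ 2 + t ^ 2) 0 with h0 | h0
    · simp [h0]
    · field_simp
  have hst : s ^ 2 + t ^ 2 ≠ 0 := by rw [hn] at h; exact (inv_pos.1 h).ne'
  apply Subtype.ext
  refine G2.ext hg.symm (Units.ext (.trans ?_ hA.symm))
  change !![_, _; _, _] = _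
  simp only [freq, ← es, ← et, hn]
  ext i j; fin_cases i <;> fin_cases j <;> simp <;> field_simp

theorem measurable_entry (i j : Fin 2) :
    Measurable fun g : G2 => (g.A : Matrix (Fin 2) (Fin 2) ℝ) i j := by
  have := (measurable_pi_iff.1 (measurable_pi_iff.1 (measurable_snd.comp G2.measurable_coords) i) j)
  exact this

theorem measurable_x (i : Fin 2) : Measurable fun g : G2 => g.x i :=
  measurable_pi_iff.1 (measurable_fst.comp G2.measurable_coords) i

theorem measurable_freqVec : Measurable freqVec := by
  have h : ∀ i j, Measurable fun k : K => (k.1.A : Matrix (Fin 2) (Fin 2) ℝ) i j :=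
    fun i j => (measurable_entry i j).comp measurable_subtype_coe
  have h0 := h 0 0
  have h1 := h 1 0
  refine measurable_pi_iff.2 fun i => ?_
  simp only [freqVec_eq]
  fin_cases i
  · simp only [Fin.zero_eta, Matrix.cons_val_zero]; fun_prop
  · simp only [Fin.mk_one, Matrix.cons_val_one, Matrix.cons_val_zero]; fun_prop

theorem measurable_freq : Measurable freq := measurable_freqVec.subtype_mk

theorem measurable_gamma : Measurable gamma := by
  refine Measurable.subtype_mk ?_
  refine measurable_comap_iff.2 ?_
  refine Measurable.prodMk measurable_const ?_
  have h : ∀ i, Measurable fun ω : Orbit => ω.1 i :=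
    fun i => (measurable_pi_apply i).comp measurable_subtype_coe
  have h0 := h 0
  have h1 := h 1
  have hn : Measurable fun ω : Orbit => normSq ω.1 := (h0.pow_const 2).add (h1.pow_const 2)
  refine measurable_pi_iff.2 fun i => measurable_pi_iff.2 fun j => ?_
  fin_cases i <;> fin_cases j
  · exact h0.div hn
  · exact (h1.div hn).neg
  · exact h1.div hn
  · exact h0.div hn

theorem measurableEmbedding_freqVec : MeasurableEmbedding freqVec := by
  let e : K ≃ᵐ Orbit :=
    { toFun := freq, invFun := gamma, left_inv := gamma_freq, right_inv := freq_gamma,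
      measurable_toFun := measurable_freq, measurable_invFun := measurable_gamma }
  have hO : MeasurableSet {ω : Fin 2 → ℝ | ω ≠ 0} := (measurableSet_singleton 0).compl
  exact (MeasurableEmbedding.subtype_coe hO).comp e.measurableEmbedding

theorem range_freqVec : Set.range freqVec = {0}ᶜ := by
  ext ω; constructor
  · rintro ⟨k, rfl⟩; exact freqVec_ne_zero k
  · intro h; exact ⟨gamma ⟨ω, h⟩, congrArg Subtype.val (freq_gamma ⟨ω, h⟩)⟩

/-- Haar measure of `K`: `∫ f dμ_K = ∫_{ℝ² \ {0}} f[0, γ(ω)] dω / ‖ω‖²`. -/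
noncomputable def haarK : Measure K :=
  (volume.comap freqVec).withDensity fun k => ENNReal.ofReal (normSq (freqVec k))⁻¹

instance : SigmaFinite ((volume : Measure (Fin 2 → ℝ)).comap freqVec) :=
  SigmaFinite.of_map _ measurable_freqVec.aemeasurable (by
    rw [measurableEmbedding_freqVec.map_comap]; infer_instance)

instance : SFinite haarK := by unfold haarK; infer_instance

theorem measurable_normSq : Measurable normSq := by unfold normSq; fun_prop

theorem lintegral_haarK (h : (Fin 2 → ℝ) → ℝ≥0∞) (hh : Measurable h) :
    ∫⁻ k, h (freqVec k) ∂haarK = ∫⁻ ω, ENNReal.ofReal (normSq ω)⁻¹ * h ω := by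
  have hm := measurable_freqVec
  have hn := measurable_normSq
  rw [haarK, lintegral_withDensity_eq_lintegral_mul _ (by fun_prop) (g := fun k => h (freqVec k))
    (hh.comp hm)]
  have := measurableEmbedding_freqVec.lintegral_map (μ := volume.comap freqVec)
    (fun ω => ENNReal.ofReal (normSq ω)⁻¹ * h ω)
  rw [measurableEmbedding_freqVec.map_comap] at this
  simp only [Pi.mul_apply]
  rw [← this, range_freqVec, setLIntegral_congr (ae_eq_univ.2 (by simp)), setLIntegral_univ]

/-! ### The representation `σ` -/

/-- The factor `|det A|^{1/2} ‖ω‖ / ‖ω A‖`. -/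
noncomputable def weight (ω : Orbit) (A : GL (Fin 2) ℝ) : ℝ :=
  √|(A : Matrix (Fin 2) (Fin 2) ℝ).det| * rowNorm ω.1 / rowNorm (rowMul ω A).1

/-- `u_{ω,A} = ((ac+bd)(ω₁²-ω₂²) - (a²+b²-c²-d²) ω₁ω₂) / ‖ω A‖²` for `A = (a, b; c, d)`. -/
noncomputable def uCoef (ω : Orbit) (A : GL (Fin 2) ℝ) : ℝ :=
  ((A 0 0 * A 1 0 + A 0 1 * A 1 1) * (ω.1 0 ^ 2 - ω.1 1 ^ 2)
    - (A 0 0 ^ 2 + A 0 1 ^ 2 - A 1 0 ^ 2 - A 1 1 ^ 2) * (ω.1 0 * ω.1 1)) / normSq (rowMul ω A).1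

/-- `v_{ω,A} = det(A) ‖ω‖² / ‖ω A‖²`, a nonzero real number. -/
noncomputable def vCoef (ω : Orbit) (A : GL (Fin 2) ℝ) : ℝˣ :=
  Units.mk0 ((A : Matrix (Fin 2) (Fin 2) ℝ).det * normSq ω.1 / normSq (rowMul ω A).1)
    (div_ne_zero (mul_ne_zero (Matrix.isUnits_det_units A).ne_zero (normSq_pos ω.2).ne')
      (normSq_pos (rowMul ω A).2).ne')

theorem weight_mul (ω : Orbit) (A B : GL (Fin 2) ℝ) :
    weight ω (A * B) = weight ω A * weight (rowMul ω A) B := by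
  have h1 := (rowNorm_pos (rowMul ω A).2).ne'
  have h2 := (rowNorm_pos (rowMul (rowMul ω A) B).2).ne'
  simp only [weight, rowMul_mul, Units.val_mul, Matrix.det_mul, abs_mul,
    Real.sqrt_mul (abs_nonneg _)]
  field_simp

theorem vCoef_mul (ω : Orbit) (A B : GL (Fin 2) ℝ) :
    vCoef ω (A * B) = vCoef ω A * vCoef (rowMul ω A) B := by
  have h1 := (normSq_pos (rowMul ω A).2).ne'
  have h2 := (normSq_pos (rowMul (rowMul ω A) B).2).ne'
  apply Units.ext
  simp only [vCoef, rowMul_mul, Units.val_mul, Matrix.det_mul, Units.val_mk0]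
  field_simp

theorem uCoef_mul_aux (p₀ p₁ u v r s e f g h : ℝ) (hp₀ : p₀ = u * r - v * s)
    (hp₁ : p₁ = u * s + v * r) (hS : (r * e + s * g) ^ 2 + (r * f + s * h) ^ 2 ≠ 0) :
    ((p₀ * e + p₁ * g) * (r * e + s * g) + (p₀ * f + p₁ * h) * (r * f + s * h))
        / ((r * e + s * g) ^ 2 + (r * f + s * h) ^ 2)
      = u + v * (((e * g + f * h) * (r ^ 2 - s ^ 2)
        - (e ^ 2 + f ^ 2 - g ^ 2 - h ^ 2) * (r * s))
          / ((r * e + s * g) ^ 2 + (r * f + s * h) ^ 2)) := by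
  rw [hp₀, hp₁, eq_comm, ← mul_div_assoc, eq_div_iff hS, add_mul, div_mul_cancel₀ _ hS]
  ring

theorem uCoef_eq (ω : Orbit) (A : GL (Fin 2) ℝ) :
    uCoef ω A = ((ω.1 0 * A 1 0 - ω.1 1 * A 0 0) * (rowMul ω A).1 0
      + (ω.1 0 * A 1 1 - ω.1 1 * A 0 1) * (rowMul ω A).1 1) / normSq (rowMul ω A).1 := by
  have h0 : (rowMul ω A).1 0 = ω.1 0 * A 0 0 + ω.1 1 * A 1 0 := by
    simp [rowMul, Matrix.vecMul, dotProduct, Fin.sum_univ_two]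
  have h1 : (rowMul ω A).1 1 = ω.1 0 * A 0 1 + ω.1 1 * A 1 1 := by
    simp [rowMul, Matrix.vecMul, dotProduct, Fin.sum_univ_two]
  rw [uCoef, h0, h1]
  congr 1
  ring

theorem uCoef_mul (ω : Orbit) (A B : GL (Fin 2) ℝ) :
    uCoef ω (A * B) = uCoef ω A + vCoef ω A * uCoef (rowMul ω A) B := by
  have h1 := (normSq_pos (rowMul ω A).2).ne'
  have h2 := (normSq_pos (rowMul (rowMul ω A) B).2).ne'
  have e : ∀ (ω : Orbit) (A : GL (Fin 2) ℝ) (j : Fin 2),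
      (rowMul ω A).1 j = ω.1 0 * A 0 j + ω.1 1 * A 1 j := by
    intro ω A j
    simp [rowMul, Matrix.vecMul, dotProduct, Fin.sum_univ_two]
  have hp₀ : ω.1 0 * A 1 0 - ω.1 1 * A 0 0 = uCoef ω A * (rowMul ω A).1 0
      - (vCoef ω A : ℝ) * (rowMul ω A).1 1 := by
    rw [uCoef_eq, vCoef, Units.val_mk0]
    field_simp
    simp only [normSq, e, Matrix.det_fin_two]
    ring
  have hp₁ : ω.1 0 * A 1 1 - ω.1 1 * A 0 1 = uCoef ω A * (rowMul ω A).1 1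
      + (vCoef ω A : ℝ) * (rowMul ω A).1 0 := by
    rw [uCoef_eq, vCoef, Units.val_mk0]
    field_simp
    simp only [normSq, e, Matrix.det_fin_two]
    ring
  have key := uCoef_mul_aux _ _ (uCoef ω A) (vCoef ω A : ℝ) ((rowMul ω A).1 0) ((rowMul ω A).1 1)
    (B 0 0) (B 0 1) (B 1 0) (B 1 1) hp₀ hp₁ (by rwa [normSq, e _ B, e _ B] at h2)
  have hB : uCoef (rowMul ω A) B = _ / _ := rfl
  rw [hB, normSq, e _ B, e _ B, ← key, uCoef_eq ω (A * B), rowMul_mul, normSq, e _ B, e _ B]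
  simp only [Units.val_mul, Matrix.mul_apply, Fin.sum_univ_two]
  congr 1
  ring

/-- The Hilbert space `L²(K, L²(ℝ*))`. -/
abbrev HSigma : Type := Lp L2Rstar 2 haarK

/-- The action of `[x, A]` on functions `K → L²(ℝ*)`: with `[0, L] = [0, γ(ω)]`, it sends `F` to
`[0, γ(ω)] ↦ |det A|^{1/2} ‖ω‖ / ‖ω A‖ · e^{2πi ω x} π¹[u_{ω,A}, v_{ω,A}] F[0, γ(ω A)]`. -/
noncomputable def sigmaFun (g : G2) : (K → L2Rstar) →ₗ[ℂ] (K → L2Rstar) where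
  toFun F k := ((weight (freq k) g.A : ℂ) * unitExp (freqVec k ⬝ᵥ g.x)) •
    piOne (uCoef (freq k) g.A) (vCoef (freq k) g.A) (F (gamma (rowMul (freq k) g.A)))
  map_add' F G := by ext1 k; simp
  map_smul' c F := by ext1 k; simp [smul_smul, mul_comm]

theorem sigmaFun_apply (g : G2) (F : K → L2Rstar) (k : K) :
    sigmaFun g F k = ((weight (freq k) g.A : ℂ) * unitExp (freqVec k ⬝ᵥ g.x)) •
      piOne (uCoef (freq k) g.A) (vCoef (freq k) g.A) (F (gamma (rowMul (freq k) g.A))) := rfl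

theorem sigmaFun_mul (g h : G2) (F : K → L2Rstar) :
    sigmaFun g (sigmaFun h F) = sigmaFun (g * h) F := by
  funext k
  simp only [sigmaFun, LinearMap.coe_mk, AddHom.coe_mk, freq_gamma, map_smul, piOne_mul,
    G2.mul_A, rowMul_mul, weight_mul, uCoef_mul, vCoef_mul, G2.mul_x, smul_smul]
  congr 1
  have e : freqVec (gamma (rowMul (freq k) g.A))
      = Matrix.vecMul (freqVec k) (g.A : Matrix (Fin 2) (Fin 2) ℝ) :=
    congrArg Subtype.val (freq_gamma (rowMul (freq k) g.A))
  rw [dotProduct_add, unitExp_add, Matrix.dotProduct_mulVec, e]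
  push_cast
  ring

theorem sigmaFun_one (F : K → L2Rstar) : sigmaFun 1 F = F := by
  funext k
  have h1 : weight (freq k) 1 = 1 := by
    simp [weight, rowMul_one, (rowNorm_pos (freq k).2).ne']
  have h2 : uCoef (freq k) 1 = 0 := by simp [uCoef]
  have h3 : vCoef (freq k) 1 = 1 := by
    apply Units.ext
    simp [vCoef, rowMul_one, (normSq_pos (freq k).2).ne']
  simp only [sigmaFun, LinearMap.coe_mk, AddHom.coe_mk, G2.one_A, G2.one_x, h1, h2, h3, rowMul_one,
    gamma_freq, piOne_zero_one, dotProduct_zero, unitExp_zero, Complex.ofReal_one, mul_one]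
  exact one_smul ℂ (F k)

theorem measurable_det : Measurable fun g : G2 => (g.A : Matrix (Fin 2) (Fin 2) ℝ).det := by
  have h := measurable_entry
  have h00 := h 0 0
  have h01 := h 0 1
  have h10 := h 1 0
  have h11 := h 1 1
  simp only [Matrix.det_fin_two]
  fun_prop

theorem measurable_rowMul : Measurable fun p : G2 × K => rowMul (freq p.2) p.1.A := by
  refine Measurable.subtype_mk (measurable_pi_iff.2 fun j => ?_)
  have h : ∀ i j, Measurable fun p : G2 × K => (p.1.A : Matrix (Fin 2) (Fin 2) ℝ) i j :=
    fun i j => (measurable_entry i j).comp measurable_fst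
  have hf : ∀ i, Measurable fun p : G2 × K => freqVec p.2 i :=
    fun i => (measurable_pi_apply i).comp (measurable_freqVec.comp measurable_snd)
  have a := h 0 j
  have b := h 1 j
  have c := hf 0
  have d := hf 1
  simp only [Matrix.vecMul, dotProduct, Fin.sum_univ_two, freq]
  fun_prop

theorem stronglyMeasurable_sigmaFun (F : K → L2Rstar) (hF : StronglyMeasurable F) :
    StronglyMeasurable fun p : G2 × K => sigmaFun p.1 F p.2 := by
  have hA : ∀ i j, Measurable fun p : G2 × K => (p.1.A : Matrix (Fin 2) (Fin 2) ℝ) i j :=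
    fun i j => (measurable_entry i j).comp measurable_fst
  have h00 := hA 0 0
  have h01 := hA 0 1
  have h10 := hA 1 0
  have h11 := hA 1 1
  have hdet : Measurable fun p : G2 × K => (p.1.A : Matrix (Fin 2) (Fin 2) ℝ).det :=
    measurable_det.comp measurable_fst
  have hf : ∀ i, Measurable fun p : G2 × K => (freq p.2).1 i :=
    fun i => (measurable_pi_apply i).comp (measurable_freqVec.comp measurable_snd)
  have hf0 := hf 0
  have hf1 := hf 1
  have hx : ∀ i, Measurable fun p : G2 × K => p.1.x i :=
    fun i => (measurable_x i).comp measurable_fst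
  have hx0 := hx 0
  have hx1 := hx 1
  have hn : Measurable fun p : G2 × K => normSq (freq p.2).1 :=
    measurable_normSq.comp (measurable_freqVec.comp measurable_snd)
  have hnr : Measurable fun p : G2 × K => normSq (rowMul (freq p.2) p.1.A).1 :=
    measurable_normSq.comp (measurable_subtype_coe.comp measurable_rowMul)
  have hw : Measurable fun p : G2 × K => weight (freq p.2) p.1.A := by
    unfold weight rowNorm
    exact ((hdet.abs.sqrt).mul hn.sqrt).div hnr.sqrt
  have hu : Measurable fun p : G2 × K => uCoef (freq p.2) p.1.A := by
    unfold uCoef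
    refine Measurable.div ?_ hnr
    fun_prop
  have hv : Measurable fun p : G2 × K => vCoef (freq p.2) p.1.A :=
    measurable_comap_iff.2 ((hdet.mul hn).div hnr)
  have he : Measurable fun p : G2 × K => unitExp (freqVec p.2 ⬝ᵥ p.1.x) := by
    refine continuous_unitExp.measurable.comp ?_
    have : (fun p : G2 × K => freqVec p.2 ⬝ᵥ p.1.x)
        = fun p => (freq p.2).1 0 * p.1.x 0 + (freq p.2).1 1 * p.1.x 1 := by
      funext p; simp [dotProduct, Fin.sum_univ_two, freq]
    rw [this]
    fun_prop
  have hs : Measurable fun p : G2 × K =>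
      (weight (freq p.2) p.1.A : ℂ) * unitExp (freqVec p.2 ⬝ᵥ p.1.x) :=
    (Complex.measurable_ofReal.comp hw).mul he
  have hψ : Measurable fun p : G2 × K => gamma (rowMul (freq p.2) p.1.A) :=
    measurable_gamma.comp measurable_rowMul
  have hq : StronglyMeasurable fun p : G2 × K =>
      ((((uCoef (freq p.2) p.1.A), (vCoef (freq p.2) p.1.A)),
        F (gamma (rowMul (freq p.2) p.1.A))) : (ℝ × ℝˣ) × L2Rstar) :=
    (hu.stronglyMeasurable.prodMk hv.stronglyMeasurable).prodMk (hF.comp_measurable hψ)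
  have hr : StronglyMeasurable fun p : G2 × K =>
      piOne (uCoef (freq p.2) p.1.A) (vCoef (freq p.2) p.1.A)
        (F (gamma (rowMul (freq p.2) p.1.A))) :=
    Continuous.comp_stronglyMeasurable (g := fun q : (ℝ × ℝˣ) × L2Rstar => piOne q.1.1 q.1.2 q.2)
      continuous_piOne hq
  simp only [sigmaFun_apply]
  exact hs.stronglyMeasurable.smul hr

theorem sigmaFun_stronglyMeasurable (g : G2) (F : K → L2Rstar) (hF : StronglyMeasurable F) :
    StronglyMeasurable (sigmaFun g F) := by
  have h : Measurable fun k : K => (g, k) := measurable_const.prodMk measurable_id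
  have := (stronglyMeasurable_sigmaFun F hF).comp_measurable h
  exact this

theorem lintegral_weight (A : GL (Fin 2) ℝ) (G : K → ℝ≥0∞) (hG : Measurable G) :
    ∫⁻ k, ENNReal.ofReal (weight (freq k) A ^ 2) * G (gamma (rowMul (freq k) A)) ∂haarK
      = ∫⁻ k, G k ∂haarK := by
  obtain ⟨h, hh, hhG⟩ := measurableEmbedding_freqVec.exists_measurable_extend hG
    (fun _ => inferInstance)
  have hG' : ∀ k, G k = h (freqVec k) := fun k => (congrFun hhG k).symm
  have hd : (A : Matrix (Fin 2) (Fin 2) ℝ).det ≠ 0 := (Matrix.isUnits_det_units A).ne_zero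
  have hd' : 0 < |(A : Matrix (Fin 2) (Fin 2) ℝ).det| := abs_pos.2 hd
  have hn := measurable_normSq
  have hl : Measurable fun ω : Fin 2 → ℝ => Matrix.vecMul ω (A : Matrix (Fin 2) (Fin 2) ℝ) := by
    refine measurable_pi_iff.2 fun j => ?_
    simp only [Matrix.vecMul, dotProduct]
    fun_prop
  have e1 : ∀ k, ENNReal.ofReal (weight (freq k) A ^ 2) * G (gamma (rowMul (freq k) A))
      = (fun ω => ENNReal.ofReal (|(A : Matrix (Fin 2) (Fin 2) ℝ).det| * normSq ω
        / normSq (Matrix.vecMul ω (A : Matrix (Fin 2) (Fin 2) ℝ)))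
        * h (Matrix.vecMul ω (A : Matrix (Fin 2) (Fin 2) ℝ))) (freqVec k) := by
    intro k
    have e : freqVec (gamma (rowMul (freq k) A))
        = Matrix.vecMul (freqVec k) (A : Matrix (Fin 2) (Fin 2) ℝ) :=
      congrArg Subtype.val (freq_gamma (rowMul (freq k) A))
    rw [hG', e]
    simp only [weight, rowNorm, div_pow, mul_pow, Real.sq_sqrt (normSq_nonneg _),
      Real.sq_sqrt (abs_nonneg _)]
    rfl
  rw [lintegral_congr e1, lintegral_haarK (fun ω => ENNReal.ofReal
    (|(A : Matrix (Fin 2) (Fin 2) ℝ).det| * normSq ω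
      / normSq (Matrix.vecMul ω (A : Matrix (Fin 2) (Fin 2) ℝ)))
        * h (Matrix.vecMul ω (A : Matrix (Fin 2) (Fin 2) ℝ))) (by fun_prop)]
  simp only [hG']
  rw [lintegral_haarK _ hh]
  have e2 : ∀ ω : Fin 2 → ℝ, ENNReal.ofReal (normSq ω)⁻¹ *
      (ENNReal.ofReal (|(A : Matrix (Fin 2) (Fin 2) ℝ).det| * normSq ω
        / normSq (Matrix.vecMul ω (A : Matrix (Fin 2) (Fin 2) ℝ)))
        * h (Matrix.vecMul ω (A : Matrix (Fin 2) (Fin 2) ℝ)))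
      = ENNReal.ofReal |(A : Matrix (Fin 2) (Fin 2) ℝ).det| *
        ((fun η => ENNReal.ofReal (normSq η)⁻¹ * h η)
          (Matrix.toLin' (A : Matrix (Fin 2) (Fin 2) ℝ).transpose ω)) := by
    intro ω
    simp only [Matrix.toLin'_apply, Matrix.mulVec_transpose]
    rw [← mul_assoc, ← mul_assoc, ← ENNReal.ofReal_mul (inv_nonneg.2 (normSq_nonneg _)),
      ← ENNReal.ofReal_mul hd'.le]
    rcases eq_or_ne ω 0 with rfl | hω
    · simp [normSq]
    · have := (normSq_pos hω).ne'
      congr 2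
      field_simp
  simp only [e2]
  have hF : Measurable fun η : Fin 2 → ℝ => ENNReal.ofReal (normSq η)⁻¹ * h η := by fun_prop
  have hL : Measurable (Matrix.toLin' (A : Matrix (Fin 2) (Fin 2) ℝ).transpose) :=
    (LinearMap.continuous_of_finiteDimensional _).measurable
  have e3 := lintegral_map (μ := volume) hF hL
  have hFL := hF.comp hL
  simp only [Function.comp_def] at hFL
  rw [lintegral_const_mul _ hFL, ← e3,
    Real.map_matrix_volume_pi_eq_smul_volume_pi (by rwa [Matrix.det_transpose]),
    lintegral_smul_measure, Matrix.det_transpose, smul_eq_mul, ← mul_assoc,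
    ← ENNReal.ofReal_mul hd'.le, abs_inv, mul_inv_cancel₀ hd'.ne', ENNReal.ofReal_one, one_mul]

theorem weight_pos (ω : Orbit) (A : GL (Fin 2) ℝ) : 0 < weight ω A := by
  unfold weight
  have h1 := rowNorm_pos ω.2
  have h2 := rowNorm_pos (rowMul ω A).2
  have h3 := Real.sqrt_pos.2 (abs_pos.2 (Matrix.isUnits_det_units A).ne_zero)
  positivity

theorem measurable_rowMul_right (A : GL (Fin 2) ℝ) :
    Measurable fun k : K => rowMul (freq k) A := by
  refine Measurable.subtype_mk (measurable_pi_iff.2 fun j => ?_)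
  have hf : ∀ i, Measurable fun k : K => freqVec k i :=
    fun i => (measurable_pi_apply i).comp measurable_freqVec
  have c := hf 0
  have d := hf 1
  simp only [Matrix.vecMul, dotProduct, Fin.sum_univ_two, freq]
  fun_prop

theorem measurable_gamma_rowMul (A : GL (Fin 2) ℝ) :
    Measurable fun k : K => gamma (rowMul (freq k) A) :=
  measurable_gamma.comp (measurable_rowMul_right A)

theorem measurable_weight (A : GL (Fin 2) ℝ) : Measurable fun k : K => weight (freq k) A := by
  have h1 : Measurable fun k : K => normSq (freq k).1 := measurable_normSq.comp measurable_freqVec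
  have h2 : Measurable fun k : K => normSq (rowMul (freq k) A).1 :=
    measurable_normSq.comp (measurable_subtype_coe.comp (measurable_rowMul_right A))
  unfold weight rowNorm
  exact (measurable_const.mul h1.sqrt).div h2.sqrt

theorem quasiMeasurePreserving_gamma_rowMul (A : GL (Fin 2) ℝ) :
    Measure.QuasiMeasurePreserving (fun k : K => gamma (rowMul (freq k) A)) haarK haarK := by
  have hψ := measurable_gamma_rowMul A
  refine ⟨hψ, Measure.AbsolutelyContinuous.mk fun s hs h0 => ?_⟩
  have hw := measurable_weight A
  have hs1 : Measurable (s.indicator (1 : K → ℝ≥0∞)) := measurable_one.indicator hs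
  have hs2 : Measurable fun k : K => ENNReal.ofReal (weight (freq k) A ^ 2)
      * s.indicator (1 : K → ℝ≥0∞) (gamma (rowMul (freq k) A)) :=
    (by fun_prop : Measurable fun k : K => ENNReal.ofReal (weight (freq k) A ^ 2)).mul
      (hs1.comp hψ)
  have key := lintegral_weight A (s.indicator 1) hs1
  rw [lintegral_indicator_one hs, h0, lintegral_eq_zero_iff hs2] at key
  rw [Measure.map_apply hψ hs, ← compl_mem_ae_iff]
  filter_upwards [key] with k hk hks
  have hpos := weight_pos (freq k) A
  have hks' : gamma (rowMul (freq k) A) ∈ s := hks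
  rw [Set.indicator_of_mem hks'] at hk
  simp only [Pi.one_apply, mul_one, Pi.zero_apply, ENNReal.ofReal_eq_zero] at hk
  exact absurd hk (not_le.2 (by positivity))

theorem sigmaFun_congr (g : G2) (F F' : K → L2Rstar) (h : F =ᵐ[haarK] F') :
    sigmaFun g F =ᵐ[haarK] sigmaFun g F' := by
  have h' : ∀ᵐ k ∂haarK, F (gamma (rowMul (freq k) g.A)) = F' (gamma (rowMul (freq k) g.A)) :=
    (quasiMeasurePreserving_gamma_rowMul g.A).ae h
  filter_upwards [h'] with k hk
  rw [sigmaFun_apply, sigmaFun_apply, hk]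

theorem eLpNorm_sigmaFun (g : G2) (F : K → L2Rstar) (hF : StronglyMeasurable F) :
    eLpNorm (sigmaFun g F) 2 haarK = eLpNorm F 2 haarK := by
  rw [eLpNorm_eq_lintegral_rpow_enorm_toReal (by norm_num) (by norm_num),
    eLpNorm_eq_lintegral_rpow_enorm_toReal (by norm_num) (by norm_num)]
  congr 1
  simp only [ENNReal.toReal_ofNat, ENNReal.rpow_ofNat]
  rw [← lintegral_weight g.A (fun k => ‖F k‖ₑ ^ 2) (hF.enorm.pow_const 2)]
  refine lintegral_congr fun k => ?_
  have hpos : 0 ≤ weight (freq k) g.A := (weight_pos _ _).le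
  rw [sigmaFun_apply, enorm_smul, enorm_mul, ← ofReal_norm (unitExp _), norm_unitExp, ENNReal.ofReal_one, mul_one,
    mul_pow, ← ofReal_norm, Complex.norm_real, Real.norm_of_nonneg hpos, ENNReal.ofReal_pow hpos,
    ← ofReal_norm, LinearIsometry.norm_map, ofReal_norm]

/-- The isometry `σ[x, A]`. -/
noncomputable def sigmaIsometry (g : G2) : HSigma →ₗᵢ[ℂ] HSigma :=
  lpIsometry (sigmaFun g) (sigmaFun_congr g)
    (fun F hF => (sigmaFun_stronglyMeasurable g F hF).aestronglyMeasurable) (eLpNorm_sigmaFun g)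

theorem sigmaIsometry_coe (g : G2) (F : HSigma) : sigmaIsometry g F =ᵐ[haarK] sigmaFun g F :=
  lpIsometry_coe _ _ _ _ _

attribute [irreducible] sigmaIsometry

theorem sigmaIsometry_mul (g h : G2) (F : HSigma) :
    sigmaIsometry (g * h) F = sigmaIsometry g (sigmaIsometry h F) := by
  apply Lp.ext
  refine (sigmaIsometry_coe _ _).trans (.trans ?_ (sigmaIsometry_coe _ _).symm)
  rw [← sigmaFun_mul]
  exact sigmaFun_congr g _ _ (sigmaIsometry_coe h F).symm

theorem sigmaIsometry_one (F : HSigma) : sigmaIsometry 1 F = F := by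
  apply Lp.ext
  refine (sigmaIsometry_coe _ _).trans ?_
  rw [sigmaFun_one]

/-- The unitary operator `σ[x, A]`. -/
noncomputable def sigmaUnitary (g : G2) : HSigma ≃ₗᵢ[ℂ] HSigma where
  toFun := sigmaIsometry g
  invFun := sigmaIsometry g⁻¹
  map_add' := map_add _
  map_smul' := map_smul _
  left_inv F := by rw [← sigmaIsometry_mul, inv_mul_cancel, sigmaIsometry_one]
  right_inv F := by rw [← sigmaIsometry_mul, mul_inv_cancel, sigmaIsometry_one]
  norm_map' F := (sigmaIsometry g).norm_map F

theorem sigmaUnitary_apply (g : G2) (F : HSigma) : sigmaUnitary g F = sigmaIsometry g F := rfl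

/-- The unitary representation `σ` of `G₂` on `L²(K, L²(ℝ*))`. -/
noncomputable def sigma : G2 →* (HSigma ≃ₗᵢ[ℂ] HSigma) where
  toFun := sigmaUnitary
  map_one' := LinearIsometryEquiv.ext fun F => sigmaIsometry_one F
  map_mul' g h := LinearIsometryEquiv.ext fun F => sigmaIsometry_mul g h F

theorem sigma_eq (g : G2) (F : HSigma) : sigma g F = sigmaIsometry g F := rfl

/-- The pointwise formula for `σ`: for a.e. `[0, γ(ω)] ∈ K` and a.e. `t ∈ ℝ*`,
`(σ[x, A] F [0, γ(ω)])(t) = |det A|^{1/2} ‖ω‖ / ‖ω A‖ · e^{2πi (ω x + t⁻¹ u_{ω,A})} ·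
(F [0, γ(ω A)])(v_{ω,A}⁻¹ t)`. -/
theorem sigma_apply (g : G2) (F : HSigma) :
    ∀ᵐ k ∂haarK, ∀ᵐ (t : ℝˣ) ∂haarRstar, sigma g F k t =
      (weight (freq k) g.A : ℂ)
        * unitExp ((freq k).1 ⬝ᵥ g.x + (t : ℝ)⁻¹ * uCoef (freq k) g.A)
        * (F (gamma (rowMul (freq k) g.A)) : ℝˣ → ℂ) ((vCoef (freq k) g.A)⁻¹ * t) := by
  filter_upwards [sigmaIsometry_coe g F] with k hk
  rw [sigma_eq, hk, sigmaFun_apply]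
  filter_upwards [Lp.coeFn_smul ((weight (freq k) g.A : ℂ) * unitExp (freqVec k ⬝ᵥ g.x))
    (piOne (uCoef (freq k) g.A) (vCoef (freq k) g.A) (F (gamma (rowMul (freq k) g.A)))),
    piOne_coe (uCoef (freq k) g.A) (vCoef (freq k) g.A) (F (gamma (rowMul (freq k) g.A)))]
    with t h1 h2
  rw [h1, Pi.smul_apply, h2, unitExp_add]
  simp only [piOneFun, LinearMap.coe_mk, AddHom.coe_mk, smul_eq_mul, freq]
  ring

/-! ### The operators `σ(f)` -/

theorem stronglyMeasurable_inner_sigma (F E : HSigma) :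
    StronglyMeasurable fun g : G2 => inner ℂ (sigma g F) E := by
  have hF := stronglyMeasurable_sigmaFun F (Lp.stronglyMeasurable F)
  have hE : StronglyMeasurable fun p : G2 × K => (E : K → L2Rstar) p.2 :=
    (Lp.stronglyMeasurable E).comp_measurable measurable_snd
  have h : StronglyMeasurable fun p : G2 × K => inner ℂ (sigmaFun p.1 F p.2) (E p.2) :=
    hF.inner hE
  have hi : StronglyMeasurable fun g : G2 => ∫ k, inner ℂ (sigmaFun g F k) (E k) ∂haarK :=
    StronglyMeasurable.integral_prod_right (f := fun g k => inner ℂ (sigmaFun g F k) (E k)) h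
  have e : (fun g : G2 => inner ℂ (sigma g F) E)
      = fun g : G2 => ∫ k, inner ℂ (sigmaFun g F k) (E k) ∂haarK := by
    funext g
    rw [L2.inner_def]
    refine integral_congr_ae ?_
    filter_upwards [sigmaIsometry_coe g F] with k hk
    rw [sigma_eq, hk]
  rw [e]
  exact hi

theorem integrable_conj_mul_inner_sigma {f : G2 → ℂ} (hf : MemLp f 1 G2.haar) (F E : HSigma) :
    Integrable (fun g => starRingEnd ℂ (f g) * inner ℂ (sigma g F) E) G2.haar := by
  have h1 : Integrable (fun g => starRingEnd ℂ (f g)) G2.haar := by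
    have := memLp_one_iff_integrable.1 hf
    exact (Complex.conjLIE.integrable_comp_iff (φ := f)).2 this
  refine h1.mul_bdd (c := ‖F‖ * ‖E‖) (stronglyMeasurable_inner_sigma F E).aestronglyMeasurable
    (.of_forall fun g => ?_)
  exact (norm_inner_le_norm _ _).trans (by rw [LinearIsometryEquiv.norm_map])

/-- The bounded sesquilinear form `(F, E) ↦ ∫ conj(f(g)) ⟪σ(g) F, E⟫ dμ(g)`; here `⟪·, ·⟫` is
conjugate-linear in the first variable. -/
noncomputable def sigmaForm (f : G2 → ℂ) (hf : MemLp f 1 G2.haar) :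
    HSigma →L⋆[ℂ] HSigma →L[ℂ] ℂ :=
  LinearMap.mkContinuous₂
    (LinearMap.mk₂'ₛₗ (starRingEnd ℂ) (RingHom.id ℂ)
      (fun F E => ∫ g, starRingEnd ℂ (f g) * inner ℂ (sigma g F) E ∂G2.haar)
      (fun F F' E => by
        simp only [map_add, inner_add_left, mul_add]
        exact integral_add (integrable_conj_mul_inner_sigma hf F E)
          (integrable_conj_mul_inner_sigma hf F' E))
      (fun c F E => by
        simp only [map_smul, inner_smul_left, smul_eq_mul, mul_left_comm _ (starRingEnd ℂ c)]
        exact integral_const_mul _ _)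
      (fun F E E' => by
        simp only [inner_add_right, mul_add]
        exact integral_add (integrable_conj_mul_inner_sigma hf F E)
          (integrable_conj_mul_inner_sigma hf F E'))
      (fun c F E => by
        simp only [inner_smul_right, smul_eq_mul, mul_left_comm _ c, RingHom.id_apply]
        exact integral_const_mul _ _))
    (∫ g, ‖f g‖ ∂G2.haar) (fun F E => by
      change ‖∫ g, starRingEnd ℂ (f g) * inner ℂ (sigma g F) E ∂G2.haar‖ ≤ _
      have hi : Integrable (fun g => ‖f g‖ * (‖F‖ * ‖E‖)) G2.haar :=
        (memLp_one_iff_integrable.1 hf).norm.mul_const _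
      refine (norm_integral_le_of_norm_le hi (.of_forall fun g => ?_)).trans ?_
      · rw [norm_mul, RCLike.norm_conj]
        gcongr
        exact (norm_inner_le_norm _ _).trans (by rw [LinearIsometryEquiv.norm_map])
      · rw [integral_mul_const, mul_assoc])

/-- The operator `σ(f) = ∫ f(g) σ(g) dμ(g)`, for `f ∈ L¹(G₂)`. -/
noncomputable def sigmaL1 (f : G2 → ℂ) (hf : MemLp f 1 G2.haar) : HSigma →L[ℂ] HSigma :=
  InnerProductSpace.continuousLinearMapOfBilin (sigmaForm f hf)

/-- The weak formula that characterises `σ(f)`. -/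
theorem inner_sigmaL1 (f : G2 → ℂ) (hf : MemLp f 1 G2.haar) (F E : HSigma) :
    Integrable (fun g => f g * inner ℂ E (sigma g F)) G2.haar ∧
      inner ℂ E (sigmaL1 f hf F) = ∫ g, f g * inner ℂ E (sigma g F) ∂G2.haar := by
  have e : ∀ g, f g * inner ℂ E (sigma g F)
      = starRingEnd ℂ (starRingEnd ℂ (f g) * inner ℂ (sigma g F) E) := by
    intro g
    rw [map_mul, Complex.conj_conj, inner_conj_symm]
  simp only [e]
  constructor
  · exact (Complex.conjLIE.integrable_comp_iff
      (φ := fun g => starRingEnd ℂ (f g) * inner ℂ (sigma g F) E)).2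
      (integrable_conj_mul_inner_sigma hf F E)
  · rw [integral_conj, ← inner_conj_symm E]
    congr 1
    exact InnerProductSpace.continuousLinearMapOfBilin_apply (sigmaForm f hf) F E

/-! ### The positive operator `T` -/

/-- The function `|det(L) ν|^{-1/2}` of `[0, L] ∈ K` and `ν ∈ ℝ*`. -/
noncomputable def weightT (k : K) (ν : ℝˣ) : ℝ :=
  |(k.1.A : Matrix (Fin 2) (Fin 2) ℝ).det * (ν : ℝ)| ^ (-(1 / 2) : ℝ)

/-- The graph of `T`: all pairs `(F, E)` in `L²(K, L²(ℝ*))` with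
`(E[0, L])(ν) = |det(L) ν|^{-1/2} (F[0, L])(ν)` almost everywhere. -/
noncomputable def graphT : Submodule ℂ (HSigma × HSigma) where
  carrier := {p | ∀ᵐ k ∂haarK, ∀ᵐ ν ∂haarRstar, p.2 k ν = (weightT k ν : ℂ) * p.1 k ν}
  add_mem' := by
    rintro ⟨F, E⟩ ⟨F', E'⟩ h h'
    filter_upwards [h, h', Lp.coeFn_add F F', Lp.coeFn_add E E'] with k h1 h2 h3 h4
    change ∀ᵐ ν ∂haarRstar, (E + E' : HSigma) k ν = (weightT k ν : ℂ) * (F + F' : HSigma) k ν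
    rw [h3, h4]
    filter_upwards [h1, h2, Lp.coeFn_add (F k) (F' k), Lp.coeFn_add (E k) (E' k)]
      with ν n1 n2 n3 n4
    rw [Pi.add_apply, Pi.add_apply, n3, n4, Pi.add_apply, Pi.add_apply, n1, n2, mul_add]
  zero_mem' := by
    filter_upwards [Lp.coeFn_zero L2Rstar 2 haarK] with k h1
    change ∀ᵐ ν ∂haarRstar, (0 : HSigma) k ν = (weightT k ν : ℂ) * (0 : HSigma) k ν
    rw [h1]
    filter_upwards [Lp.coeFn_zero ℂ 2 haarRstar] with ν n1
    rw [Pi.zero_apply, n1, Pi.zero_apply, mul_zero]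
  smul_mem' := by
    rintro c ⟨F, E⟩ h
    filter_upwards [h, Lp.coeFn_smul c F, Lp.coeFn_smul c E] with k h1 h3 h4
    change ∀ᵐ ν ∂haarRstar, (c • E : HSigma) k ν = (weightT k ν : ℂ) * (c • F : HSigma) k ν
    rw [h3, h4]
    filter_upwards [h1, Lp.coeFn_smul c (F k), Lp.coeFn_smul c (E k)] with ν n1 n3 n4
    rw [Pi.smul_apply, Pi.smul_apply, n3, n4, Pi.smul_apply, Pi.smul_apply, n1, smul_eq_mul,
      smul_eq_mul, mul_left_comm]

theorem graphT_functional : ∀ p : HSigma × HSigma, p ∈ graphT → p.1 = 0 → p.2 = 0 := by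
  rintro ⟨F, E⟩ h h0
  obtain rfl : F = 0 := h0
  apply Lp.ext
  filter_upwards [h, Lp.coeFn_zero L2Rstar 2 haarK] with k h1 h2
  rw [h2]
  apply Lp.ext
  change ∀ᵐ ν ∂haarRstar, E k ν = (weightT k ν : ℂ) * (0 : HSigma) k ν at h1
  rw [h2] at h1
  filter_upwards [h1, Lp.coeFn_zero ℂ 2 haarRstar] with ν n1 n2
  rw [n1, Pi.zero_apply, n2, Pi.zero_apply, mul_zero]

/-- The unbounded operator `T` of multiplication by `|det(L) ν|^{-1/2}` on `L²(K, L²(ℝ*))`,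
with its maximal domain. -/
noncomputable def opT : HSigma →ₗ.[ℂ] HSigma := graphT.toLinearPMap

theorem opT_graph : opT.graph = graphT := Submodule.toLinearPMap_graph_eq _ graphT_functional

/-! ### Hilbert–Schmidt operators -/

/-- `R` is a Hilbert–Schmidt operator: `∑ ‖R ξⱼ‖² < ∞` for every orthonormal basis `(ξⱼ)`. -/
def IsHilbertSchmidt {H : Type} [NormedAddCommGroup H] [InnerProductSpace ℂ H]
    (R : H →L[ℂ] H) : Prop :=
  ∀ (ι : Type) (b : HilbertBasis ι ℂ H), Summable fun i => ‖R (b i)‖ ^ 2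

/-- The Hilbert–Schmidt norm `(∑ ‖R ξⱼ‖²)^{1/2}`, computed in the orthonormal basis `b = (ξⱼ)`. -/
noncomputable def hsNorm {H : Type} [NormedAddCommGroup H] [InnerProductSpace ℂ H]
    {ι : Type} (b : HilbertBasis ι ℂ H) (R : H →L[ℂ] H) : ℝ :=
  √(∑' i, ‖R (b i)‖ ^ 2)

end AffinePlane

namespace AffinePlane

/-! Fix a frequency ω ≠ 0 and put (a, b)^⊥ = (-b, a). A matrix A is determined by η = ωA and by the
coordinates of ω^⊥A = uη + vη^⊥, and these u, v are exactly u_{ω,A} and v_{ω,A}. In the coordinates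
(x, η, u, v) the factor |det A|^{1/2}‖ω‖/‖ωA‖ is |v|^{1/2}, and the left Haar measure of G₂ is
‖ω‖²‖η‖⁻²|v|⁻² dx du dμ_K(η) dv/|v| (`density_identity`, `measurePreserving_psi`). In the formula
for σ the variables x and u occur only in the character e^{2πi(ωx + u/t)} (`sigmaZ_psi`).
Integrating f over x and u therefore produces its Fourier transform f̂ at (ω, 1/t), and the
substitution v = t/s turns σ(f)T into an integral operator on L²(K × ℝ*) with kernel `kern`
(`integral_mul_sigmaZ`).

Since det γ(η) = ‖η‖⁻², T multiplies by ‖η‖|s|^{-1/2}. Collecting the powers, the kernel is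
‖ω‖²‖η‖⁻¹|v|⁻¹|t|^{-1/2} f̂, and its square is ‖ω‖²|t|⁻¹ times the Haar density times |f̂|²
(`kernFactor_eq`, `kernFactor_sq`). Now ‖ω‖² dμ_K is Lebesgue measure dω, and |t|⁻¹ dt/|t| is dτ for
τ = 1/t, so the squared L² norm of the kernel is a Plancherel integral of f. The coordinates (η, u,
v) depend on ω, so the two Plancherel theorems come in a definite order: in u for fixed ω
(`lintegral_fourierXU`), then a return to A, whose measure does not involve ω, and in x for fixed A
(`lintegral_fourierX`). The outcome is `lintegral_kern`.

The remaining ingredients are general: L²(X, L²(Y)) is L²(X × Y) (`uncurryLp`), an operator with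
square-integrable kernel has that L² norm as Hilbert–Schmidt norm (`tsum_enorm_hsOp_sq`), and
multiplication by a real function on its maximal domain is self-adjoint (`isSelfAdjoint_of_graph`).
-/

theorem lintegral_enorm_sq {X E : Type*} [MeasurableSpace X] {μ : Measure X}
    [NormedAddCommGroup E] (f : X → E) : ∫⁻ x, ‖f x‖ₑ ^ 2 ∂μ = eLpNorm f 2 μ ^ 2 := by
  have := eLpNorm_nnreal_pow_eq_lintegral (f := f) (μ := μ) (p := 2) two_ne_zero
  simp only [NNReal.coe_ofNat, ENNReal.rpow_ofNat, ENNReal.coe_ofNat] at this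
  exact this.symm

theorem memLp_two_iff_lintegral {X E : Type*} [MeasurableSpace X] {μ : Measure X}
    [NormedAddCommGroup E] {f : X → E} (hf : AEStronglyMeasurable f μ) :
    MemLp f 2 μ ↔ ∫⁻ x, ‖f x‖ₑ ^ 2 ∂μ < ∞ := by
  rw [lintegral_enorm_sq]
  exact ⟨fun h => ENNReal.pow_lt_top h.2, fun h => ⟨hf, by simpa using h⟩⟩

/-! ### Plancherel's theorem for functions in L¹ ∩ L². -/

section Plancherel

open scoped FourierTransform ContDiff RealInnerProductSpace

variable {V : Type*} [NormedAddCommGroup V] [InnerProductSpace ℝ V] [FiniteDimensional ℝ V]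
  [MeasurableSpace V] [BorelSpace V]

/-- The `L²` Fourier transform of an integrable function is given by the Fourier integral. -/
theorem coeFn_fourier_toLp {f : V → ℂ} (h1 : Integrable f) (h2 : MemLp f 2) :
    (𝓕 (h2.toLp f) : Lp ℂ 2 (volume : Measure V)) =ᵐ[volume] 𝓕 f := by
  have hc : Continuous (𝓕 f) :=
    VectorFourier.fourierIntegral_continuous Real.continuous_fourierChar
      (by exact continuous_inner) h1
  -- Both sides are locally integrable, so smooth compactly supported test functions suffice.
  -- Against these the L² transform is that of tempered distributions, defined by duality, and the
  -- symmetry of the Fourier integral moves the transform back onto f.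
  refine ae_eq_of_integral_contDiff_smul_eq
    ((Lp.memLp _).locallyIntegrable (by norm_num)) hc.locallyIntegrable fun g hg hgc => ?_
  have hg₁ : HasCompactSupport (Complex.ofRealCLM ∘ g) := hgc.comp_left rfl
  have hg₂ : ContDiff ℝ ∞ (Complex.ofRealCLM ∘ g) := by fun_prop
  set φ := hg₁.toSchwartzMap hg₂ with hφ
  have e1 := congrArg (fun T => T φ) (Lp.fourier_toTemperedDistribution_eq (h2.toLp f))
  simp only [TemperedDistribution.fourier_apply, Lp.toTemperedDistribution_apply] at e1
  have e2 : ∫ x, (𝓕 φ) x • (h2.toLp f) x = ∫ x, (𝓕 (φ : V → ℂ)) x • f x := by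
    refine integral_congr_ae ?_
    filter_upwards [h2.coeFn_toLp] with x hx
    rw [hx]; rfl
  have e3 : ∫ ξ, (𝓕 (φ : V → ℂ)) ξ • f ξ = ∫ x, φ x • 𝓕 f x := by
    simpa using! VectorFourier.integral_fourierIntegral_smul_eq_flip (L := innerₗ V)
      Real.continuous_fourierChar continuous_inner φ.integrable h1
  have e4 : ∀ x, φ x = (g x : ℂ) := fun x => rfl
  rw [e2, e3] at e1
  simp only [e4, Complex.coe_smul] at e1
  exact e1.symm

theorem lintegral_enorm_sq_fourier {f : V → ℂ} (h1 : Integrable f) (h2 : MemLp f 2) :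
    ∫⁻ w, ‖𝓕 f w‖ₑ ^ 2 = ∫⁻ v, ‖f v‖ₑ ^ 2 := by
  have h := Lp.norm_fourier_eq (h2.toLp f)
  rw [Lp.norm_def, eLpNorm_congr_ae (coeFn_fourier_toLp h1 h2), Lp.norm_toLp,
    ENNReal.toReal_eq_toReal_iff' _ h2.2.ne] at h
  · rw [lintegral_enorm_sq, lintegral_enorm_sq, h]
  · rw [← eLpNorm_congr_ae (coeFn_fourier_toLp h1 h2)]
    exact (Lp.memLp _).2.ne

/-- The characters in σ carry the sign +, so it is the inverse transform that occurs; it differs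
from the transform by the measure-preserving reflection w ↦ -w. -/
theorem lintegral_enorm_sq_fourierInv {f : V → ℂ} (h1 : Integrable f) (h2 : MemLp f 2) :
    ∫⁻ w, ‖𝓕⁻ f w‖ₑ ^ 2 = ∫⁻ v, ‖f v‖ₑ ^ 2 := by
  rw [← lintegral_enorm_sq_fourier h1 h2,
    ← (Measure.measurePreserving_neg (volume : Measure V)).lintegral_comp_emb
      (MeasurableEquiv.neg V).measurableEmbedding (fun w => ‖𝓕 f w‖ₑ ^ 2)]
  simp only [Real.fourierInv_eq_fourier_neg]

theorem fourierInv_eq_unitExp (f : V → ℂ) (w : V) :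
    𝓕⁻ f w = ∫ v, f v * unitExp ⟪v, w⟫ := by
  rw [Real.fourierInv_eq']
  refine integral_congr_ae (.of_forall fun v => ?_)
  simp only [smul_eq_mul, unitExp]
  rw [mul_comm]
  push_cast
  ring_nf

end Plancherel

theorem plancherel_real {f : ℝ → ℂ} (h1 : Integrable f) (h2 : MemLp f 2) :
    ∫⁻ τ, ‖∫ u, f u * unitExp (τ * u)‖ₑ ^ 2 = ∫⁻ u, ‖f u‖ₑ ^ 2 := by
  rw [← lintegral_enorm_sq_fourierInv h1 h2]
  simp only [fourierInv_eq_unitExp]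
  rfl

/-- The sup norm of `Fin 2 → ℝ` is not Euclidean; the dot product becomes an inner product after the
volume-preserving passage to `EuclideanSpace`. -/
theorem plancherel_plane {f : (Fin 2 → ℝ) → ℂ} (h1 : Integrable f) (h2 : MemLp f 2) :
    ∫⁻ ω : Fin 2 → ℝ, ‖∫ x, f x * unitExp (ω ⬝ᵥ x)‖ₑ ^ 2 = ∫⁻ x, ‖f x‖ₑ ^ 2 := by
  have hp := PiLp.volume_preserving_ofLp (Fin 2)
  have he : MeasurableEmbedding (WithLp.ofLp : EuclideanSpace ℝ (Fin 2) → Fin 2 → ℝ) :=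
    (MeasurableEquiv.toLp 2 (Fin 2 → ℝ)).symm.measurableEmbedding
  have k1 : Integrable (f ∘ WithLp.ofLp : EuclideanSpace ℝ (Fin 2) → ℂ) :=
    (hp.integrable_comp_emb he).2 h1
  have k2 : MemLp (f ∘ WithLp.ofLp : EuclideanSpace ℝ (Fin 2) → ℂ) 2 :=
    h2.comp_measurePreserving hp
  have := lintegral_enorm_sq_fourierInv k1 k2
  simp only [fourierInv_eq_unitExp] at this
  rw [← hp.lintegral_comp_emb he, ← hp.lintegral_comp_emb he (fun x => ‖f x‖ₑ ^ 2)]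
  refine Eq.trans ?_ this
  refine lintegral_congr fun w => ?_
  rw [← hp.integral_comp he]
  congr 2

/-! ### The isomorphism of L²(X, L²(Y)) with L²(X × Y). -/

section Curry

open Filter Topology TopologicalSpace

/-- In a separable metric space, the points of a dense sequence which are close to a given point
can be chosen measurably. -/
theorem exists_measurable_approx {L : Type*} [PseudoMetricSpace L] [MeasurableSpace L]
    [BorelSpace L] [SecondCountableTopology L] {d : ℕ → L} (hd : DenseRange d) {ε : ℝ}
    (hε : 0 < ε) : ∃ N : L → ℕ, Measurable N ∧ ∀ f, dist (d (N f)) f < ε := by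
  classical
  have hex : ∀ f : L, ∃ m, dist (d m) f < ε := by
    intro f
    obtain ⟨_, hx, m, rfl⟩ := hd.inter_open_nonempty
      (Metric.ball f ε) Metric.isOpen_ball ⟨f, Metric.mem_ball_self hε⟩
    exact ⟨m, hx⟩
  exact ⟨fun f => Nat.find (hex f), measurable_find _ fun k =>
    (measurable_const.dist measurable_id) measurableSet_Iio, fun f => Nat.find_spec (hex f)⟩

/-- A sequence which converges fast in `L²` converges almost everywhere. -/
theorem ae_tendsto_of_dist_lt {Y : Type*} [MeasurableSpace Y] {ν : Measure Y}
    {a : ℕ → Lp ℂ 2 ν} {f : Lp ℂ 2 ν} (h : ∀ n, dist (a n) f < (1 / 2) ^ n) :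
    ∀ᵐ y ∂ν, Tendsto (fun n => a n y) atTop (𝓝 (f y)) := by
  have hcau : ∀ᵐ y ∂ν, ∃ l : ℂ, Tendsto (fun n => a n y) atTop (𝓝 l) := by
    refine Lp.ae_tendsto_of_cauchy_eLpNorm (p := 2) (f := fun n => (a n : Y → ℂ))
      (B := fun n => ENNReal.ofReal (2 * (1 / 2) ^ n))
      (fun n => Lp.aestronglyMeasurable _) (by norm_num) ?_ ?_
    · rw [← ENNReal.ofReal_tsum_of_nonneg (fun n => by positivity)
        ((summable_geometric_two).mul_left 2)]
      exact ENNReal.ofReal_ne_top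
    · intro M n m hn hm
      have h2 : ∀ k, M ≤ k → dist (a k) f < (1 / 2) ^ M :=
        fun k hk => (h k).trans_le (pow_le_pow_of_le_one (by norm_num) (by norm_num) hk)
      rw [← Lp.edist_def, edist_dist]
      refine ENNReal.ofReal_lt_ofReal_iff'.2 ⟨?_, by positivity⟩
      refine (dist_triangle_right _ _ f).trans_lt ?_
      linarith [h2 n hn, h2 m hm]
  have hlim : Tendsto a atTop (𝓝 f) := by
    rw [tendsto_iff_dist_tendsto_zero]
    exact squeeze_zero (fun _ => dist_nonneg) (fun n => (h n).le)
      (tendsto_pow_atTop_nhds_zero_of_lt_one (by norm_num) (by norm_num))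
  -- The geometric rate gives some a.e. limit. It is identified with f along a subsequence, since L²
  -- convergence implies convergence in measure.
  obtain ⟨ns, hns, hlim'⟩ := (tendstoInMeasure_of_tendsto_Lp hlim).exists_seq_tendsto_ae
  filter_upwards [hcau, hlim'] with y ⟨l, hl⟩ h2
  rwa [tendsto_nhds_unique h2 (hl.comp hns.tendsto_atTop)]

/-- There is a choice of representatives of the elements of `L²(Y)` which is jointly measurable
on `L²(Y) × Y`. -/
theorem exists_measurable_eval {Y : Type*} [MeasurableSpace Y] (ν : Measure Y)
    [SecondCountableTopology (Lp ℂ 2 ν)] [MeasurableSpace (Lp ℂ 2 ν)] [BorelSpace (Lp ℂ 2 ν)] :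
    ∃ ev : Lp ℂ 2 ν → Y → ℂ, Measurable (Function.uncurry ev) ∧ ∀ f, ev f =ᵐ[ν] f := by
  obtain ⟨d, hd⟩ := exists_dense_seq (Lp ℂ 2 ν)
  -- The index `N n f` is measurable in f and takes values in ℕ, so (f, y) ↦ `d (N n f) y` is
  -- jointly measurable. The rate (1/2)^n forces a.e. convergence to f without passing to an
  -- f-dependent subsequence.
  choose N hNm hN using fun n : ℕ =>
    exists_measurable_approx hd (ε := (1 / 2 : ℝ) ^ n) (by positivity)
  have ha : ∀ n, StronglyMeasurable fun p : Lp ℂ 2 ν × Y => d (N n p.1) p.2 := by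
    intro n
    have h1 : Measurable fun q : ℕ × Y => d q.1 q.2 :=
      measurable_from_prod_countable_right fun m => (Lp.stronglyMeasurable (d m)).measurable
    exact (h1.comp (((hNm n).comp measurable_fst).prodMk measurable_snd)).stronglyMeasurable
  refine ⟨fun f y => limUnder atTop fun n => d (N n f) y,
    (StronglyMeasurable.limUnder ha).measurable, fun f => ?_⟩
  filter_upwards [ae_tendsto_of_dist_lt fun n => hN n f] with y hy
  exact hy.limUnder_eq

/-- A map to a separable metric space is measurable if the preimages of balls are. -/
theorem measurable_of_ball {X L : Type*} [MeasurableSpace X] [PseudoMetricSpace L]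
    [SecondCountableTopology L] [MeasurableSpace L] [BorelSpace L] {f : X → L}
    (h : ∀ c r, MeasurableSet {x | dist (f x) c < r}) : Measurable f := by
  have hb : IsTopologicalBasis {s : Set L | ∃ c r, s = Metric.ball c r} := by
    refine isTopologicalBasis_of_isOpen_of_nhds ?_ ?_
    · rintro _ ⟨c, r, rfl⟩
      exact Metric.isOpen_ball
    · intro a u ha hu
      obtain ⟨r, hr, hs⟩ := Metric.isOpen_iff.1 hu a ha
      exact ⟨_, ⟨a, r, rfl⟩, Metric.mem_ball_self hr, hs⟩
  refine measurable_of_isOpen fun s hs => ?_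
  obtain ⟨t, ht, htc, rfl⟩ := hb.exists_countable_biUnion_of_isOpen hs
  rw [Set.preimage_iUnion₂]
  refine MeasurableSet.biUnion htc fun u hu => ?_
  obtain ⟨c, r, rfl⟩ := ht hu
  exact h c r

variable {X Y : Type*} [MeasurableSpace X] [MeasurableSpace Y] {μ : Measure X} {ν : Measure Y}

/-- The target is separable, so balls suffice; the distance to a fixed c is the root of an integral
over y, which is measurable in x by Tonelli. -/
theorem stronglyMeasurable_toLp [SFinite ν] [SecondCountableTopology (Lp ℂ 2 ν)]
    {g : X × Y → ℂ} (hg : StronglyMeasurable g) (h : ∀ x, MemLp (fun y => g (x, y)) 2 ν) :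
    StronglyMeasurable fun x => (h x).toLp := by
  let _ : MeasurableSpace (Lp ℂ 2 ν) := borel _
  have _ : BorelSpace (Lp ℂ 2 ν) := ⟨rfl⟩
  refine (measurable_of_ball fun c r => ?_).stronglyMeasurable
  have e : ∀ x, dist (h x).toLp c
      = ((∫⁻ y, ‖g (x, y) - c y‖ₑ ^ 2 ∂ν) ^ (1 / 2 : ℝ)).toReal := by
    intro x
    rw [Lp.dist_def]
    congr 1
    rw [eLpNorm_congr_ae ((h x).coeFn_toLp.sub (EventuallyEq.refl _ (c : Y → ℂ))),
      eLpNorm_eq_lintegral_rpow_enorm_toReal two_ne_zero ENNReal.ofNat_ne_top]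
    simp
  have hm : Measurable fun p : X × Y => ‖g p - c p.2‖ₑ ^ 2 := by
    have h1 := hg.measurable
    have h2 : Measurable fun p : X × Y => c p.2 :=
      (Lp.stronglyMeasurable c).measurable.comp measurable_snd
    fun_prop
  have hm' := hm.lintegral_prod_right' (ν := ν)
  simp only [e]
  exact ((hm'.pow_const _).ennreal_toReal) measurableSet_Iio

variable [SFinite ν]

/-- Each `F x` is only a class, and arbitrary representatives need not fit together measurably in
(x, y). The jointly measurable choice `ev` repairs this, and Tonelli gives the norm. -/
theorem exists_uncurry [SFinite μ] [SecondCountableTopology (Lp ℂ 2 ν)] (F : Lp (Lp ℂ 2 ν) 2 μ) :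
    ∃ G : Lp ℂ 2 (μ.prod ν), (∀ᵐ x ∂μ, ∀ᵐ y ∂ν, G (x, y) = F x y) ∧ ‖G‖ = ‖F‖ := by
  let _ : MeasurableSpace (Lp ℂ 2 ν) := borel _
  have _ : BorelSpace (Lp ℂ 2 ν) := ⟨rfl⟩
  obtain ⟨ev, hev, he⟩ := exists_measurable_eval ν
  have hFm := (Lp.stronglyMeasurable F).measurable
  have hgm : Measurable fun z : X × Y => ev (F z.1) z.2 :=
    hev.comp ((hFm.comp measurable_fst).prodMk measurable_snd)
  have hint : ∫⁻ z, ‖ev (F z.1) z.2‖ₑ ^ 2 ∂μ.prod ν = ∫⁻ x, ‖F x‖ₑ ^ 2 ∂μ := by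
    rw [lintegral_prod _ (by fun_prop)]
    refine lintegral_congr fun x => ?_
    rw [lintegral_enorm_sq, eLpNorm_congr_ae (he (F x)), Lp.enorm_def]
  have hmem : MemLp (fun z : X × Y => ev (F z.1) z.2) 2 (μ.prod ν) := by
    rw [memLp_two_iff_lintegral hgm.aestronglyMeasurable, hint,
      ← memLp_two_iff_lintegral (Lp.aestronglyMeasurable F)]
    exact Lp.memLp F
  refine ⟨hmem.toLp, ?_, ?_⟩
  · filter_upwards [Measure.ae_ae_of_ae_prod hmem.coeFn_toLp] with x hx
    filter_upwards [hx, he (F x)] with y h1 h2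
    rw [h1, h2]
  · rw [lintegral_enorm_sq, lintegral_enorm_sq] at hint
    rw [Lp.norm_toLp, Lp.norm_def]
    congr 1
    exact (ENNReal.pow_right_strictMono two_ne_zero).injective hint

/-- A.e. equality on a product of two measurable functions can be checked fibrewise. -/
theorem ae_prod_eq_of_ae_ae {g h : X × Y → ℂ} (hg : AEStronglyMeasurable g (μ.prod ν))
    (hh : AEStronglyMeasurable h (μ.prod ν)) (e : ∀ᵐ x ∂μ, ∀ᵐ y ∂ν, g (x, y) = h (x, y)) :
    g =ᵐ[μ.prod ν] h := by
  -- Passing from fibres to the product requires a measurable set of equality, hence the strongly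
  -- measurable representatives.
  have h1 : ∀ᵐ z ∂μ.prod ν, hg.mk g z = hh.mk h z := by
    rw [Measure.ae_prod_iff_ae_ae (measurableSet_eq_fun hg.stronglyMeasurable_mk.measurable
      hh.stronglyMeasurable_mk.measurable)]
    filter_upwards [e, Measure.ae_ae_of_ae_prod hg.ae_eq_mk,
      Measure.ae_ae_of_ae_prod hh.ae_eq_mk] with x e1 e2 e3
    filter_upwards [e1, e2, e3] with y f1 f2 f3
    rw [← f2, f1, f3]
  exact hg.ae_eq_mk.trans (.trans h1 hh.ae_eq_mk.symm)

theorem exists_curry [SecondCountableTopology (Lp ℂ 2 ν)] (G : Lp ℂ 2 (μ.prod ν)) :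
    ∃ F : Lp (Lp ℂ 2 ν) 2 μ, ∀ᵐ x ∂μ, ∀ᵐ y ∂ν, G (x, y) = F x y := by
  have hGm := Lp.stronglyMeasurable G
  have hm : Measurable fun z : X × Y => ‖G z‖ₑ ^ 2 := by
    have := hGm.measurable
    fun_prop
  have hfin : ∫⁻ z, ‖G z‖ₑ ^ 2 ∂μ.prod ν < ∞ :=
    (memLp_two_iff_lintegral hGm.aestronglyMeasurable).1 (Lp.memLp G)
  rw [lintegral_prod _ hm.aemeasurable] at hfin
  set S : Set X := {x | ∫⁻ y, ‖G (x, y)‖ₑ ^ 2 ∂ν < ∞} with hS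
  have hSm : MeasurableSet S := hm.lintegral_prod_right' measurableSet_Iio
  have hSae : ∀ᵐ x ∂μ, x ∈ S := ae_lt_top hm.lintegral_prod_right' hfin.ne
  -- Only almost every fibre of G is in L². Cutting G off outside S puts every fibre in L², so that
  -- `toLp` is defined for all x.
  set g : X × Y → ℂ := (S ×ˢ Set.univ).indicator G with hg
  have hgm : StronglyMeasurable g := hGm.indicator (hSm.prod .univ)
  have hg1 : ∀ x ∈ S, ∀ y, g (x, y) = G (x, y) := fun x hx y =>
    Set.indicator_of_mem (by exact ⟨hx, trivial⟩) _
  have hg0 : ∀ x ∉ S, ∀ y, g (x, y) = 0 := fun x hx y =>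
    Set.indicator_of_notMem (fun h => hx h.1) _
  have hgy : ∀ x, StronglyMeasurable fun y => g (x, y) :=
    fun x => hgm.comp_measurable measurable_prodMk_left
  have hmem : ∀ x, MemLp (fun y => g (x, y)) 2 ν := by
    intro x
    rw [memLp_two_iff_lintegral (hgy x).aestronglyMeasurable]
    by_cases hx : x ∈ S
    · simp only [hg1 x hx]; exact hx
    · simp [hg0 x hx]
  have hF := stronglyMeasurable_toLp hgm hmem
  have hFmem : MemLp (fun x => (hmem x).toLp) 2 μ := by
    rw [memLp_two_iff_lintegral hF.aestronglyMeasurable]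
    refine lt_of_eq_of_lt ?_ hfin
    refine lintegral_congr_ae ?_
    filter_upwards [hSae] with x hx
    rw [Lp.enorm_def, eLpNorm_congr_ae (hmem x).coeFn_toLp, ← lintegral_enorm_sq]
    simp only [hg1 x hx]
  refine ⟨hFmem.toLp, ?_⟩
  filter_upwards [hFmem.coeFn_toLp, hSae] with x h1 h2
  rw [h1]
  filter_upwards [(hmem x).coeFn_toLp] with y h3
  rw [h3, hg1 x h2]

variable [SFinite μ]

variable (μ ν) in
/-- The isometric isomorphism `L²(X, L²(Y)) ≃ L²(X × Y)`. -/
noncomputable def uncurryLp [SecondCountableTopology (Lp ℂ 2 ν)] :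
    Lp (Lp ℂ 2 ν) 2 μ ≃ₗᵢ[ℂ] Lp ℂ 2 (μ.prod ν) :=
  -- A class on the product is determined by its fibres. This makes the chosen witnesses of
  -- `exists_uncurry` linear in F and also yields surjectivity.
  have uniq : ∀ {F : Lp (Lp ℂ 2 ν) 2 μ} {G G' : Lp ℂ 2 (μ.prod ν)},
      (∀ᵐ x ∂μ, ∀ᵐ y ∂ν, G (x, y) = F x y) → (∀ᵐ x ∂μ, ∀ᵐ y ∂ν, G' (x, y) = F x y) → G = G' := by
    intro F G G' h h'
    refine Lp.ext (ae_prod_eq_of_ae_ae (Lp.aestronglyMeasurable G) (Lp.aestronglyMeasurable G') ?_)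
    filter_upwards [h, h'] with x h1 h2
    filter_upwards [h1, h2] with y h3 h4
    rw [h3, h4]
  LinearIsometryEquiv.ofSurjective
    { toFun := fun F => (exists_uncurry F).choose
      map_add' := fun F F' => by
        refine uniq (exists_uncurry (F + F')).choose_spec.1 ?_
        filter_upwards [(exists_uncurry F).choose_spec.1, (exists_uncurry F').choose_spec.1,
          Lp.coeFn_add F F', Measure.ae_ae_of_ae_prod
            (Lp.coeFn_add (exists_uncurry F).choose (exists_uncurry F').choose)] with x h1 h2 h3 h4
        filter_upwards [h1, h2, h4, Lp.coeFn_add (F x) (F' x)] with y k1 k2 k3 k4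
        rw [k3, h3, Pi.add_apply, Pi.add_apply, k4, Pi.add_apply, k1, k2]
      map_smul' := fun c F => by
        refine uniq (exists_uncurry (c • F)).choose_spec.1 ?_
        filter_upwards [(exists_uncurry F).choose_spec.1, Lp.coeFn_smul c F,
          Measure.ae_ae_of_ae_prod (Lp.coeFn_smul c (exists_uncurry F).choose)] with x h1 h3 h4
        filter_upwards [h1, h4, Lp.coeFn_smul c (F x)] with y k1 k3 k4
        rw [RingHom.id_apply, k3, h3, Pi.smul_apply, Pi.smul_apply, k4, Pi.smul_apply, k1]
      norm_map' := fun F => (exists_uncurry F).choose_spec.2 }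
    (fun G => by
      obtain ⟨F, hF⟩ := exists_curry G
      exact ⟨F, uniq (exists_uncurry F).choose_spec.1 hF⟩)

theorem uncurryLp_ae [SecondCountableTopology (Lp ℂ 2 ν)] (F : Lp (Lp ℂ 2 ν) 2 μ) :
    ∀ᵐ x ∂μ, ∀ᵐ y ∂ν, uncurryLp μ ν F (x, y) = F x y :=
  (exists_uncurry F).choose_spec.1

end Curry

/-! ### Hilbert–Schmidt operators given by square-integrable kernels. -/

section HilbertSchmidt

open scoped InnerProductSpace

variable {X : Type*} [MeasurableSpace X] {μ : Measure X}
  {H : Type*} [NormedAddCommGroup H] [InnerProductSpace ℂ H]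

/-- The operator `ξ ↦ (x ↦ ⟪k x, ξ⟫)` from `H` to `L²(X)` defined by `k ∈ L²(X, H)`. -/
noncomputable def hsOp (k : Lp H 2 μ) : H →L[ℂ] Lp ℂ 2 μ :=
  LinearMap.mkContinuous
    { toFun := fun ξ => ((Lp.memLp k).inner_const (𝕜 := ℂ) ξ).toLp
      map_add' := fun ξ η => by
        rw [← MemLp.toLp_add, MemLp.toLp_eq_toLp_iff]
        exact .of_forall fun x => inner_add_right _ _ _
      map_smul' := fun c ξ => by
        rw [RingHom.id_apply, ← MemLp.toLp_const_smul, MemLp.toLp_eq_toLp_iff]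
        exact .of_forall fun x => inner_smul_right _ _ _ } ‖k‖ fun ξ => by
      change ‖((Lp.memLp k).inner_const (𝕜 := ℂ) ξ).toLp‖ ≤ ‖k‖ * ‖ξ‖
      rw [mul_comm]
      refine Lp.norm_le_mul_norm_of_ae_le_mul ?_
      filter_upwards [((Lp.memLp k).inner_const (𝕜 := ℂ) ξ).coeFn_toLp] with x hx
      rw [hx, mul_comm]
      exact norm_inner_le_norm _ _

theorem hsOp_coe (k : Lp H 2 μ) (ξ : H) : hsOp k ξ =ᵐ[μ] fun x => ⟪k x, ξ⟫_ℂ :=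
  ((Lp.memLp k).inner_const (𝕜 := ℂ) ξ).coeFn_toLp

/-- Parseval's identity in `ℝ≥0∞`, where the sum can be exchanged with `∫⁻` without summability
conditions. -/
theorem HilbertBasis.tsum_enorm_inner_sq {ι : Type*} (b : HilbertBasis ι ℂ H) (x : H) :
    ∑' i, ‖⟪x, b i⟫_ℂ‖ₑ ^ 2 = ‖x‖ₑ ^ 2 := by
  have h := b.hasSum_inner_mul_inner x x
  have h2 : HasSum (fun i => ‖⟪x, b i⟫_ℂ‖ ^ 2) (‖x‖ ^ 2) := by
    have := Complex.hasSum_re h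
    convert this using 1
    · funext i
      rw [← inner_conj_symm (b i) x, RCLike.mul_conj]
      norm_cast
    · exact (inner_self_eq_norm_sq (𝕜 := ℂ) x).symm
  have h3 := ENNReal.ofReal_tsum_of_nonneg (fun i => sq_nonneg _) h2.summable
  rw [h2.tsum_eq] at h3
  simp only [ENNReal.ofReal_pow (norm_nonneg _), ofReal_norm] at h3
  exact h3.symm

/-- Distinct basis vectors are at distance at least 1, so balls of radius 1/2 around them are
disjoint open sets in a separable space. Countability allows the sum over the basis to be exchanged
with the integral. -/
theorem HilbertBasis.countable {ι : Type*} [SecondCountableTopology H]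
    (b : HilbertBasis ι ℂ H) : Countable ι := by
  have hd : ∀ i j, i ≠ j → 1 ≤ dist (b i) (b j) := by
    intro i j hij
    have h0 : ⟪b i, b j⟫_ℂ = 0 := b.orthonormal.2 hij
    have := norm_sub_sq (𝕜 := ℂ) (b i) (b j)
    rw [h0, b.orthonormal.1, b.orthonormal.1, ← dist_eq_norm] at this
    simp only [map_zero] at this
    nlinarith [dist_nonneg (x := b i) (y := b j)]
  have : (Set.univ : Set ι).Countable := by
    refine Set.PairwiseDisjoint.countable_of_isOpen (s := fun i => Metric.ball (b i) (1 / 2))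
      (fun i _ j _ hij => Metric.ball_disjoint_ball (by linarith [hd i j hij]))
      (fun i _ => Metric.isOpen_ball) (fun i _ => ⟨b i, Metric.mem_ball_self (by norm_num)⟩)
  exact Set.countable_univ_iff.1 this

/-- The Hilbert–Schmidt norm of `hsOp k` is the norm of `k` in `L²(X, H)`. -/
theorem tsum_enorm_hsOp_sq {ι : Type*} [SecondCountableTopology H]
    (b : HilbertBasis ι ℂ H) (k : Lp H 2 μ) :
    ∑' i, ‖hsOp k (b i)‖ₑ ^ 2 = ‖k‖ₑ ^ 2 := by
  have := HilbertBasis.countable b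
  have e : ∀ i, ‖hsOp k (b i)‖ₑ ^ 2 = ∫⁻ x, ‖⟪k x, b i⟫_ℂ‖ₑ ^ 2 ∂μ := by
    intro i
    rw [Lp.enorm_def, ← lintegral_enorm_sq]
    refine lintegral_congr_ae ?_
    filter_upwards [hsOp_coe k (b i)] with x hx
    rw [hx]
  simp only [e]
  rw [← lintegral_tsum fun i => ?_]
  · simp only [HilbertBasis.tsum_enorm_inner_sq, Lp.enorm_def, lintegral_enorm_sq]
  · exact (((Lp.aestronglyMeasurable k).inner aestronglyMeasurable_const).enorm).pow_const 2

end HilbertSchmidt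

/-! ### Self-adjointness of multiplication by a real function. -/

section MultiplicationOperator

open scoped InnerProductSpace

variable {Z : Type*} [MeasurableSpace Z] {μ : Measure Z}
  {H : Type*} [NormedAddCommGroup H] [InnerProductSpace ℂ H]
  {U : H ≃ₗᵢ[ℂ] Lp ℂ 2 μ} {m : Z → ℝ} {A : H →ₗ.[ℂ] H}

/-- Where |m| ≤ n the multiplier is bounded, so every vector cut off to that set lies in the domain.
These are the test vectors of the self-adjointness proof. -/
theorem exists_truncation (hm : Measurable m)
    (hA : ∀ p : H × H, p ∈ A.graph ↔ U p.2 =ᵐ[μ] fun z => (m z : ℂ) * U p.1 z) (n : ℕ)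
    (h : Lp ℂ 2 μ) : ∃ F : A.domain, U F =ᵐ[μ] {z | |m z| ≤ n}.indicator h ∧
      U (A F) =ᵐ[μ] fun z => (m z : ℂ) * {z | |m z| ≤ n}.indicator h z := by
  have hS : MeasurableSet {z | |m z| ≤ n} := hm.abs measurableSet_Iic
  have h1 : MemLp ({z | |m z| ≤ n}.indicator h) 2 μ := (Lp.memLp h).indicator hS
  have h2 : MemLp (fun z => (m z : ℂ) * {z | |m z| ≤ n}.indicator h z) 2 μ := by
    refine h1.of_le_mul (c := n)
      ((Complex.measurable_ofReal.comp hm).aestronglyMeasurable.mul h1.1) (.of_forall fun z => ?_)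
    by_cases hz : z ∈ {z | |m z| ≤ n}
    · rw [norm_mul, Complex.norm_real]
      gcongr
      exact hz
    · simp [Set.indicator_of_notMem hz]
  have e1 : U (U.symm h1.toLp) =ᵐ[μ] {z | |m z| ≤ n}.indicator h := by
    rw [LinearIsometryEquiv.apply_symm_apply]; exact h1.coeFn_toLp
  have e2 : U (U.symm h2.toLp) =ᵐ[μ] fun z => (m z : ℂ) * {z | |m z| ≤ n}.indicator h z := by
    rw [LinearIsometryEquiv.apply_symm_apply]; exact h2.coeFn_toLp
  have hg : (U.symm h1.toLp, U.symm h2.toLp) ∈ A.graph := by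
    rw [hA]
    filter_upwards [e1, e2] with z k1 k2
    rw [k2, k1]
  obtain ⟨F, hF1, hF2⟩ := (LinearPMap.mem_graph_iff A).1 hg
  refine ⟨F, ?_, ?_⟩
  · rw [hF1]; exact e1
  · rw [hF2]; exact e2

theorem apply_ae_of_graph
    (hA : ∀ p : H × H, p ∈ A.graph ↔ U p.2 =ᵐ[μ] fun z => (m z : ℂ) * U p.1 z) (F : A.domain) :
    U (A F) =ᵐ[μ] fun z => (m z : ℂ) * U F z :=
  (hA (F, A F)).1 (LinearPMap.mem_graph A F)

/-- Testing with the truncation of w - my to {|m| ≤ n} shows that this truncation has norm 0; the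
sets exhaust Z as n grows. The case y = 0 gives density of the domain, the general case gives that
the adjoint is contained in A. -/
theorem mem_graph_of_inner_eq (hm : Measurable m)
    (hA : ∀ p : H × H, p ∈ A.graph ↔ U p.2 =ᵐ[μ] fun z => (m z : ℂ) * U p.1 z) {y w : H}
    (h : ∀ F : A.domain, ⟪w, (F : H)⟫_ℂ = ⟪y, A F⟫_ℂ) : (y, w) ∈ A.graph := by
  rw [hA]
  have key : ∀ n : ℕ, ∀ᵐ z ∂μ, |m z| ≤ n → U w z = (m z : ℂ) * U y z := by
    intro n
    -- The product my need not be in L². Replacing y by its truncation y' makes it so and changes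
    -- nothing where |m| ≤ n.
    obtain ⟨y', hy1, hy2⟩ := exists_truncation hm hA n (U y)
    have hS : MeasurableSet {z | |m z| ≤ n} := hm.abs measurableSet_Iic
    have hq : MemLp ({z | |m z| ≤ n}.indicator (U w - U (A y') : Lp ℂ 2 μ)) 2 μ :=
      (Lp.memLp _).indicator hS
    obtain ⟨F, hF1, hF2⟩ := exists_truncation hm hA n hq.toLp
    have hF := h F
    rw [← U.inner_map_map, ← U.inner_map_map, ← sub_eq_zero, L2.inner_def, L2.inner_def,
      ← integral_sub (L2.integrable_inner _ _) (L2.integrable_inner _ _)] at hF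
    -- Since m is real it moves to the first slot, and the difference of the two inner products
    -- becomes the squared norm of the truncated w - my.
    have e : ∫ z, ⟪U w z, U F z⟫_ℂ - ⟪U y z, U (A F) z⟫_ℂ ∂μ = ⟪hq.toLp, hq.toLp⟫_ℂ := by
      rw [L2.inner_def]
      refine integral_congr_ae ?_
      filter_upwards [hF1, hF2, hy2, hq.coeFn_toLp, Lp.coeFn_sub (U w) (U (A y'))]
        with z k1 k2 k4 k5 k6
      rw [k1, k2]
      by_cases hz : z ∈ {z | |m z| ≤ n}
      · rw [Set.indicator_of_mem hz, k5, Set.indicator_of_mem hz, k6, Pi.sub_apply, k4,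
          Set.indicator_of_mem hz]
        simp only [RCLike.inner_apply, map_sub, map_mul, Complex.conj_ofReal]
        ring
      · rw [Set.indicator_of_notMem hz, k5, Set.indicator_of_notMem hz]
        simp
    rw [e, inner_self_eq_zero] at hF
    have h0 : {z | |m z| ≤ n}.indicator (U w - U (A y') : Lp ℂ 2 μ) =ᵐ[μ] 0 := by
      have := hq.coeFn_toLp
      rw [hF] at this
      exact this.symm.trans (Lp.coeFn_zero _ _ _)
    filter_upwards [h0, hy2, Lp.coeFn_sub (U w) (U (A y'))] with z k1 k4 k6 hz
    have hz' : z ∈ {z | |m z| ≤ n} := hz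
    rw [Set.indicator_of_mem hz', k6, Pi.sub_apply, k4, Set.indicator_of_mem hz'] at k1
    exact sub_eq_zero.1 k1
  filter_upwards [ae_all_iff.2 key] with z hz
  obtain ⟨n, hn⟩ := exists_nat_ge |m z|
  exact hz n hn

/-- Multiplication by a measurable real function, with its maximal domain, is self-adjoint. -/
theorem isSelfAdjoint_of_graph [CompleteSpace H] (hm : Measurable m)
    (hA : ∀ p : H × H, p ∈ A.graph ↔ U p.2 =ᵐ[μ] fun z => (m z : ℂ) * U p.1 z) :
    IsSelfAdjoint A := by
  have hd : Dense (A.domain : Set H) := by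
    rw [Submodule.dense_iff_topologicalClosure_eq_top, Submodule.topologicalClosure_eq_top_iff,
      Submodule.eq_bot_iff]
    intro y hy
    -- A vector y orthogonal to the domain satisfies the hypothesis with 0 in place of the first
    -- component, so (0, y) is in the graph and y = 0.
    have h := mem_graph_of_inner_eq hm hA (y := 0) (w := y) fun F => by
      rw [inner_zero_left]
      exact Submodule.inner_left_of_mem_orthogonal F.2 hy
    exact LinearPMap.graph_fst_eq_zero_snd A h rfl
  rw [LinearPMap.isSelfAdjoint_def]
  -- The adjoint is below A by the test-vector argument; A is below its adjoint by symmetry, as m is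
  -- real.
  refine le_antisymm (LinearPMap.le_of_le_graph ?_) (LinearPMap.IsFormalAdjoint.le_adjoint hd ?_)
  · rintro ⟨y, w⟩ hyw
    obtain ⟨F, rfl, rfl⟩ := (LinearPMap.mem_graph_iff _).1 hyw
    exact mem_graph_of_inner_eq hm hA fun G => LinearPMap.adjoint_isFormalAdjoint hd F G
  · intro F G
    rw [← U.inner_map_map, ← U.inner_map_map, L2.inner_def, L2.inner_def]
    refine integral_congr_ae ?_
    filter_upwards [apply_ae_of_graph hA F, apply_ae_of_graph hA G] with z h1 h2
    rw [h1, h2]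
    simp only [RCLike.inner_apply, map_mul, Complex.conj_ofReal]
    ring

theorem re_inner_nonneg_of_graph (hm0 : ∀ z, 0 ≤ m z)
    (hA : ∀ p : H × H, p ∈ A.graph ↔ U p.2 =ᵐ[μ] fun z => (m z : ℂ) * U p.1 z) (F : A.domain) :
    0 ≤ (⟪(F : H), A F⟫_ℂ).re := by
  have e : ⟪(F : H), A F⟫_ℂ = ∫ z, ((m z * ‖U F z‖ ^ 2 : ℝ) : ℂ) ∂μ := by
    rw [← U.inner_map_map, L2.inner_def]
    refine integral_congr_ae ?_
    filter_upwards [apply_ae_of_graph hA F] with z h1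
    rw [h1, RCLike.inner_apply, mul_assoc, RCLike.mul_conj]
    push_cast
    rfl
  rw [e, integral_complex_ofReal, Complex.ofReal_re]
  exact integral_nonneg fun z => mul_nonneg (hm0 z) (sq_nonneg _)

end MultiplicationOperator

/-! ### The operator T as a multiplication operator on L²(K × ℝ*). -/

section OperatorT

instance : SigmaFinite haarK := by unfold haarK; infer_instance

instance : Fact ((2 : ℝ≥0∞) ≠ ∞) := ⟨ENNReal.ofNat_ne_top⟩

instance : SecondCountableTopology L2Rstar := Lp.SecondCountableTopology

instance : SecondCountableTopology HSigma := Lp.SecondCountableTopology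

/-- The measure `dμ_K dt/|t|` of `K × ℝ*`. -/
noncomputable abbrev haarZ : Measure (K × ℝˣ) := haarK.prod haarRstar

/-- The identification of `L²(K, L²(ℝ*))` with `L²(K × ℝ*)`. -/
noncomputable def uncurryH : HSigma ≃ₗᵢ[ℂ] Lp ℂ 2 haarZ := uncurryLp haarK haarRstar

theorem uncurryH_ae (F : HSigma) : ∀ᵐ k ∂haarK, ∀ᵐ t ∂haarRstar, uncurryH F (k, t) = F k t :=
  uncurryLp_ae F

theorem det_eq_inv_normSq (k : K) :
    (k.1.A : Matrix (Fin 2) (Fin 2) ℝ).det = (normSq (freqVec k))⁻¹ := by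
  obtain ⟨g, hg, s, t, hA⟩ := k
  have e := freqVec_eq ⟨g, hg, s, t, hA⟩
  simp only [hA] at e
  simp only [normSq, e, hA, Matrix.det_fin_two_of]
  rcases eq_or_ne (s ^ 2 + t ^ 2) 0 with h0 | h0
  · simp [h0]; linarith
  · simp; field_simp

/-- Because det γ(ω) = ‖ω‖⁻². In this form the powers can be compared with those of the Haar
density. -/
theorem weightT_eq (k : K) (ν : ℝˣ) : weightT k ν = rowNorm (freqVec k) / √|(ν : ℝ)| := by
  have h := normSq_pos (freqVec_ne_zero k)
  rw [weightT, det_eq_inv_normSq, Real.rpow_neg (abs_nonneg _), ← Real.sqrt_eq_rpow, abs_mul,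
    abs_inv, abs_of_pos h, Real.sqrt_mul (inv_nonneg.2 h.le), Real.sqrt_inv, mul_inv, inv_inv]
  rfl

theorem measurable_coe_units : Measurable fun t : ℝˣ => (t : ℝ) :=
  measurableEmbedding_unitsVal.measurable

theorem measurable_rowNorm : Measurable rowNorm := by
  unfold rowNorm
  exact measurable_normSq.sqrt

theorem measurable_weightT : Measurable fun z : K × ℝˣ => weightT z.1 z.2 := by
  simp only [weightT_eq]
  have h1 : Measurable fun z : K × ℝˣ => rowNorm (freqVec z.1) :=
    measurable_rowNorm.comp (measurable_freqVec.comp measurable_fst)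
  have h2 : Measurable fun z : K × ℝˣ => (z.2 : ℝ) := measurable_coe_units.comp measurable_snd
  exact h1.div (h2.abs.sqrt)

/-- Both a.e. statements say the same by Tonelli; the product form brings T under the results on
multiplication operators. -/
theorem mem_graph_opT_iff (p : HSigma × HSigma) : p ∈ opT.graph ↔
    uncurryH p.2 =ᵐ[haarZ] fun z => (weightT z.1 z.2 : ℂ) * uncurryH p.1 z := by
  have hm : AEStronglyMeasurable (fun z => (weightT z.1 z.2 : ℂ) * uncurryH p.1 z) haarZ :=
    (Complex.measurable_ofReal.comp measurable_weightT).aestronglyMeasurable.mul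
      (Lp.aestronglyMeasurable _)
  rw [opT_graph]
  constructor
  · intro h
    refine ae_prod_eq_of_ae_ae (Lp.aestronglyMeasurable _) hm ?_
    filter_upwards [h, uncurryH_ae p.1, uncurryH_ae p.2] with k h1 h2 h3
    filter_upwards [h1, h2, h3] with t k1 k2 k3
    rw [k3, k1, k2]
  · intro h
    change ∀ᵐ k ∂haarK, ∀ᵐ ν ∂haarRstar, p.2 k ν = (weightT k ν : ℂ) * p.1 k ν
    filter_upwards [Measure.ae_ae_of_ae_prod h, uncurryH_ae p.1, uncurryH_ae p.2] with k h1 h2 h3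
    filter_upwards [h1, h2, h3] with t k1 k2 k3
    rw [← k3, k1, k2]

theorem isSelfAdjoint_opT : IsSelfAdjoint opT :=
  isSelfAdjoint_of_graph measurable_weightT mem_graph_opT_iff

theorem weightT_nonneg (k : K) (ν : ℝˣ) : 0 ≤ weightT k ν := Real.rpow_nonneg (abs_nonneg _) _

theorem re_inner_opT_nonneg (F : opT.domain) : 0 ≤ (inner ℂ (F : HSigma) (opT F)).re :=
  re_inner_nonneg_of_graph (m := fun z : K × ℝˣ => weightT z.1 z.2)
    (fun _ => weightT_nonneg _ _) mem_graph_opT_iff F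

end OperatorT

/-! ### Lebesgue measure on matrices in the coordinates (η, u, v). -/

section ChangeOfVariables

theorem lintegral_comp_linearMap {V : Type*} [NormedAddCommGroup V] [NormedSpace ℝ V]
    [MeasurableSpace V] [BorelSpace V] [FiniteDimensional ℝ V] (μ : Measure V)
    [μ.IsAddHaarMeasure] {L : V →ₗ[ℝ] V} (hL : LinearMap.det L ≠ 0) {h : V → ℝ≥0∞}
    (hh : Measurable h) :
    ∫⁻ a, h (L a) ∂μ = ENNReal.ofReal |(LinearMap.det L)⁻¹| * ∫⁻ a, h a ∂μ := by
  have hLm : Measurable L := (LinearMap.continuous_of_finiteDimensional L).measurable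
  rw [← lintegral_map hh hLm, Measure.map_linearMap_addHaar_eq_smul_addHaar μ hL,
    lintegral_smul_measure, smul_eq_mul]

/-- Transposition, as a linear map. -/
def transposeLin : (Fin 2 → Fin 2 → ℝ) →ₗ[ℝ] (Fin 2 → Fin 2 → ℝ) where
  toFun a := fun i j => a j i
  map_add' _ _ := rfl
  map_smul' _ _ := rfl

/-- Left multiplication by a matrix, as a linear map. -/
def mulLeftLin (C : Matrix (Fin 2) (Fin 2) ℝ) :
    (Fin 2 → Fin 2 → ℝ) →ₗ[ℝ] (Fin 2 → Fin 2 → ℝ) where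
  toFun a := fun i j => C i 0 * a 0 j + C i 1 * a 1 j
  map_add' a b := by ext i j; simp; ring
  map_smul' c a := by ext i j; simp; ring

/-- C acts separately on the two columns, which gives det C twice. Transposition turns columns into
rows, and its determinant enters squared, hence as 1. -/
theorem det_mulLeftLin (C : Matrix (Fin 2) (Fin 2) ℝ) :
    LinearMap.det (mulLeftLin C) = C.det ^ 2 := by
  have h1 : transposeLin ∘ₗ transposeLin = LinearMap.id := rfl
  have h2 : mulLeftLin C = transposeLin ∘ₗ
      (LinearMap.pi fun i => Matrix.toLin' C ∘ₗ LinearMap.proj i) ∘ₗ transposeLin := by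
    ext a i j
    simp [mulLeftLin, transposeLin, Matrix.mulVec, dotProduct, Fin.sum_univ_two]
  have h3 := congrArg LinearMap.det h1
  rw [LinearMap.det_comp, LinearMap.det_id] at h3
  rw [h2, LinearMap.det_comp, LinearMap.det_comp, LinearMap.det_pi, mul_left_comm, h3]
  simp

/-- The matrix `A` with `ω A = η` and `ω^⊥ A = u η + v η^⊥`, where `(a, b)^⊥ = (-b, a)`. -/
noncomputable def matOf (ω η : Fin 2 → ℝ) (u v : ℝ) : Fin 2 → Fin 2 → ℝ :=
  ![fun j => (ω 0 * η j - ω 1 * ![u * η 0 - v * η 1, u * η 1 + v * η 0] j) / normSq ω,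
    fun j => (ω 1 * η j + ω 0 * ![u * η 0 - v * η 1, u * η 1 + v * η 0] j) / normSq ω]

/-- The matrix carries (ω, ω^⊥), of determinant ‖ω‖², to (η, uη + vη^⊥), of determinant v‖η‖². -/
theorem det_matOf {ω : Fin 2 → ℝ} (hω : ω ≠ 0) (η : Fin 2 → ℝ) (u v : ℝ) :
    (Matrix.of (matOf ω η u v)).det = v * normSq η / normSq ω := by
  have h := (normSq_pos hω).ne'
  simp only [matOf, Matrix.det_fin_two, Matrix.of_apply, Matrix.cons_val_zero,
    Matrix.cons_val_one]
  field_simp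
  simp only [normSq]
  ring

@[fun_prop]
theorem Measurable.matOf {α : Type*} [MeasurableSpace α] {ω η : α → Fin 2 → ℝ} {u v : α → ℝ}
    (hω : Measurable ω) (hη : Measurable η) (hu : Measurable u) (hv : Measurable v) :
    Measurable fun a => matOf (ω a) (η a) (u a) (v a) := by
  have hn : Measurable fun a => normSq (ω a) := measurable_normSq.comp hω
  refine measurable_pi_iff.2 fun i => measurable_pi_iff.2 fun j => ?_
  fin_cases i <;> fin_cases j <;> simp [AffinePlane.matOf] <;> fun_prop

/-- Coordinates p = uη + vη^⊥ with respect to an orthogonal basis of area ‖η‖². -/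
theorem lintegral_plane_eq {η : Fin 2 → ℝ} (hη : η ≠ 0) {g : (Fin 2 → ℝ) → ℝ≥0∞}
    (hg : Measurable g) : ∫⁻ p, g p = ENNReal.ofReal (normSq η) *
      ∫⁻ v : ℝ, ∫⁻ u : ℝ, g ![u * η 0 - v * η 1, u * η 1 + v * η 0] := by
  have hpos := normSq_pos hη
  have hdet : (!![η 0, -η 1; η 1, η 0] : Matrix (Fin 2) (Fin 2) ℝ).det = normSq η := by
    rw [Matrix.det_fin_two_of, normSq]; ring
  have h1 := lintegral_comp_linearMap (volume : Measure (Fin 2 → ℝ))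
    (L := Matrix.toLin' !![η 0, -η 1; η 1, η 0])
    (by rw [LinearMap.det_toLin', hdet]; exact hpos.ne') hg
  rw [LinearMap.det_toLin', hdet, abs_inv, abs_of_pos hpos] at h1
  have hgL : Measurable fun q : Fin 2 → ℝ => g (Matrix.toLin' !![η 0, -η 1; η 1, η 0] q) :=
    hg.comp (LinearMap.continuous_of_finiteDimensional _).measurable
  have h2 := (volume_preserving_piFinTwo fun _ : Fin 2 => ℝ).symm.lintegral_comp hgL
  have hgS : Measurable fun q : ℝ × ℝ => g (Matrix.toLin' !![η 0, -η 1; η 1, η 0]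
      ((MeasurableEquiv.piFinTwo fun _ : Fin 2 => ℝ).symm q)) :=
    hgL.comp (MeasurableEquiv.piFinTwo _).symm.measurable
  rw [Measure.volume_eq_prod, lintegral_prod_symm _ hgS.aemeasurable, h1] at h2
  have h3 : ∀ u v : ℝ, Matrix.toLin' !![η 0, -η 1; η 1, η 0]
      ((MeasurableEquiv.piFinTwo fun _ : Fin 2 => ℝ).symm (u, v))
      = ![u * η 0 - v * η 1, u * η 1 + v * η 0] := by
    intro u v
    ext i
    fin_cases i <;> simp [Matrix.mulVec, dotProduct, Fin.sum_univ_two] <;> ring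
  simp only [h3] at h2
  rw [h2, ← mul_assoc, ← ENNReal.ofReal_mul hpos.le, mul_inv_cancel₀ hpos.ne',
    ENNReal.ofReal_one, one_mul]

/-- A is C times the matrix with rows η = ωA and p = ω^⊥A, where C is the inverse of the matrix with
rows ω and ω^⊥. So dA = (det C)² dη dp with det C = ‖ω‖⁻², and dp = ‖η‖² du dv. -/
theorem lintegral_matOf {ω : Fin 2 → ℝ} (hω : ω ≠ 0) {h : (Fin 2 → Fin 2 → ℝ) → ℝ≥0∞}
    (hh : Measurable h) :
    ∫⁻ a, h a = ∫⁻ η : Fin 2 → ℝ, ∫⁻ v : ℝ, ∫⁻ u : ℝ,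
      ENNReal.ofReal (normSq η * (normSq ω)⁻¹ ^ 2) * h (matOf ω η u v) := by
  have hpos := normSq_pos hω
  set C : Matrix (Fin 2) (Fin 2) ℝ :=
    !![ω 0 / normSq ω, -(ω 1 / normSq ω); ω 1 / normSq ω, ω 0 / normSq ω] with hC
  have hdet : C.det = (normSq ω)⁻¹ := by
    rw [hC, Matrix.det_fin_two_of]
    field_simp
    unfold normSq; ring
  have h1 := lintegral_comp_linearMap (volume : Measure (Fin 2 → Fin 2 → ℝ))
    (L := mulLeftLin C) (by rw [det_mulLeftLin, hdet]; positivity) hh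
  rw [det_mulLeftLin, hdet, abs_of_pos (by positivity)] at h1
  have hLm : Measurable (mulLeftLin C) :=
    (LinearMap.continuous_of_finiteDimensional (mulLeftLin C)).measurable
  have hhL : Measurable fun a => h (mulLeftLin C a) := hh.comp hLm
  have h2 := (volume_preserving_piFinTwo fun _ : Fin 2 => Fin 2 → ℝ).symm.lintegral_comp hhL
  have hm2 : Measurable fun q : (Fin 2 → ℝ) × (Fin 2 → ℝ) =>
      h (mulLeftLin C ((MeasurableEquiv.piFinTwo fun _ : Fin 2 => Fin 2 → ℝ).symm q)) :=
    hhL.comp (MeasurableEquiv.piFinTwo _).symm.measurable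
  rw [Measure.volume_eq_prod, lintegral_prod _ hm2.aemeasurable, h1] at h2
  have h3 : ∫⁻ a, h a = ENNReal.ofReal ((normSq ω)⁻¹ ^ 2) * ∫⁻ η : Fin 2 → ℝ, ∫⁻ p,
      h (mulLeftLin C ((MeasurableEquiv.piFinTwo fun _ : Fin 2 => Fin 2 → ℝ).symm (η, p))) := by
    rw [h2, ← mul_assoc, ← ENNReal.ofReal_mul (by positivity), mul_inv_cancel₀ (by positivity),
      ENNReal.ofReal_one, one_mul]
  rw [h3, ← lintegral_const_mul _ hm2.lintegral_prod_right']
  refine lintegral_congr_ae ?_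
  -- At η = 0 the vectors η, η^⊥ are no basis; this is a null set.
  have h0 : ∀ᵐ η : Fin 2 → ℝ, η ≠ 0 := by simp [ae_iff]
  filter_upwards [h0] with η hη
  have h4 : ∀ u v, mulLeftLin C ((MeasurableEquiv.piFinTwo fun _ : Fin 2 => Fin 2 → ℝ).symm
      (η, ![u * η 0 - v * η 1, u * η 1 + v * η 0])) = matOf ω η u v := by
    intro u v
    ext i j
    fin_cases i <;> fin_cases j <;> simp [mulLeftLin, matOf, hC] <;> ring
  have hm4 : Measurable fun p => h (mulLeftLin C
      ((MeasurableEquiv.piFinTwo fun _ : Fin 2 => Fin 2 → ℝ).symm (η, p))) :=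
    hm2.comp measurable_prodMk_left
  rw [lintegral_plane_eq hη hm4, ← mul_assoc,
    ← ENNReal.ofReal_mul (by positivity), mul_comm ((normSq ω)⁻¹ ^ 2)]
  simp only [h4]
  have hm3 : Measurable fun q : ℝ × ℝ => h (matOf ω η q.2 q.1) :=
    hh.comp (by fun_prop)
  rw [← lintegral_const_mul _ hm3.lintegral_prod_right']
  exact lintegral_congr fun v => (lintegral_const_mul _ (hm3.comp measurable_prodMk_left)).symm

end ChangeOfVariables

/-! ### Haar measure of G₂ in the coordinates attached to a point of K. -/

section Coordinates

/-- The density `|det a|⁻³` of the left Haar measure of `G₂`. -/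
noncomputable def detWeight (a : Fin 2 → Fin 2 → ℝ) : ℝ≥0∞ :=
  ENNReal.ofReal (|(Matrix.of a).det|⁻¹ ^ 3)

theorem measurable_detWeight : Measurable detWeight := by
  unfold detWeight
  simp only [Matrix.det_fin_two, Matrix.of_apply]
  fun_prop

/-- The coordinates miss the singular matrices, but there `detWeight` is 0 because 0⁻¹ = 0, so the
integral may run over the whole space. -/
theorem lintegral_haar_G2 {h : (Fin 2 → ℝ) × (Fin 2 → Fin 2 → ℝ) → ℝ≥0∞} (hh : Measurable h) :
    ∫⁻ g, h g.coords ∂G2.haar = ∫⁻ p, detWeight p.2 * h p := by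
  have hd := measurable_detWeight
  have e : ∀ g : G2, ENNReal.ofReal (|(g.A : Matrix (Fin 2) (Fin 2) ℝ).det|⁻¹ ^ 3)
      = detWeight g.coords.2 := fun g => rfl
  have hc := G2.measurable_coords
  have hw : Measurable fun g : G2 => detWeight g.coords.2 := hd.comp (measurable_snd.comp hc)
  have := G2.measurableEmbedding_coords.lintegral_map (μ := volume.comap G2.coords)
    (fun p => detWeight p.2 * h p)
  rw [G2.measurableEmbedding_coords.map_comap] at this
  simp only [G2.haar, e]
  rw [lintegral_withDensity_eq_lintegral_mul _ hw (g := fun g : G2 => h g.coords) (hh.comp hc)]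
  simp only [Pi.mul_apply]
  rw [← this, ← lintegral_indicator G2.measurableEmbedding_coords.measurableSet_range]
  refine lintegral_congr fun p => ?_
  by_cases hp : p ∈ Set.range G2.coords
  · rw [Set.indicator_of_mem hp]
  · rw [Set.indicator_of_notMem hp]
    rw [G2.range_coords] at hp
    have h0 : (Matrix.of p.2).det = 0 := not_not.1 hp
    simp [detWeight, h0]

/-- The density of the Haar measure of `G₂` in the coordinates `(k', v, x, u)` attached to `k`. -/
noncomputable def dens (k : K) (z : K × ℝˣ) : ℝ :=
  normSq (freqVec k) * (normSq (freqVec z.1))⁻¹ * |(z.2 : ℝ)|⁻¹ ^ 2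

theorem lintegral_haarK_haarRstar {Φ : (Fin 2 → ℝ) × ℝ → ℝ≥0∞} (hΦ : Measurable Φ) :
    ∫⁻ k, (∫⁻ v : ℝˣ, Φ (freqVec k, v) ∂haarRstar) ∂haarK = ∫⁻ η, ∫⁻ v,
      ENNReal.ofReal (normSq η)⁻¹ * (ENNReal.ofReal |v|⁻¹ * Φ (η, v)) := by
  have hm : Measurable fun p : (Fin 2 → ℝ) × ℝ => ENNReal.ofReal |p.2|⁻¹ * Φ p := by fun_prop
  have e : ∀ η : Fin 2 → ℝ, ∫⁻ v : ℝˣ, Φ (η, v) ∂haarRstar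
      = ∫⁻ v : ℝ, ENNReal.ofReal |v|⁻¹ * Φ (η, v) := fun η =>
    lintegral_haarRstar (fun v => Φ (η, v)) (hΦ.comp measurable_prodMk_left)
  simp only [e]
  rw [lintegral_haarK (fun η => ∫⁻ v : ℝ, ENNReal.ofReal |v|⁻¹ * Φ (η, v))
    hm.lintegral_prod_right']
  exact lintegral_congr fun η =>
    (lintegral_const_mul _ (hm.comp (measurable_prodMk_left (x := η)))).symm

/-- With n = ‖ω‖² and m = ‖η‖², the left side is the Jacobian times |det A|⁻³. The right side is the
densities of μ_K and dv/|v| times `dens`. The cases m = 0 and v = 0 hold by 0⁻¹ = 0. -/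
theorem density_identity {n m : ℝ} (hn : 0 < n) (hm : 0 ≤ m) (v : ℝ) :
    m * n⁻¹ ^ 2 * |v * m / n|⁻¹ ^ 3 = m⁻¹ * (|v|⁻¹ * (n * m⁻¹ * |v|⁻¹ ^ 2)) := by
  rw [abs_div, abs_mul, abs_of_nonneg hm, abs_of_pos hn]
  rcases eq_or_ne m 0 with h0 | h0
  · simp [h0]
  rcases eq_or_ne |v| 0 with h1 | h1
  · simp [h1]
  field_simp

theorem measurable_dens_mul (k : K) {h : (Fin 2 → Fin 2 → ℝ) → ℝ≥0∞} (hh : Measurable h) :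
    Measurable fun p : ((Fin 2 → ℝ) × ℝ) × ℝ =>
      ENNReal.ofReal (normSq (freqVec k) * (normSq p.1.1)⁻¹ * |p.1.2|⁻¹ ^ 2)
        * h (matOf (freqVec k) p.1.1 p.2 p.1.2) := by
  have hn := measurable_normSq
  have h1 : Measurable fun p : ((Fin 2 → ℝ) × ℝ) × ℝ => matOf (freqVec k) p.1.1 p.2 p.1.2 := by
    fun_prop
  have h2 : Measurable fun p : ((Fin 2 → ℝ) × ℝ) × ℝ =>
    normSq (freqVec k) * (normSq p.1.1)⁻¹ * |p.1.2|⁻¹ ^ 2 := by fun_prop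
  exact h2.ennreal_ofReal.mul (hh.comp h1)

theorem lintegral_detWeight (k : K) {h : (Fin 2 → Fin 2 → ℝ) → ℝ≥0∞} (hh : Measurable h) :
    ∫⁻ a, detWeight a * h a = ∫⁻ k', (∫⁻ v : ℝˣ, (∫⁻ u : ℝ, ENNReal.ofReal (dens k (k', v)) *
      h (matOf (freqVec k) (freqVec k') u v)) ∂haarRstar) ∂haarK := by
  have hω := freqVec_ne_zero k
  have hM := measurable_dens_mul k hh
  have e := lintegral_haarK_haarRstar (hM.lintegral_prod_right' (ν := (volume : Measure ℝ)))
  simp only [dens]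
  rw [e, lintegral_matOf hω (h := fun a => detWeight a * h a) (measurable_detWeight.mul hh)]
  refine lintegral_congr fun η => lintegral_congr fun v => ?_
  have hM1 : Measurable fun u : ℝ => matOf (freqVec k) η u v := by fun_prop
  have hM' : Measurable fun u : ℝ =>
      ENNReal.ofReal (normSq (freqVec k) * (normSq η)⁻¹ * |v|⁻¹ ^ 2)
        * h (matOf (freqVec k) η u v) := measurable_const.mul (hh.comp hM1)
  rw [← mul_assoc, ← lintegral_const_mul _ hM']
  refine lintegral_congr fun u => ?_
  have hη := normSq_nonneg η
  have hω' := normSq_nonneg (freqVec k)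
  have key := congrArg ENNReal.ofReal (density_identity (normSq_pos hω) hη v)
  rw [ENNReal.ofReal_mul (p := normSq η * (normSq (freqVec k))⁻¹ ^ 2)
      (mul_nonneg hη (by positivity)), ENNReal.ofReal_mul (inv_nonneg.2 hη),
    ENNReal.ofReal_mul (p := |v|⁻¹) (by positivity)] at key
  rw [detWeight, det_matOf hω, ← mul_assoc, key]
  simp only [mul_assoc]

/-- The matrix `matOf` as an element of `GL₂(ℝ)`. -/
noncomputable def matGL (k k' : K) (u : ℝ) (v : ℝˣ) : GL (Fin 2) ℝ :=
  Matrix.GeneralLinearGroup.mkOfDetNeZero (Matrix.of (matOf (freqVec k) (freqVec k') u v)) (by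
    rw [det_matOf (freqVec_ne_zero k)]
    exact div_ne_zero (mul_ne_zero v.ne_zero (normSq_pos (freqVec_ne_zero k')).ne')
      (normSq_pos (freqVec_ne_zero k)).ne')

theorem coe_matGL (k k' : K) (u : ℝ) (v : ℝˣ) :
    (matGL k k' u v : Matrix (Fin 2) (Fin 2) ℝ)
      = Matrix.of (matOf (freqVec k) (freqVec k') u v) := rfl

theorem det_matGL (k k' : K) (u : ℝ) (v : ℝˣ) :
    (matGL k k' u v : Matrix (Fin 2) (Fin 2) ℝ).det
      = v * normSq (freqVec k') / normSq (freqVec k) := det_matOf (freqVec_ne_zero k) _ _ _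

theorem rowMul_matGL (k k' : K) (u : ℝ) (v : ℝˣ) :
    rowMul (freq k) (matGL k k' u v) = freq k' := by
  have h := (normSq_pos (freqVec_ne_zero k)).ne'
  apply Subtype.ext
  change Matrix.vecMul (freqVec k) (matGL k k' u v : Matrix (Fin 2) (Fin 2) ℝ) = freqVec k'
  ext j
  simp only [coe_matGL, matOf, Matrix.vecMul, dotProduct, Fin.sum_univ_two, Matrix.of_apply,
    Matrix.cons_val_zero, Matrix.cons_val_one]
  field_simp
  simp only [normSq]
  ring

/-- Together with `uCoef_matGL`: the parameters of the representation are the coordinates of ω^⊥A in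
the basis η, η^⊥. -/
theorem vCoef_matGL (k k' : K) (u : ℝ) (v : ℝˣ) : vCoef (freq k) (matGL k k' u v) = v := by
  have h := (normSq_pos (freqVec_ne_zero k)).ne'
  have h' := (normSq_pos (freqVec_ne_zero k')).ne'
  apply Units.ext
  simp only [vCoef, Units.val_mk0, rowMul_matGL, det_matGL]
  simp only [freq]
  field_simp

theorem uCoef_matGL (k k' : K) (u : ℝ) (v : ℝˣ) : uCoef (freq k) (matGL k k' u v) = u := by
  have h := (normSq_pos (freqVec_ne_zero k)).ne'
  have h' := (normSq_pos (freqVec_ne_zero k')).ne'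
  rw [uCoef_eq, rowMul_matGL]
  simp only [freq, coe_matGL, matOf, Matrix.of_apply, Matrix.cons_val_zero, Matrix.cons_val_one]
  field_simp
  simp only [normSq]
  ring

/-- From |det A| = |v|‖η‖²/‖ω‖² all norms cancel. -/
theorem weight_matGL (k k' : K) (u : ℝ) (v : ℝˣ) :
    weight (freq k) (matGL k k' u v) = √|(v : ℝ)| := by
  have h := normSq_pos (freqVec_ne_zero k)
  have h' := normSq_pos (freqVec_ne_zero k')
  have h1 := rowNorm_pos (freqVec_ne_zero k)
  have h2 := rowNorm_pos (freqVec_ne_zero k')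
  rw [weight, rowMul_matGL, det_matGL, abs_div, abs_mul, abs_of_pos h, abs_of_pos h',
    Real.sqrt_div (by positivity), Real.sqrt_mul (abs_nonneg _)]
  simp only [freq]
  change _ * rowNorm (freqVec k') / rowNorm (freqVec k) * _ / _ = _
  field_simp

/-- The parametrization of `G₂` attached to `k ∈ K`: the coordinates of `[x, A]` are `k'`, `v`, `x`
and `u`, where `k` and `k'` have frequencies `ω` and `ω A`, and `u = u_{ω,A}`, `v = v_{ω,A}`. -/
noncomputable def psi (k : K) (p : (K × ℝˣ) × ((Fin 2 → ℝ) × ℝ)) : G2 :=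
  ⟨p.2.1, matGL k p.1.1 p.2.2 p.1.2⟩

theorem coords_psi (k : K) (p : (K × ℝˣ) × ((Fin 2 → ℝ) × ℝ)) :
    (psi k p).coords = (p.2.1, matOf (freqVec k) (freqVec p.1.1) p.2.2 p.1.2) := rfl

theorem measurable_psi :
    Measurable fun q : K × ((K × ℝˣ) × ((Fin 2 → ℝ) × ℝ)) => psi q.1 q.2 := by
  have h1 := measurable_freqVec
  have h2 := measurable_coe_units
  have h3 : Measurable fun q : K × ((K × ℝˣ) × ((Fin 2 → ℝ) × ℝ)) =>
    matOf (freqVec q.1) (freqVec q.2.1.1) q.2.2.2 q.2.1.2 := by fun_prop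
  exact measurable_comap_iff.2 (Measurable.prodMk (by fun_prop) h3)

theorem measurable_dens : Measurable fun q : K × (K × ℝˣ) => dens q.1 q.2 := by
  have h0 := measurable_normSq
  have h1 := measurable_freqVec
  have h2 := measurable_coe_units
  unfold dens
  fun_prop

/-- The measure on `K × ℝ*` with density `dens k`. -/
noncomputable def densMeasure (k : K) : Measure (K × ℝˣ) :=
  haarZ.withDensity fun z => ENNReal.ofReal (dens k z)

instance (k : K) : SigmaFinite (densMeasure k) := by unfold densMeasure; infer_instance

theorem lintegral_densMeasure (k : K) {h : K × ℝˣ → ℝ≥0∞} (hh : Measurable h) :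
    ∫⁻ z, h z ∂densMeasure k = ∫⁻ z, ENNReal.ofReal (dens k z) * h z ∂haarZ := by
  have hd : Measurable fun z => ENNReal.ofReal (dens k z) :=
    (measurable_dens.comp measurable_prodMk_left).ennreal_ofReal
  rw [densMeasure, lintegral_withDensity_eq_lintegral_mul _ hd hh]
  rfl

theorem lintegral_detWeight_eq (k : K) {h : (Fin 2 → Fin 2 → ℝ) → ℝ≥0∞} (hh : Measurable h) :
    ∫⁻ a, detWeight a * h a =
      ∫⁻ z, (∫⁻ u : ℝ, h (matOf (freqVec k) (freqVec z.1) u z.2)) ∂densMeasure k := by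
  have h1 := measurable_freqVec
  have h2 := measurable_coe_units
  have h3 : Measurable fun q : (K × ℝˣ) × ℝ =>
    matOf (freqVec k) (freqVec q.1.1) q.2 q.1.2 := by fun_prop
  have hm := hh.comp h3
  have hd : Measurable fun z => ENNReal.ofReal (dens k z) :=
    (measurable_dens.comp measurable_prodMk_left).ennreal_ofReal
  have hi : Measurable fun z : K × ℝˣ => ∫⁻ u : ℝ, h (matOf (freqVec k) (freqVec z.1) u z.2) :=
    hm.lintegral_prod_right' (ν := (volume : Measure ℝ))
  have hdi : Measurable fun z : K × ℝˣ => ENNReal.ofReal (dens k z) *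
    ∫⁻ u : ℝ, h (matOf (freqVec k) (freqVec z.1) u z.2) := hd.mul hi
  rw [lintegral_densMeasure k hi, lintegral_prod _ hdi.aemeasurable, lintegral_detWeight k hh]
  refine lintegral_congr fun k' => lintegral_congr fun v => ?_
  have hmu : Measurable fun u : ℝ => h (matOf (freqVec k) (freqVec k') u v) :=
    hh.comp (by fun_prop)
  rw [lintegral_const_mul _ hmu]

/-- The coordinates move with k, so integrals over G₂ that arise at an output point (k, t) are to be
computed in the chart of that k. -/
theorem measurePreserving_psi (k : K) :
    MeasurePreserving (psi k) ((densMeasure k).prod volume) G2.haar := by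
  have hm : Measurable (psi k) := measurable_psi.comp measurable_prodMk_left
  refine ⟨hm, Measure.ext fun s hs => ?_⟩
  obtain ⟨h, hh, hhs⟩ := G2.measurableEmbedding_coords.exists_measurable_extend
    (g := s.indicator (1 : G2 → ℝ≥0∞)) (measurable_one.indicator hs) (fun _ => inferInstance)
  have hs' : ∀ g, s.indicator (1 : G2 → ℝ≥0∞) g = h g.coords := fun g => (congrFun hhs g).symm
  rw [← lintegral_indicator_one hs, ← lintegral_indicator_one hs,
    lintegral_map (measurable_one.indicator hs) hm]
  simp only [hs', coords_psi]
  have hd := measurable_detWeight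
  have hdh : Measurable fun p : (Fin 2 → ℝ) × (Fin 2 → Fin 2 → ℝ) => detWeight p.2 * h p := by
    fun_prop
  rw [lintegral_haar_G2 hh, Measure.volume_eq_prod (Fin 2 → ℝ) (Fin 2 → Fin 2 → ℝ),
    lintegral_prod _ hdh.aemeasurable]
  have hM : Measurable fun q : (K × ℝˣ) × ((Fin 2 → ℝ) × ℝ) =>
      h (q.2.1, matOf (freqVec k) (freqVec q.1.1) q.2.2 q.1.2) :=
    hh.comp (G2.measurable_coords.comp hm)
  have hM' : Measurable fun q : ((Fin 2 → ℝ) × (K × ℝˣ)) × ℝ =>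
      h (q.1.1, matOf (freqVec k) (freqVec q.1.2.1) q.2 q.1.2.2) :=
    hM.comp (f := fun q : ((Fin 2 → ℝ) × (K × ℝˣ)) × ℝ => (q.1.2, (q.1.1, q.2))) (by fun_prop)
  have e : ∀ x, ∫⁻ a, detWeight a * h (x, a) = ∫⁻ z, (∫⁻ u : ℝ,
      h (x, matOf (freqVec k) (freqVec z.1) u z.2)) ∂densMeasure k := fun x =>
    lintegral_detWeight_eq k (hh.comp measurable_prodMk_left)
  simp only [e]
  -- The change of variables in A was made with x fixed; the exchange brings x next to u, as in the
  -- domain of `psi`.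
  rw [lintegral_prod _ hM.aemeasurable, lintegral_lintegral_swap
    (f := fun (x : Fin 2 → ℝ) (z : K × ℝˣ) =>
      ∫⁻ u : ℝ, h (x, matOf (freqVec k) (freqVec z.1) u z.2))
    (hM'.lintegral_prod_right' (ν := (volume : Measure ℝ))).aemeasurable]
  refine lintegral_congr fun z => ?_
  rw [Measure.volume_eq_prod, lintegral_prod]
  exact (hM.comp measurable_prodMk_left).aemeasurable

end Coordinates

/-! ### Inversion on ℝ* and the passage from μ_K to Lebesgue measure. -/

section Substitutions

theorem measurable_section_left {α β γ : Type*} [MeasurableSpace α] [MeasurableSpace β]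
    [MeasurableSpace γ] (F : α → β → γ) (h : Measurable fun p : α × β => F p.1 p.2) (a : α) :
    Measurable (F a) := h.comp measurable_prodMk_left

theorem measurable_section_right {α β γ : Type*} [MeasurableSpace α] [MeasurableSpace β]
    [MeasurableSpace γ] (F : α → β → γ) (h : Measurable fun p : α × β => F p.1 p.2) (b : β) :
    Measurable fun a => F a b := h.comp measurable_prodMk_right

/-- Being nonzero is what upgrades left invariance to a Haar measure; on a commutative group this
gives invariance under inversion, needed for τ = 1/t and v = t/s. -/
instance : NeZero haarRstar := ⟨by
  intro h0
  -- The factor |t| cancels the density, so the test function has integral equal to the length of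
  -- [1, 2].
  have h := lintegral_haarRstar (fun t => ENNReal.ofReal |t| * (Set.Icc 1 2).indicator 1 t)
    (Measurable.mul (by fun_prop) (measurable_one.indicator measurableSet_Icc))
  have e : ∀ t : ℝ, ENNReal.ofReal |t|⁻¹ * (ENNReal.ofReal |t| *
      (Set.Icc (1 : ℝ) 2).indicator 1 t) = (Set.Icc (1 : ℝ) 2).indicator 1 t := by
    intro t
    by_cases ht : t ∈ Set.Icc (1 : ℝ) 2
    · have : 0 < |t| := abs_pos.2 (by linarith [ht.1])
      rw [← mul_assoc, ← ENNReal.ofReal_mul (by positivity), inv_mul_cancel₀ this.ne',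
        ENNReal.ofReal_one, one_mul]
    · simp [Set.indicator_of_notMem ht]
  simp only [e] at h
  rw [h0, lintegral_zero_measure, lintegral_indicator_one measurableSet_Icc] at h
  norm_num at h⟩

instance : haarRstar.IsOpenPosMeasure := isOpenPosMeasure_of_mulLeftInvariant_of_regular

instance : haarRstar.IsHaarMeasure where

instance : haarRstar.IsInvInvariant := inferInstance

/-- The substitution τ = 1/t: inversion preserves dt/|t|, and the remaining factor |τ| cancels its
density. -/
theorem lintegral_haarRstar_inv {G : ℝ → ℝ≥0∞} (hG : Measurable G) :
    ∫⁻ t : ℝˣ, ENNReal.ofReal |(t : ℝ)|⁻¹ * G (t : ℝ)⁻¹ ∂haarRstar = ∫⁻ τ, G τ := by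
  have h := (Measure.measurePreserving_inv haarRstar).lintegral_comp_emb
    (MeasurableEquiv.inv ℝˣ).measurableEmbedding
    (fun t : ℝˣ => ENNReal.ofReal |(t : ℝ)| * G (t : ℝ))
  simp only [Units.val_inv_eq_inv_val, abs_inv] at h
  rw [h, lintegral_haarRstar (fun t => ENNReal.ofReal |t| * G t) (by fun_prop)]
  refine lintegral_congr_ae ?_
  have h0 : ∀ᵐ t : ℝ, t ≠ 0 := by simp [ae_iff]
  filter_upwards [h0] with t ht
  rw [← mul_assoc, ← ENNReal.ofReal_mul (by positivity), inv_mul_cancel₀ (abs_ne_zero.2 ht),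
    ENNReal.ofReal_one, one_mul]

theorem lintegral_normSq_haarK {G : (Fin 2 → ℝ) → ℝ≥0∞} (hG : Measurable G) :
    ∫⁻ k, ENNReal.ofReal (normSq (freqVec k)) * G (freqVec k) ∂haarK = ∫⁻ ω, G ω := by
  have hn := measurable_normSq
  rw [lintegral_haarK (fun ω => ENNReal.ofReal (normSq ω) * G ω) (by fun_prop)]
  refine lintegral_congr_ae ?_
  have h0 : ∀ᵐ η : Fin 2 → ℝ, η ≠ 0 := by simp [ae_iff]
  filter_upwards [h0] with η hη
  rw [← mul_assoc, ← ENNReal.ofReal_mul (inv_nonneg.2 (normSq_nonneg _)),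
    inv_mul_cancel₀ (normSq_pos hη).ne', ENNReal.ofReal_one, one_mul]

/-- The map `(k', s) ↦ (k', t / s)` preserves the measure of `K × ℝ*`. -/
theorem measurePreserving_div (t : ℝˣ) :
    MeasurePreserving (fun y : K × ℝˣ => (y.1, t * y.2⁻¹)) haarZ haarZ := by
  have h1 : MeasurePreserving (fun s : ℝˣ => t * s⁻¹) haarRstar haarRstar :=
    (measurePreserving_mul_left t).comp (Measure.measurePreserving_inv haarRstar)
  exact (MeasurePreserving.id haarK).prod h1

theorem div_invol (t : ℝˣ) (y : K × ℝˣ) :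
    (fun y : K × ℝˣ => (y.1, t * y.2⁻¹)) ((fun y : K × ℝˣ => (y.1, t * y.2⁻¹)) y) = y := by
  ext <;> simp

end Substitutions

/-! ### Plancherel's theorem in the translation variable. -/

section PartialFourier

theorem measurable_dotProduct :
    Measurable fun p : (Fin 2 → ℝ) × (Fin 2 → ℝ) => p.1 ⬝ᵥ p.2 := by
  simp only [dotProduct, Fin.sum_univ_two]
  fun_prop

theorem measurable_unitExp : Measurable unitExp := continuous_unitExp.measurable

/-- The Fourier transform in the translation variable. -/
noncomputable def fourierX (h : (Fin 2 → ℝ) × (Fin 2 → Fin 2 → ℝ) → ℂ) (ω : Fin 2 → ℝ)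
    (a : Fin 2 → Fin 2 → ℝ) : ℂ := ∫ x, h (x, a) * unitExp (ω ⬝ᵥ x)

variable {h : (Fin 2 → ℝ) × (Fin 2 → Fin 2 → ℝ) → ℂ}

theorem measurable_fourierX (hh : Measurable h) :
    Measurable fun p : (Fin 2 → ℝ) × (Fin 2 → Fin 2 → ℝ) => fourierX h p.1 p.2 := by
  have h1 := measurable_dotProduct
  have h2 := measurable_unitExp
  have : Measurable fun q : ((Fin 2 → ℝ) × (Fin 2 → Fin 2 → ℝ)) × (Fin 2 → ℝ) =>
      h (q.2, q.1.2) * unitExp (q.1.1 ⬝ᵥ q.2) := by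
    have h3 : Measurable fun q : ((Fin 2 → ℝ) × (Fin 2 → Fin 2 → ℝ)) × (Fin 2 → ℝ) =>
      q.1.1 ⬝ᵥ q.2 := h1.comp (f := fun q : ((Fin 2 → ℝ) × (Fin 2 → Fin 2 → ℝ)) × (Fin 2 → ℝ) =>
        (q.1.1, q.2)) (by fun_prop)
    fun_prop
  exact (this.stronglyMeasurable.integral_prod_right').measurable

/-- After an exchange of integrals this is Plancherel in x for fixed a, weighted by `detWeight a`,
which does not depend on ω. -/
theorem lintegral_fourierX (hh : Measurable h) (h1 : ∫⁻ p, detWeight p.2 * ‖h p‖ₑ < ∞)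
    (h2 : ∫⁻ p, detWeight p.2 * ‖h p‖ₑ ^ 2 < ∞) :
    ∫⁻ ω, ∫⁻ a, detWeight a * ‖fourierX h ω a‖ₑ ^ 2 = ∫⁻ p, detWeight p.2 * ‖h p‖ₑ ^ 2 := by
  have hd := measurable_detWeight
  have hF := measurable_fourierX hh
  -- Fubini gives finiteness of the x-integral only where the weight is nonzero; where it vanishes,
  -- both sides of the claim are 0.
  have fin : ∀ (n : ℕ), ∫⁻ p, detWeight p.2 * ‖h p‖ₑ ^ n < ∞ →
      ∀ᵐ a, detWeight a = 0 ∨ ∫⁻ x, ‖h (x, a)‖ₑ ^ n < ∞ := by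
    intro n hn
    have hm : Measurable fun p : (Fin 2 → ℝ) × (Fin 2 → Fin 2 → ℝ) =>
      detWeight p.2 * ‖h p‖ₑ ^ n := by fun_prop
    rw [Measure.volume_eq_prod, lintegral_prod_symm _ hm.aemeasurable] at hn
    filter_upwards [ae_lt_top hm.lintegral_prod_left' hn.ne] with a ha
    by_cases h0 : detWeight a = 0
    · exact .inl h0
    · refine .inr ?_
      have hm' : Measurable fun x : Fin 2 → ℝ => ‖h (x, a)‖ₑ ^ n := by fun_prop
      rw [lintegral_const_mul _ hm'] at ha
      exact lt_top_iff_ne_top.2 fun e => by simp [e, h0] at ha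
  have hm1 : Measurable fun p : (Fin 2 → ℝ) × (Fin 2 → Fin 2 → ℝ) =>
      detWeight p.2 * ‖fourierX h p.1 p.2‖ₑ ^ 2 := by fun_prop
  have hm2 : Measurable fun p : (Fin 2 → ℝ) × (Fin 2 → Fin 2 → ℝ) =>
      detWeight p.2 * ‖h p‖ₑ ^ 2 := by fun_prop
  rw [Measure.volume_eq_prod, lintegral_prod_symm _ hm2.aemeasurable,
    lintegral_lintegral_swap hm1.aemeasurable]
  refine lintegral_congr_ae ?_
  filter_upwards [fin 1 (by simpa using h1), fin 2 h2] with a ha1 ha2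
  by_cases h0 : detWeight a = 0
  · simp [h0]
  have ha1 := ha1.resolve_left h0
  have ha2 := ha2.resolve_left h0
  have hhm : Measurable fun x : Fin 2 → ℝ => h (x, a) := by fun_prop
  have hFm : Measurable fun ω : Fin 2 → ℝ => fourierX h ω a := hF.comp measurable_prodMk_right
  rw [lintegral_const_mul _ (by fun_prop), lintegral_const_mul _ (by fun_prop)]
  congr 1
  refine plancherel_plane ⟨hhm.aestronglyMeasurable, ?_⟩
    ((memLp_two_iff_lintegral hhm.aestronglyMeasurable).2 ha2)
  simpa [HasFiniteIntegral] using ha1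

end PartialFourier

/-! ### The integral kernel of σ(f)T and its L² norm. -/

section Kernel

variable {f : G2 → ℂ}

/-- The Fourier transform of `f` in the coordinates `(x, u)` attached to `k`. -/
noncomputable def fourierXU (f : G2 → ℂ) (k : K) (τ : ℝ) (z : K × ℝˣ) : ℂ :=
  ∫ q : (Fin 2 → ℝ) × ℝ, f (psi k (z, q)) * (unitExp (freqVec k ⬝ᵥ q.1) * unitExp (τ * q.2))

theorem measurable_fourierXU (hf : Measurable f) :
    Measurable fun p : (K × ℝ) × (K × ℝˣ) => fourierXU f p.1.1 p.1.2 p.2 := by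
  have h1 := measurable_unitExp
  have h2 := measurable_freqVec
  have h3 : Measurable fun q : ((K × ℝ) × (K × ℝˣ)) × ((Fin 2 → ℝ) × ℝ) =>
    f (psi q.1.1.1 (q.1.2, q.2)) := hf.comp (measurable_psi.comp
      (f := fun q : ((K × ℝ) × (K × ℝˣ)) × ((Fin 2 → ℝ) × ℝ) => (q.1.1.1, (q.1.2, q.2)))
      (by fun_prop))
  have h4 : Measurable fun q : ((K × ℝ) × (K × ℝˣ)) × ((Fin 2 → ℝ) × ℝ) =>
    freqVec q.1.1.1 ⬝ᵥ q.2.1 := measurable_dotProduct.comp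
      (f := fun q : ((K × ℝ) × (K × ℝˣ)) × ((Fin 2 → ℝ) × ℝ) => (freqVec q.1.1.1, q.2.1))
      (by fun_prop)
  have : Measurable fun q : ((K × ℝ) × (K × ℝˣ)) × ((Fin 2 → ℝ) × ℝ) =>
    f (psi q.1.1.1 (q.1.2, q.2)) *
      (unitExp (freqVec q.1.1.1 ⬝ᵥ q.2.1) * unitExp (q.1.1.2 * q.2.2)) :=
    h3.mul (by fun_prop)
  exact (this.stronglyMeasurable.integral_prod_right').measurable

theorem integrable_comp_psi (h1 : Integrable f G2.haar) (k : K) :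
    ∀ᵐ z ∂densMeasure k, Integrable fun q => f (psi k (z, q)) :=
  ((measurePreserving_psi k).integrable_comp_of_integrable h1).prod_right_ae

/-- Integrating over x first leaves a function of u alone, to which one-dimensional Plancherel
applies: it is in L¹ by Fubini, and in L² for almost every z by `hk`. -/
theorem lintegral_fourierXU (h1 : Integrable f G2.haar) {h : (Fin 2 → ℝ) × (Fin 2 → Fin 2 → ℝ) → ℂ}
    (hh : Measurable h) (hfh : ∀ g, f g = h g.coords) (k : K)
    (hk : ∫⁻ z, (∫⁻ u : ℝ, ‖fourierX h (freqVec k) (matOf (freqVec k) (freqVec z.1) u z.2)‖ₑ ^ 2)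
      ∂densMeasure k < ∞) :
    ∫⁻ z, (∫⁻ τ : ℝ, ‖fourierXU f k τ z‖ₑ ^ 2) ∂densMeasure k =
      ∫⁻ z, (∫⁻ u : ℝ, ‖fourierX h (freqVec k) (matOf (freqVec k) (freqVec z.1) u z.2)‖ₑ ^ 2)
        ∂densMeasure k := by
  have hF := measurable_fourierX hh
  have m1 := measurable_freqVec
  have m2 := measurable_coe_units
  have hm : Measurable fun q : (K × ℝˣ) × ℝ =>
      ‖fourierX h (freqVec k) (matOf (freqVec k) (freqVec q.1.1) q.2 q.1.2)‖ₑ ^ 2 :=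
    (hF.comp (f := fun q : (K × ℝˣ) × ℝ =>
      (freqVec k, matOf (freqVec k) (freqVec q.1.1) q.2 q.1.2)) (by fun_prop)).enorm.pow_const 2
  refine lintegral_congr_ae ?_
  filter_upwards [integrable_comp_psi h1 k,
    ae_lt_top (hm.lintegral_prod_right' (ν := (volume : Measure ℝ))) hk.ne] with z hz1 hz2
  have mu := measurable_unitExp
  have hu : Integrable fun q : (Fin 2 → ℝ) × ℝ =>
      f (psi k (z, q)) * unitExp (freqVec k ⬝ᵥ q.1) := by
    refine hz1.mul_bdd (c := 1) ?_ (.of_forall fun q => (norm_unitExp _).le)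
    exact (mu.comp (measurable_dotProduct.comp
      (f := fun q : (Fin 2 → ℝ) × ℝ => (freqVec k, q.1)) (by fun_prop))).aestronglyMeasurable
  have hφ : ∀ u, ∫ x, f (psi k (z, (x, u))) * unitExp (freqVec k ⬝ᵥ x)
      = fourierX h (freqVec k) (matOf (freqVec k) (freqVec z.1) u z.2) := by
    intro u
    simp only [hfh, coords_psi]
    rfl
  have hφi : Integrable fun u => fourierX h (freqVec k)
      (matOf (freqVec k) (freqVec z.1) u z.2) := by
    rw [Measure.volume_eq_prod] at hu
    have := hu.integral_prod_right
    simpa only [hφ] using this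
  have hφ2 : MemLp (fun u => fourierX h (freqVec k)
      (matOf (freqVec k) (freqVec z.1) u z.2)) 2 volume :=
    (memLp_two_iff_lintegral hφi.1).2 hz2
  rw [← plancherel_real hφi hφ2]
  refine lintegral_congr fun τ => ?_
  congr 2
  have hu' : Integrable (fun q : (Fin 2 → ℝ) × ℝ => f (psi k (z, q)) *
      (unitExp (freqVec k ⬝ᵥ q.1) * unitExp (τ * q.2))) (volume.prod volume) := by
    simp only [← mul_assoc]
    refine hu.mul_bdd (c := 1) ?_ (.of_forall fun q => (norm_unitExp _).le)
    exact (by fun_prop : Measurable fun q : (Fin 2 → ℝ) × ℝ =>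
      unitExp (τ * q.2)).aestronglyMeasurable
  rw [fourierXU, Measure.volume_eq_prod, integral_prod_symm _ hu']
  refine integral_congr_ae (.of_forall fun u => ?_)
  simp only [← hφ, ← mul_assoc]
  exact integral_mul_const _ _

/-- The factor in front of the Fourier transform in the integral kernel of `σ(f) T`. -/
noncomputable def kernFactor (z y : K × ℝˣ) : ℝ :=
  normSq (freqVec z.1) * (rowNorm (freqVec y.1))⁻¹ * |(y.2 : ℝ)|⁻¹ * (√|(z.2 : ℝ)|)⁻¹

/-- The integral kernel of `σ(f) T`, in the variables `(k, t)` and `(k', v)` with `v = t / s`. -/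
noncomputable def kernV (f : G2 → ℂ) (z y : K × ℝˣ) : ℂ :=
  kernFactor z y * fourierXU f z.1 (z.2 : ℝ)⁻¹ y

/-- The integral kernel of `σ(f) T`. -/
noncomputable def kern (f : G2 → ℂ) (z y : K × ℝˣ) : ℂ := kernV f z (y.1, z.2 * y.2⁻¹)

theorem measurable_kernFactor :
    Measurable fun p : (K × ℝˣ) × (K × ℝˣ) => kernFactor p.1 p.2 := by
  have m0 := measurable_normSq
  have m1 := measurable_freqVec
  have m2 := measurable_coe_units
  have m3 := measurable_rowNorm
  unfold kernFactor
  fun_prop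

theorem measurable_kernV (hf : Measurable f) :
    Measurable fun p : (K × ℝˣ) × (K × ℝˣ) => kernV f p.1 p.2 := by
  have m2 := measurable_coe_units
  exact (Complex.measurable_ofReal.comp measurable_kernFactor).mul
    ((measurable_fourierXU hf).comp
      (f := fun p : (K × ℝˣ) × (K × ℝˣ) => ((p.1.1, (p.1.2 : ℝ)⁻¹), p.2)) (by fun_prop))

theorem measurable_kern (hf : Measurable f) :
    Measurable fun p : (K × ℝˣ) × (K × ℝˣ) => kern f p.1 p.2 :=
  (measurable_kernV hf).comp
    (f := fun p : (K × ℝˣ) × (K × ℝˣ) => (p.1, (p.2.1, p.1.2 * p.2.2⁻¹)))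
    (by fun_prop)

/-- Here the weight of T proves to be the right one: ‖ω‖² turns μ_K into dω, |t|⁻¹ turns dt/|t| into
dτ, and `dens` is the density of the Haar measure of G₂. -/
theorem kernFactor_sq (z y : K × ℝˣ) : kernFactor z y ^ 2 =
    normSq (freqVec z.1) * dens z.1 y * |(z.2 : ℝ)|⁻¹ := by
  have h2 : rowNorm (freqVec y.1) ^ 2 = normSq (freqVec y.1) := Real.sq_sqrt (normSq_nonneg _)
  have h3 : √|(z.2 : ℝ)| ^ 2 = |(z.2 : ℝ)| := Real.sq_sqrt (abs_nonneg _)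
  simp only [kernFactor, dens, mul_pow, inv_pow, h2, h3]
  ring

theorem enorm_kernV_sq (z y : K × ℝˣ) :
    ‖kernV f z y‖ₑ ^ 2 = ENNReal.ofReal (normSq (freqVec z.1)) * (ENNReal.ofReal (dens z.1 y) *
      (ENNReal.ofReal |(z.2 : ℝ)|⁻¹ * ‖fourierXU f z.1 (z.2 : ℝ)⁻¹ y‖ₑ ^ 2)) := by
  have hn := normSq_nonneg (freqVec z.1)
  have hdn : 0 ≤ dens z.1 y := by
    have := normSq_nonneg (freqVec y.1)
    unfold dens; positivity
  rw [kernV, enorm_mul, mul_pow, ← ofReal_norm, Complex.norm_real,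
    ← ENNReal.ofReal_pow (norm_nonneg _), Real.norm_eq_abs, sq_abs, kernFactor_sq,
    ENNReal.ofReal_mul (mul_nonneg hn hdn), ENNReal.ofReal_mul hn, mul_assoc, mul_assoc]

theorem lintegral_kern_eq_kernV (hf : Measurable f) (z : K × ℝˣ) :
    ∫⁻ y, ‖kern f z y‖ₑ ^ 2 ∂haarZ = ∫⁻ y, ‖kernV f z y‖ₑ ^ 2 ∂haarZ := by
  have hV : Measurable (kernV f z) := measurable_section_left (kernV f) (measurable_kernV hf) z
  exact (measurePreserving_div z.2).lintegral_comp (f := fun y => ‖kernV f z y‖ₑ ^ 2)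
    (hV.enorm.pow_const 2)

theorem lintegral_kernV (hf : Measurable f) (k : K) :
    ∫⁻ t : ℝˣ, (∫⁻ y, ‖kernV f (k, t) y‖ₑ ^ 2 ∂haarZ) ∂haarRstar
      = ENNReal.ofReal (normSq (freqVec k)) *
        ∫⁻ z, (∫⁻ τ : ℝ, ‖fourierXU f k τ z‖ₑ ^ 2) ∂densMeasure k := by
  have mc := measurable_coe_units
  have hdk : Measurable fun y => ENNReal.ofReal (dens k y) :=
    (measurable_dens.comp measurable_prodMk_left).ennreal_ofReal
  have hXk : Measurable fun p : ℝ × (K × ℝˣ) => ‖fourierXU f k p.1 p.2‖ₑ ^ 2 :=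
    ((measurable_fourierXU hf).comp (f := fun p : ℝ × (K × ℝˣ) => ((k, p.1), p.2))
      (by fun_prop)).enorm.pow_const 2
  have hXk' : Measurable fun p : ℝˣ × (K × ℝˣ) =>
      ENNReal.ofReal |(p.1 : ℝ)|⁻¹ * ‖fourierXU f k (p.1 : ℝ)⁻¹ p.2‖ₑ ^ 2 :=
    Measurable.mul (by fun_prop) (hXk.comp
      (f := fun p : ℝˣ × (K × ℝˣ) => ((p.1 : ℝ)⁻¹, p.2)) (by fun_prop))
  have s3 : ∀ t : ℝˣ, ∫⁻ y, ‖kernV f (k, t) y‖ₑ ^ 2 ∂haarZ = ENNReal.ofReal (normSq (freqVec k)) *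
      ∫⁻ y, ENNReal.ofReal |(t : ℝ)|⁻¹ * ‖fourierXU f k (t : ℝ)⁻¹ y‖ₑ ^ 2 ∂densMeasure k := by
    intro t
    have hXt : Measurable fun y : K × ℝˣ =>
        ENNReal.ofReal |(t : ℝ)|⁻¹ * ‖fourierXU f k (t : ℝ)⁻¹ y‖ₑ ^ 2 :=
      measurable_section_left (fun (t : ℝˣ) y =>
        ENNReal.ofReal |(t : ℝ)|⁻¹ * ‖fourierXU f k (t : ℝ)⁻¹ y‖ₑ ^ 2) hXk' t
    have hdX : Measurable fun y : K × ℝˣ => ENNReal.ofReal (dens k y) *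
      (ENNReal.ofReal |(t : ℝ)|⁻¹ * ‖fourierXU f k (t : ℝ)⁻¹ y‖ₑ ^ 2) := hdk.mul hXt
    rw [lintegral_densMeasure k hXt, ← lintegral_const_mul _ hdX]
    exact lintegral_congr fun y => enorm_kernV_sq (k, t) y
  simp only [s3]
  rw [lintegral_const_mul _ hXk'.lintegral_prod_right', lintegral_lintegral_swap hXk'.aemeasurable]
  congr 1
  refine lintegral_congr fun y => ?_
  exact lintegral_haarRstar_inv (G := fun τ => ‖fourierXU f k τ y‖ₑ ^ 2)
    (measurable_section_right (fun τ y => ‖fourierXU f k τ y‖ₑ ^ 2) hXk y)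

/-- The Hilbert–Schmidt norm of the kernel of `σ(f) T` is the `L²` norm of `f`. -/
theorem lintegral_kern (hf : Measurable f) (h1 : Integrable f G2.haar) (h2 : MemLp f 2 G2.haar) :
    ∫⁻ p, ‖kern f p.1 p.2‖ₑ ^ 2 ∂haarZ.prod haarZ = ∫⁻ g, ‖f g‖ₑ ^ 2 ∂G2.haar := by
  obtain ⟨h, hh, hfh⟩ := G2.measurableEmbedding_coords.exists_measurable_extend hf
    (fun _ => inferInstance)
  replace hfh : ∀ g, f g = h g.coords := fun g => (congrFun hfh g).symm
  have e1 : ∫⁻ g, ‖f g‖ₑ ∂G2.haar = ∫⁻ p, detWeight p.2 * ‖h p‖ₑ := by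
    simp only [hfh]
    exact lintegral_haar_G2 (h := fun p => ‖h p‖ₑ) (by fun_prop)
  have e2 : ∫⁻ g, ‖f g‖ₑ ^ 2 ∂G2.haar = ∫⁻ p, detWeight p.2 * ‖h p‖ₑ ^ 2 := by
    simp only [hfh]
    exact lintegral_haar_G2 (h := fun p => ‖h p‖ₑ ^ 2) (by fun_prop)
  have b1 : ∫⁻ p, detWeight p.2 * ‖h p‖ₑ < ∞ := by rw [← e1]; exact h1.2
  have b2 : ∫⁻ p, detWeight p.2 * ‖h p‖ₑ ^ 2 < ∞ := by
    rw [← e2]; exact (memLp_two_iff_lintegral h2.1).1 h2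
  have hd := measurable_detWeight
  have hF := measurable_fourierX hh
  have mn := measurable_normSq
  have mf := measurable_freqVec
  -- `S ω` links the two Plancherel theorems: as an integral over matrices it comes from Plancherel
  -- in x, and in the chart of ω it is the input of Plancherel in u.
  set S : (Fin 2 → ℝ) → ℝ≥0∞ := fun ω => ∫⁻ a, detWeight a * ‖fourierX h ω a‖ₑ ^ 2 with hS
  have hSm : Measurable S := by
    have : Measurable fun p : (Fin 2 → ℝ) × (Fin 2 → Fin 2 → ℝ) =>
      detWeight p.2 * ‖fourierX h p.1 p.2‖ₑ ^ 2 := by fun_prop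
    exact this.lintegral_prod_right' (ν := (volume : Measure (Fin 2 → Fin 2 → ℝ)))
  have hS1 : ∫⁻ k, ENNReal.ofReal (normSq (freqVec k)) * S (freqVec k) ∂haarK
      = ∫⁻ g, ‖f g‖ₑ ^ 2 ∂G2.haar := by
    rw [lintegral_normSq_haarK hSm, e2, ← lintegral_fourierX hh b1 b2]
  have hS2 : ∀ k, S (freqVec k) = ∫⁻ z, (∫⁻ u : ℝ,
      ‖fourierX h (freqVec k) (matOf (freqVec k) (freqVec z.1) u z.2)‖ₑ ^ 2) ∂densMeasure k := by
    intro k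
    have hFk : Measurable fun a => fourierX h (freqVec k) a :=
      measurable_section_left (fourierX h) hF (freqVec k)
    exact lintegral_detWeight_eq k (hFk.enorm.pow_const 2)
  -- Finiteness of the total integral gives that of S almost everywhere, as ‖ω‖² ≠ 0; this supplies
  -- the L² hypothesis in u.
  have hSk : ∀ᵐ k ∂haarK, S (freqVec k) < ∞ := by
    have hfin : ∫⁻ k, ENNReal.ofReal (normSq (freqVec k)) * S (freqVec k) ∂haarK ≠ ∞ := by
      rw [hS1, e2]; exact b2.ne
    filter_upwards [ae_lt_top (by fun_prop) hfin] with k hk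
    refine lt_top_iff_ne_top.2 fun e => ?_
    rw [e, ENNReal.mul_top (by simpa using normSq_pos (freqVec_ne_zero k))] at hk
    exact lt_irrefl _ hk
  have hVm : Measurable fun p : (K × ℝˣ) × (K × ℝˣ) => ‖kernV f p.1 p.2‖ₑ ^ 2 :=
    (measurable_kernV hf).enorm.pow_const 2
  rw [lintegral_prod _ ((measurable_kern hf).enorm.pow_const 2).aemeasurable]
  simp only [lintegral_kern_eq_kernV hf]
  rw [lintegral_prod _ hVm.lintegral_prod_right'.aemeasurable, ← hS1]
  refine lintegral_congr_ae ?_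
  filter_upwards [hSk] with k hk
  rw [hS2] at hk ⊢
  rw [← lintegral_fourierXU h1 hh hfh k hk]
  exact lintegral_kernV hf k

end Kernel

/-! ### A pointwise formula for σ(f). -/

section MatrixCoefficients

instance : SigmaFinite ((volume : Measure ((Fin 2 → ℝ) × (Fin 2 → Fin 2 → ℝ))).comap G2.coords) :=
  SigmaFinite.of_map _ G2.measurable_coords.aemeasurable (by
    rw [G2.measurableEmbedding_coords.map_comap]; infer_instance)

instance : SigmaFinite G2.haar := by unfold G2.haar; infer_instance

/-- The function `(g, (k, t)) ↦ (σ(g) G)(k, t)`, for a function `G` on `K × ℝ*`. -/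
noncomputable def sigmaZ (G : K × ℝˣ → ℂ) (g : G2) (z : K × ℝˣ) : ℂ :=
  (weight (freq z.1) g.A : ℂ) *
    unitExp ((freq z.1).1 ⬝ᵥ g.x + (z.2 : ℝ)⁻¹ * uCoef (freq z.1) g.A) *
    G (gamma (rowMul (freq z.1) g.A), (vCoef (freq z.1) g.A)⁻¹ * z.2)

theorem measurable_sigmaZ {G : K × ℝˣ → ℂ} (hG : Measurable G) :
    Measurable fun p : G2 × (K × ℝˣ) => sigmaZ G p.1 p.2 := by
  have hA : ∀ i j, Measurable fun p : G2 × (K × ℝˣ) => (p.1.A : Matrix (Fin 2) (Fin 2) ℝ) i j :=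
    fun i j => (measurable_entry i j).comp measurable_fst
  have h00 := hA 0 0
  have h01 := hA 0 1
  have h10 := hA 1 0
  have h11 := hA 1 1
  have hdet : Measurable fun p : G2 × (K × ℝˣ) => (p.1.A : Matrix (Fin 2) (Fin 2) ℝ).det :=
    measurable_det.comp measurable_fst
  have hfv : Measurable fun p : G2 × (K × ℝˣ) => (freq p.2.1).1 :=
    measurable_freqVec.comp (measurable_fst.comp measurable_snd)
  have hf0 : Measurable fun p : G2 × (K × ℝˣ) => (freq p.2.1).1 0 :=
    (measurable_pi_apply 0).comp hfv
  have hf1 : Measurable fun p : G2 × (K × ℝˣ) => (freq p.2.1).1 1 :=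
    (measurable_pi_apply 1).comp hfv
  have hx : Measurable fun p : G2 × (K × ℝˣ) => p.1.x :=
    (measurable_fst.comp G2.measurable_coords).comp measurable_fst
  have hr : Measurable fun p : G2 × (K × ℝˣ) => rowMul (freq p.2.1) p.1.A :=
    measurable_rowMul.comp (f := fun p : G2 × (K × ℝˣ) => (p.1, p.2.1)) (by fun_prop)
  have hn : Measurable fun p : G2 × (K × ℝˣ) => normSq (freq p.2.1).1 :=
    measurable_normSq.comp hfv
  have hnr : Measurable fun p : G2 × (K × ℝˣ) => normSq (rowMul (freq p.2.1) p.1.A).1 :=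
    measurable_normSq.comp (measurable_subtype_coe.comp hr)
  have hw : Measurable fun p : G2 × (K × ℝˣ) => weight (freq p.2.1) p.1.A := by
    unfold weight rowNorm
    exact ((hdet.abs.sqrt).mul hn.sqrt).div hnr.sqrt
  have hu : Measurable fun p : G2 × (K × ℝˣ) => uCoef (freq p.2.1) p.1.A := by
    unfold uCoef
    refine Measurable.div ?_ hnr
    fun_prop
  have hv : Measurable fun p : G2 × (K × ℝˣ) => vCoef (freq p.2.1) p.1.A :=
    measurable_comap_iff.2 ((hdet.mul hn).div hnr)
  have hd : Measurable fun p : G2 × (K × ℝˣ) => (freq p.2.1).1 ⬝ᵥ p.1.x :=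
    measurable_dotProduct.comp (hfv.prodMk hx)
  have ht : Measurable fun p : G2 × (K × ℝˣ) => (p.2.2 : ℝ) :=
    measurable_coe_units.comp (measurable_snd.comp measurable_snd)
  have he : Measurable fun p : G2 × (K × ℝˣ) =>
      unitExp ((freq p.2.1).1 ⬝ᵥ p.1.x + (p.2.2 : ℝ)⁻¹ * uCoef (freq p.2.1) p.1.A) :=
    measurable_unitExp.comp (hd.add (ht.inv.mul hu))
  have hGm : Measurable fun p : G2 × (K × ℝˣ) =>
      G (gamma (rowMul (freq p.2.1) p.1.A), (vCoef (freq p.2.1) p.1.A)⁻¹ * p.2.2) :=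
    hG.comp ((measurable_gamma.comp hr).prodMk
      (hv.inv.mul (measurable_snd.comp measurable_snd)))
  exact ((Complex.measurable_ofReal.comp hw).mul he).mul hGm

theorem uncurryH_sigma (g : G2) (G : HSigma) :
    uncurryH (sigma g G) =ᵐ[haarZ] sigmaZ (uncurryH G) g := by
  refine ae_prod_eq_of_ae_ae (Lp.aestronglyMeasurable _)
    (measurable_section_left (sigmaZ (uncurryH G))
      (measurable_sigmaZ (Lp.stronglyMeasurable _).measurable) g).aestronglyMeasurable ?_
  -- The a.e. identity for G is used at the moved point (ωA, v⁻¹t), so null sets are pulled back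
  -- along both substitutions.
  filter_upwards [sigma_apply g G, uncurryH_ae (sigma g G),
    (quasiMeasurePreserving_gamma_rowMul g.A).ae (uncurryH_ae G)] with k h1 h2 h3
  filter_upwards [h1, h2, (measurePreserving_mul_left
    (vCoef (freq k) g.A)⁻¹).quasiMeasurePreserving.ae h3] with t k1 k2 k3
  rw [k2, k1, sigmaZ, k3]

theorem inner_sigma_eq (g : G2) (E G : HSigma) :
    inner ℂ E (sigma g G)
      = ∫ z, starRingEnd ℂ (uncurryH E z) * sigmaZ (uncurryH G) g z ∂haarZ := by
  rw [← uncurryH.inner_map_map, L2.inner_def]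
  refine integral_congr_ae ?_
  filter_upwards [uncurryH_sigma g G] with z hz
  rw [hz, RCLike.inner_apply, mul_comm]

theorem lintegral_enorm_mul_le {X : Type*} [MeasurableSpace X] {μ : Measure X} {a b : X → ℂ}
    (ha : AEStronglyMeasurable a μ) (hb : AEStronglyMeasurable b μ) :
    ∫⁻ x, ‖a x * b x‖ₑ ∂μ ≤ eLpNorm a 2 μ * eLpNorm b 2 μ := by
  have := eLpNorm_smul_le_mul_eLpNorm (p := 2) (q := 2) (r := 1) hb ha
  rwa [eLpNorm_one_eq_lintegral_enorm] at this

variable {f : G2 → ℂ}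

/-- Cauchy–Schwarz in z and unitarity of σ(g) bound the inner integral by |f(g)|‖E‖‖G‖, which is
integrable in g. -/
theorem integrable_mul_sigmaZ (hf : Measurable f) (h1 : Integrable f G2.haar) (E G : HSigma) :
    Integrable (fun p : G2 × (K × ℝˣ) =>
      f p.1 * (starRingEnd ℂ (uncurryH E p.2) * sigmaZ (uncurryH G) p.1 p.2))
      (G2.haar.prod haarZ) := by
  have hE : Measurable (uncurryH E) := (Lp.stronglyMeasurable _).measurable
  have hS := measurable_sigmaZ (G := uncurryH G) (Lp.stronglyMeasurable _).measurable
  have hE' : Measurable fun z => starRingEnd ℂ (uncurryH E z) :=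
    Complex.continuous_conj.measurable.comp hE
  have hm : Measurable fun p : G2 × (K × ℝˣ) =>
      f p.1 * (starRingEnd ℂ (uncurryH E p.2) * sigmaZ (uncurryH G) p.1 p.2) :=
    (hf.comp measurable_fst).mul ((hE'.comp measurable_snd).mul hS)
  refine ⟨hm.aestronglyMeasurable, ?_⟩
  rw [HasFiniteIntegral, lintegral_prod _ hm.enorm.aemeasurable]
  have hle : ∀ g, ∫⁻ z, ‖f g * (starRingEnd ℂ (uncurryH E z) * sigmaZ (uncurryH G) g z)‖ₑ ∂haarZ
      ≤ ‖f g‖ₑ * (‖E‖ₑ * ‖G‖ₑ) := by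
    intro g
    have hSg := measurable_section_left (sigmaZ (uncurryH G)) hS g
    have hmg : Measurable fun z => ‖starRingEnd ℂ (uncurryH E z) * sigmaZ (uncurryH G) g z‖ₑ :=
      (hE'.mul hSg).enorm
    simp only [enorm_mul (f g)]
    rw [lintegral_const_mul _ hmg]
    gcongr
    refine (lintegral_enorm_mul_le hE'.aestronglyMeasurable hSg.aestronglyMeasurable).trans ?_
    have e1 : eLpNorm (fun z => starRingEnd ℂ (uncurryH E z)) 2 haarZ = ‖E‖ₑ := by
      rw [← uncurryH.enorm_map E, Lp.enorm_def]
      exact eLpNorm_congr_norm_ae (.of_forall fun z => RCLike.norm_conj _)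
    have e2 : eLpNorm (sigmaZ (uncurryH G) g) 2 haarZ = ‖G‖ₑ := by
      rw [← eLpNorm_congr_ae (uncurryH_sigma g G), ← Lp.enorm_def, uncurryH.enorm_map,
        (sigma g).enorm_map]
    rw [e1, e2]
  refine (lintegral_mono hle).trans_lt ?_
  rw [lintegral_mul_const _ hf.enorm]
  exact ENNReal.mul_lt_top h1.2 (ENNReal.mul_lt_top enorm_lt_top enorm_lt_top)

/-- σ(f) is defined only weakly; Fubini shows that it is given by integrating f(g)(σ(g)G)(z) over g.
-/
theorem inner_sigmaL1_eq (hf : Measurable f) (h1 : MemLp f 1 G2.haar) (E G : HSigma) :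
    inner ℂ E (sigmaL1 f h1 G) = ∫ z, starRingEnd ℂ (uncurryH E z) *
      ∫ g, f g * sigmaZ (uncurryH G) g z ∂G2.haar ∂haarZ := by
  rw [(inner_sigmaL1 f h1 G E).2]
  have e : ∀ g, f g * inner ℂ E (sigma g G)
      = ∫ z, f g * (starRingEnd ℂ (uncurryH E z) * sigmaZ (uncurryH G) g z) ∂haarZ := fun g => by
    rw [inner_sigma_eq, integral_const_mul]
  rw [integral_congr_ae (.of_forall e),
    integral_integral_swap (integrable_mul_sigmaZ hf (memLp_one_iff_integrable.1 h1) E G)]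
  refine integral_congr_ae (.of_forall fun z => ?_)
  beta_reduce
  rw [← integral_const_mul]
  refine integral_congr_ae (.of_forall fun g => ?_)
  exact mul_left_comm _ _ _

end MatrixCoefficients

/-! ### σ(f)T as an integral operator. -/

section KernelFormula

variable {f : G2 → ℂ}

/-- In the chart of the output point, x and u survive only in the characters, so integrating them
against f yields `fourierXU`. -/
theorem sigmaZ_psi (G : K × ℝˣ → ℂ) (z y : K × ℝˣ) (q : (Fin 2 → ℝ) × ℝ) :
    sigmaZ G (psi z.1 (y, q)) z = (√|(y.2 : ℝ)| : ℂ) * G (y.1, y.2⁻¹ * z.2) *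
      (unitExp (freqVec z.1 ⬝ᵥ q.1) * unitExp ((z.2 : ℝ)⁻¹ * q.2)) := by
  have e : gamma (freq y.1) = y.1 := gamma_freq _
  simp only [sigmaZ, psi, weight_matGL, uCoef_matGL, vCoef_matGL, rowMul_matGL, e, unitExp_add]
  simp only [freq]
  ring

/-- With v = t/s the product is ‖ω‖²‖η‖⁻²|v|⁻² · |v|^{1/2} · ‖η‖|s|^{-1/2}, and |s|^{-1/2} =
|v|^{1/2}|t|^{-1/2}. -/
theorem kernFactor_eq (z : K × ℝˣ) (k' : K) (s : ℝˣ) :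
    dens z.1 (k', z.2 * s⁻¹) * √|((z.2 * s⁻¹ : ℝˣ) : ℝ)| * weightT k' s
      = kernFactor z (k', z.2 * s⁻¹) := by
  have hr := rowNorm_pos (freqVec_ne_zero k')
  have h2 : normSq (freqVec k') = rowNorm (freqVec k') ^ 2 :=
    (Real.sq_sqrt (normSq_nonneg _)).symm
  have ht : 0 < √|(z.2 : ℝ)| := Real.sqrt_pos.2 (abs_pos.2 z.2.ne_zero)
  have hs : 0 < √|(s : ℝ)| := Real.sqrt_pos.2 (abs_pos.2 s.ne_zero)
  have ht2 : |(z.2 : ℝ)| = √|(z.2 : ℝ)| ^ 2 := (Real.sq_sqrt (abs_nonneg _)).symm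
  have hs2 : |(s : ℝ)| = √|(s : ℝ)| ^ 2 := (Real.sq_sqrt (abs_nonneg _)).symm
  simp only [dens, weightT_eq, kernFactor, Units.val_mul, Units.val_inv_eq_inv_val, abs_mul,
    abs_inv, Real.sqrt_mul (abs_nonneg _), Real.sqrt_inv, h2]
  generalize √|(z.2 : ℝ)| = a at *
  generalize √|(s : ℝ)| = b at *
  rw [ht2, hs2]
  field_simp

theorem integral_mul_sigmaZ (F : opT.domain) (z : K × ℝˣ)
    (hi : Integrable (fun g => f g * sigmaZ (uncurryH (opT F)) g z) G2.haar) :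
    ∫ g, f g * sigmaZ (uncurryH (opT F)) g z ∂G2.haar
      = ∫ y, kern f z y * uncurryH F y ∂haarZ := by
  have hψ := measurePreserving_psi z.1
  have hip : Integrable (fun p => f (psi z.1 p) * sigmaZ (uncurryH (opT F)) (psi z.1 p) z)
      ((densMeasure z.1).prod volume) := hψ.integrable_comp_of_integrable hi
  rw [← hψ.map_eq, integral_map hψ.measurable.aemeasurable (by rw [hψ.map_eq]; exact hi.1),
    integral_prod _ hip]
  have e1 : ∀ y, ∫ q, f (psi z.1 (y, q)) * sigmaZ (uncurryH (opT F)) (psi z.1 (y, q)) z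
      = (√|(y.2 : ℝ)| : ℂ) * uncurryH (opT F) (y.1, y.2⁻¹ * z.2)
        * fourierXU f z.1 (z.2 : ℝ)⁻¹ y := by
    intro y
    rw [fourierXU, ← integral_const_mul]
    refine integral_congr_ae (.of_forall fun q => ?_)
    simp only [sigmaZ_psi]
    ring
  simp only [e1]
  have hdm : Measurable fun y => dens z.1 y := measurable_section_left dens measurable_dens z.1
  rw [densMeasure, integral_withDensity_eq_integral_toReal_smul hdm.ennreal_ofReal
    (.of_forall fun y => ENNReal.ofReal_lt_top)]
  have hdn : ∀ y, 0 ≤ dens z.1 y := by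
    intro y
    have h1 := normSq_nonneg (freqVec z.1)
    have h2 := normSq_nonneg (freqVec y.1)
    unfold dens; positivity
  simp only [ENNReal.toReal_ofReal (hdn _)]
  have hdiv := measurePreserving_div z.2
  let e : (K × ℝˣ) ≃ᵐ (K × ℝˣ) :=
    { toFun := fun y => (y.1, z.2 * y.2⁻¹)
      invFun := fun y => (y.1, z.2 * y.2⁻¹)
      left_inv := div_invol z.2
      right_inv := div_invol z.2
      measurable_toFun := hdiv.measurable
      measurable_invFun := hdiv.measurable }
  -- Substituting v = t/s turns the argument v⁻¹t of TF into s, where TF is the weight of T times F.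
  rw [← hdiv.integral_comp e.measurableEmbedding]
  refine integral_congr_ae ?_
  filter_upwards [apply_ae_of_graph mem_graph_opT_iff F] with y hy
  have e2 : ((z.2 * y.2⁻¹)⁻¹ * z.2 : ℝˣ) = y.2 := by group
  simp only [e2, hy, kern, kernV, ← kernFactor_eq, Complex.real_smul]
  push_cast
  ring

end KernelFormula

/-! ### The Hilbert–Schmidt extension and its norm. -/

section Main

variable {f : G2 → ℂ}

theorem memLp_conj_kern (hf : Measurable f) (h1 : Integrable f G2.haar)
    (h2 : MemLp f 2 G2.haar) :
    MemLp (fun p : (K × ℝˣ) × (K × ℝˣ) => starRingEnd ℂ (kern f p.1 p.2)) 2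
      (haarZ.prod haarZ) := by
  have hm : Measurable fun p : (K × ℝˣ) × (K × ℝˣ) => starRingEnd ℂ (kern f p.1 p.2) :=
    Complex.continuous_conj.measurable.comp (measurable_kern hf)
  rw [memLp_two_iff_lintegral hm.aestronglyMeasurable]
  simp only [RCLike.enorm_conj]
  rw [lintegral_kern hf h1 h2]
  exact (memLp_two_iff_lintegral h2.1).1 h2

/-- The conjugate of the kernel of `σ(f) T`, as an element of `L²(Z, L²(Z))`. -/
noncomputable def kernLp (hf : Measurable f) (h1 : Integrable f G2.haar)
    (h2 : MemLp f 2 G2.haar) : Lp (Lp ℂ 2 haarZ) 2 haarZ :=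
  (uncurryLp haarZ haarZ).symm (memLp_conj_kern hf h1 h2).toLp

theorem enorm_kernLp (hf : Measurable f) (h1 : Integrable f G2.haar) (h2 : MemLp f 2 G2.haar) :
    ‖kernLp hf h1 h2‖ₑ ^ 2 = eLpNorm f 2 G2.haar ^ 2 := by
  rw [kernLp, LinearIsometryEquiv.enorm_map, Lp.enorm_def,
    eLpNorm_congr_ae (memLp_conj_kern hf h1 h2).coeFn_toLp, ← lintegral_enorm_sq,
    ← lintegral_enorm_sq]
  simp only [RCLike.enorm_conj]
  exact lintegral_kern hf h1 h2

theorem hsOp_kernLp (hf : Measurable f) (h1 : Integrable f G2.haar) (h2 : MemLp f 2 G2.haar)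
    (ξ : Lp ℂ 2 haarZ) :
    hsOp (kernLp hf h1 h2) ξ =ᵐ[haarZ] fun z => ∫ y, kern f z y * ξ y ∂haarZ := by
  have e := uncurryLp_ae (kernLp hf h1 h2)
  rw [kernLp, LinearIsometryEquiv.apply_symm_apply] at e
  filter_upwards [hsOp_coe (kernLp hf h1 h2) ξ, e,
    Measure.ae_ae_of_ae_prod (memLp_conj_kern hf h1 h2).coeFn_toLp] with z k1 k2 k3
  rw [k1, L2.inner_def]
  refine integral_congr_ae ?_
  filter_upwards [k2, k3] with y j1 j2
  -- The inner product conjugates its first argument, which undoes the conjugation built into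
  -- `kernLp`.
  rw [RCLike.inner_apply, kernLp, ← j1, j2, Complex.conj_conj, mul_comm]

/-- The Hilbert–Schmidt operator which extends `σ(f) T`. -/
noncomputable def hsExtension (hf : Measurable f) (h1 : Integrable f G2.haar)
    (h2 : MemLp f 2 G2.haar) : HSigma →L[ℂ] HSigma :=
  (uncurryH.symm : Lp ℂ 2 haarZ →L[ℂ] HSigma) ∘L hsOp (kernLp hf h1 h2) ∘L
    (uncurryH : HSigma →L[ℂ] Lp ℂ 2 haarZ)

theorem hsExtension_apply (hf : Measurable f) (h1 : Integrable f G2.haar)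
    (h2 : MemLp f 2 G2.haar) (F : HSigma) :
    hsExtension hf h1 h2 F = uncurryH.symm (hsOp (kernLp hf h1 h2) (uncurryH F)) := rfl

theorem hsExtension_eq (hf : Measurable f) (h1 : MemLp f 1 G2.haar) (h2 : MemLp f 2 G2.haar)
    (F : opT.domain) :
    hsExtension hf (memLp_one_iff_integrable.1 h1) h2 F = sigmaL1 f h1 (opT F) := by
  have h1' := memLp_one_iff_integrable.1 h1
  refine ext_inner_left ℂ fun E => ?_
  rw [inner_sigmaL1_eq hf h1, ← uncurryH.inner_map_map, hsExtension_apply,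
    LinearIsometryEquiv.apply_symm_apply, L2.inner_def]
  refine integral_congr_ae ?_
  filter_upwards [hsOp_kernLp hf h1' h2 (uncurryH F),
    (integrable_mul_sigmaZ hf h1' E (opT F)).prod_left_ae] with z k1 k2
  rw [k1, RCLike.inner_apply, mul_comm]
  -- Fubini gives integrability in g only after multiplication by the conjugate of E(z). Where E(z)
  -- = 0 both sides vanish; elsewhere the factor can be divided out.
  by_cases h0 : uncurryH E z = 0
  · simp [h0]
  · congr 1
    refine (integral_mul_sigmaZ F z ?_).symm
    have h0' : starRingEnd ℂ (uncurryH E z) ≠ 0 := (map_ne_zero _).2 h0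
    have := k2.const_mul (starRingEnd ℂ (uncurryH E z))⁻¹
    refine this.congr (.of_forall fun g => ?_)
    simp only
    field_simp

theorem tsum_enorm_hsExtension_sq (hf : Measurable f) (h1 : Integrable f G2.haar)
    (h2 : MemLp f 2 G2.haar) {ι : Type} (b : HilbertBasis ι ℂ HSigma) :
    ∑' i, ‖hsExtension hf h1 h2 (b i)‖ₑ ^ 2 = eLpNorm f 2 G2.haar ^ 2 := by
  -- The image of b under the unitary `uncurryH`, so the kernel computation on L²(K × ℝ*) applies.
  let b' : HilbertBasis ι ℂ (Lp ℂ 2 haarZ) := HilbertBasis.ofRepr (uncurryH.symm.trans b.repr)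
  have hb : ∀ i, b' i = uncurryH (b i) := fun i => by
    classical
    rw [← b'.repr_symm_single i, ← b.repr_symm_single i]
    rfl
  rw [← enorm_kernLp hf h1 h2, ← tsum_enorm_hsOp_sq b' (kernLp hf h1 h2)]
  simp only [hb, hsExtension_apply, LinearIsometryEquiv.enorm_map]

/-- The weak formula sees only the class of f, so f may be replaced by a measurable representative.
-/
theorem sigmaL1_congr {f f' : G2 → ℂ} (hf : MemLp f 1 G2.haar) (hf' : MemLp f' 1 G2.haar)
    (h : f =ᵐ[G2.haar] f') (F : HSigma) : sigmaL1 f hf F = sigmaL1 f' hf' F := by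
  refine ext_inner_left ℂ fun E => ?_
  rw [(inner_sigmaL1 f hf F E).2, (inner_sigmaL1 f' hf' F E).2]
  refine integral_congr_ae ?_
  filter_upwards [h] with g hg
  rw [hg]

theorem hasSum_of_tsum_enorm_sq {ι E : Type*} [NormedAddCommGroup E] {a : ι → E} {c : ℝ≥0∞}
    (hc : c ≠ ∞) (h : ∑' i, ‖a i‖ₑ ^ 2 = c ^ 2) : HasSum (fun i => ‖a i‖ ^ 2) (c.toReal ^ 2) := by
  have hne : ∑' i, ‖a i‖ₑ ^ 2 ≠ ∞ := by rw [h]; exact ENNReal.pow_ne_top hc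
  have := ENNReal.hasSum_toReal hne
  rw [← ENNReal.tsum_toReal_eq (ENNReal.ne_top_of_tsum_ne_top hne), h, ENNReal.toReal_pow] at this
  simpa only [ENNReal.toReal_pow, toReal_enorm] using this

end Main

end AffinePlane

theorem mainTheorem5 :
    IsSelfAdjoint AffinePlane.opT ∧
    (∀ F : AffinePlane.opT.domain,
      0 ≤ (inner ℂ (F : AffinePlane.HSigma) (AffinePlane.opT F)).re) ∧
    ∀ (f : AffinePlane.G2 → ℂ) (hf₁ : MeasureTheory.MemLp f 1 AffinePlane.G2.haar),
      MeasureTheory.MemLp f 2 AffinePlane.G2.haar →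
      ∃ R : AffinePlane.HSigma →L[ℂ] AffinePlane.HSigma,
        (∀ F : AffinePlane.opT.domain,
          R (F : AffinePlane.HSigma) = AffinePlane.sigmaL1 f hf₁ (AffinePlane.opT F)) ∧
        AffinePlane.IsHilbertSchmidt R ∧
        ∀ (ι : Type) (b : HilbertBasis ι ℂ AffinePlane.HSigma),
          (MeasureTheory.eLpNorm f 2 AffinePlane.G2.haar).toReal = AffinePlane.hsNorm b R := by
  refine ⟨AffinePlane.isSelfAdjoint_opT, AffinePlane.re_inner_opT_nonneg, fun f hf₁ hf₂ => ?_⟩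
  -- The kernel integrates f over charts that vary with k, so its joint measurability is obtained
  -- from a genuinely measurable representative of f.
  have hae := hf₁.1.ae_eq_mk
  have hm := hf₁.1.stronglyMeasurable_mk.measurable
  have h1 := (memLp_congr_ae hae).1 hf₁
  have h2 := (memLp_congr_ae hae).1 hf₂
  have hs : ∀ (ι : Type) (b : HilbertBasis ι ℂ AffinePlane.HSigma), HasSum
      (fun i => ‖AffinePlane.hsExtension hm (memLp_one_iff_integrable.1 h1) h2 (b i)‖ ^ 2)
      ((eLpNorm f 2 AffinePlane.G2.haar).toReal ^ 2) := by
    intro ι b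
    refine AffinePlane.hasSum_of_tsum_enorm_sq hf₂.2.ne ?_
    exact (AffinePlane.tsum_enorm_hsExtension_sq hm _ h2 b).trans
      (congrArg (· ^ 2) (eLpNorm_congr_ae hae).symm)
  refine ⟨AffinePlane.hsExtension hm (memLp_one_iff_integrable.1 h1) h2, fun F => ?_,
    fun ι b => (hs ι b).summable, fun ι b => ?_⟩
  · rw [AffinePlane.hsExtension_eq hm h1 h2 F]
    exact (AffinePlane.sigmaL1_congr hf₁ h1 hae _).symm
  · rw [AffinePlane.hsNorm, (hs ι b).tsum_eq, Real.sqrt_sq ENNReal.toReal_nonneg]
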